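/- Let $k$ be a commutative ring and $S$ a set. A \emph{$k$-quiver} on $S$ is a family $Q=(Q(a,b))_{a,b\in S}$ of $k$-modules; morphisms are families of $k$-linear maps. $k$-quivers on $S$ form a monoidal category with $(Q\otimes_S P)(a,b)=\bigoplus_{c\in S}Q(a,c)\otimes_k P(c,b)$ and unit $I_S$, where $I_S(a,a)=k$ and $I_S(a,b)=0$ for $a\neq b$. Let $\Delta_f$ be the category with objects $[n]=\{0<\dots<n\}$, $n\ge 0$, and as morphisms $[m]\to[n]$ the order preserving maps $f$ with $f(0)=0$ and $f(m)=n$; it is strict monoidal with $[m]+[n]=[m+n]$ and unit $[0]$. A \emph{templicial $k$-module} $(X,S)$ is a colax monoidal functor $X$ from $\Delta_f^{op}$ to $k$-quivers on $S$, with comultiplications $\mu_{k,l}:X_{k+l}\to X_k\otimes_S X_l$, whose counit $X_0\to I_S$ is an isomorphism. It is \emph{levelwise flat} if every $k$-module $X_n(a,b)$ ($n\ge 0$, $a,b\in S$) is flat. For a simplicial set $K$, the \emph{free} templicial $k$-module $\tilde F(K)$ has vertex set $K_0$, its module $\tilde F(K)_n(a,b)$ is the free $k$-module on the $n$-simplices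 of $K$ with first vertex $a$ and last vertex $b$, morphisms of $\Delta_f$ act as in $K$, and $\mu_{k,l}(x)=x|_{\{0,\dots,k\}}\otimes x|_{\{k,\dots,k+l\}}$. Let $\mathcal Nec$ be the category of necklaces: objects are pairs $(T,p)$ with $p\ge 0$ and $\{0,p\}\subseteq T\subseteq[p]$; morphisms $(T,p)\to(U,q)$ are the morphisms $f:[p]\to[q]$ of $\Delta_f$ with $U\subseteq f(T)$. A \emph{necklicial $k$-module} is a functor $Y:\mathcal Nec^{op}\to\mathrm{Mod}(k)$. Each templicial $k$-module $(X,S)$ yields a functor $X_\bullet$ from $\mathcal Nec^{op}$ to $k$-quivers on $S$ with $X_T=X_{t_1}\otimes_S X_{t_2-t_1}\otimes_S\dots\otimes_S X_{p-t_{m-1}}$ for $T=\{0=t_0<t_1<\dots<t_m=p\}$ (and $X_{\{0\}}=I_S\cong X_0$), on which a morphism $f$ with $f(T)=U$ acts by applying $X$ to the restrictions of $f$ to the beads of $T$, and a morphism with underlying map $\mathrm{id}_{[p]}$ acts by the comultiplications. Hence one has necklicial $k$-modules $X_\bullet(a,b)$ for $a,b\in S$. A necklicial $k$-module $Y$ is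 \emph{weak Kan} if for all $0<j<n$ every morphism $\tilde F(\Lambda^n_j)_\bullet(0,n)\to Y$ of necklicial $k$-modules extends along the morphism $\tilde F(\Lambda^n_j)_\bullet(0,n)\to\tilde F(\Delta^n)_\bullet(0,n)$ induced by the inclusion of the horn $\Lambda^n_j\subseteq\Delta^n$. A templicial $k$-module $(X,S)$ is a \emph{quasi-category in $\mathrm{Mod}(k)$} if $X_\bullet(a,b)$ is weak Kan for all $a,b\in S$. For a necklicial $k$-module $Y$ and a $k$-module $N$, let $Y\otimes_k N$ be the necklicial $k$-module with $(Y\otimes_k N)_T=Y_T\otimes_k N$. \textbf{Theorem.} Let $(X,S)$ be a levelwise flat quasi-category in $\mathrm{Mod}(k)$. Then for every $k$-module $N$ and all $a,b\in S$, the necklicial $k$-module $X_\bullet(a,b)\otimes_k N$ is weak Kan. -/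

import Mathlib

open CategoryTheory MonoidalCategory Opposite Functor.OplaxMonoidal

universe u

namespace Templicial

/-! ## The finite interval category -/

/-- Objects of the finite interval category: the ordinals `[n] = {0 < ... < n}`. -/
@[ext]
structure Fint where
  len : ℕ

namespace Fint

/-- Order preserving maps `[m] → [n]` that preserve both endpoints. -/
@[ext]
structure Hom (m n : Fint) where
  toOrderHom : Fin (m.len + 1) →o Fin (n.len + 1)
  map_zero : toOrderHom 0 = 0
  map_last : toOrderHom (Fin.last m.len) = Fin.last n.len

instance : Category Fint where
  Hom := Hom
  id m := ⟨OrderHom.id, rfl, rfl⟩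
  comp f g := ⟨g.toOrderHom.comp f.toOrderHom,
    by simp [f.map_zero, g.map_zero], by simp [f.map_last, g.map_last]⟩

/-- The underlying order preserving map of a morphism. -/
def fn {m n : Fint} (f : m ⟶ n) : Fin (m.len + 1) →o Fin (n.len + 1) := Hom.toOrderHom f

@[simp] lemma fn_zero {m n : Fint} (f : m ⟶ n) : fn f 0 = 0 := Hom.map_zero f

@[simp] lemma fn_last {m n : Fint} (f : m ⟶ n) : fn f (Fin.last m.len) = Fin.last n.len :=
  Hom.map_last f

@[simp] lemma fn_id (m : Fint) (i : Fin (m.len + 1)) : fn (𝟙 m) i = i := rfl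

@[simp] lemma fn_comp {m n l : Fint} (f : m ⟶ n) (g : n ⟶ l) (i : Fin (m.len + 1)) :
    fn (f ≫ g) i = fn g (fn f i) := rfl

lemma hom_ext {m n : Fint} {f g : m ⟶ n}
    (h : ∀ i : Fin (m.len + 1), (fn f i : ℕ) = fn g i) : f = g :=
  Hom.ext (OrderHom.ext _ _ (funext fun i => Fin.ext (h i)))

/-- Build a morphism from a function on natural numbers. -/
def mkHom (m n : Fint) (φ : ℕ → ℕ) (h0 : φ 0 = 0) (hl : φ m.len = n.len)
    (hm : ∀ i j, i ≤ j → j ≤ m.len → φ i ≤ φ j) : m ⟶ n where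
  toOrderHom :=
    { toFun := fun i => ⟨φ i, Nat.lt_succ_of_le
        (hl ▸ hm i m.len (Nat.le_of_lt_succ i.2) le_rfl)⟩
      monotone' := fun i j hij => hm i j hij (Nat.le_of_lt_succ j.2) }
  map_zero := Fin.ext h0
  map_last := Fin.ext hl

@[simp] lemma fn_mkHom (m n : Fint) (φ : ℕ → ℕ) (h0 : φ 0 = 0) (hl : φ m.len = n.len)
    (hm : ∀ i j, i ≤ j → j ≤ m.len → φ i ≤ φ j) (i : Fin (m.len + 1)) :
    (fn (mkHom m n φ h0 hl hm) i : ℕ) = φ i := rfl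

/-- The value at `i` of a morphism, as a function on natural numbers (constant after `m`). -/
def val {m n : Fint} (f : m ⟶ n) (i : ℕ) : ℕ :=
  fn f ⟨min i m.len, Nat.lt_succ_of_le (min_le_right _ _)⟩

lemma fn_eq_val {m n : Fint} (f : m ⟶ n) (i : Fin (m.len + 1)) : (fn f i : ℕ) = val f i := by
  unfold val
  congr 3
  exact Fin.ext (by have := i.2; show (i : ℕ) = min (i : ℕ) m.len; omega)

@[simp] lemma val_zero {m n : Fint} (f : m ⟶ n) : val f 0 = 0 := by
  have := fn_eq_val f 0
  simpa using this.symm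

lemma val_of_ge {m n : Fint} (f : m ⟶ n) {i : ℕ} (h : m.len ≤ i) : val f i = n.len := by
  have := fn_eq_val f (Fin.last _)
  rw [fn_last] at this
  simp only [Fin.val_last] at this
  exact (congrArg (fun j => (fn f j : ℕ))
    (Fin.ext (show min i m.len = min m.len m.len by omega)) : val f i = val f m.len).trans this.symm

lemma val_mono {m n : Fint} (f : m ⟶ n) {i j : ℕ} (h : i ≤ j) : val f i ≤ val f j :=
  (fn f).monotone (Fin.mk_le_mk.2 (by omega))

lemma val_le {m n : Fint} (f : m ⟶ n) (i : ℕ) : val f i ≤ n.len :=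
  Nat.le_of_lt_succ (Fin.is_lt _)

lemma val_id (m : Fint) {i : ℕ} (h : i ≤ m.len) : val (𝟙 m) i = i := by
  simp [val, h]

lemma val_comp {m n l : Fint} (f : m ⟶ n) (g : n ⟶ l) (i : ℕ) :
    val (f ≫ g) i = val g (val f i) := by
  rw [val, fn_comp, fn_eq_val]; rfl

lemma val_mkHom (m n : Fint) (φ : ℕ → ℕ) (h0 : φ 0 = 0) (hl : φ m.len = n.len)
    (hm : ∀ i j, i ≤ j → j ≤ m.len → φ i ≤ φ j) {i : ℕ} (h : i ≤ m.len) :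
    val (mkHom m n φ h0 hl hm) i = φ i := by
  simp [val, h]

lemma hom_ext_val {m n : Fint} {f g : m ⟶ n}
    (h : ∀ i ≤ m.len, val f i = val g i) : f = g :=
  hom_ext fun i => by rw [fn_eq_val, fn_eq_val, h i (Nat.le_of_lt_succ i.2)]

/-- The identification `[m] = [n]` for `m = n`. -/
def castIso {m n : Fint} (h : m.len = n.len) : m ≅ n where
  hom := mkHom m n id rfl h (fun _ _ h _ => h)
  inv := mkHom n m id rfl h.symm (fun _ _ h _ => h)
  hom_inv_id := hom_ext fun _ => rfl
  inv_hom_id := hom_ext fun _ => rfl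

lemma val_castIso_hom {m n : Fint} (h : m.len = n.len) {i : ℕ} (hi : i ≤ m.len) :
    val (castIso h).hom i = i := by
  simp [castIso, val_mkHom _ _ _ _ _ _ hi]

lemma val_castIso_hom_min {m n : Fint} (h : m.len = n.len) (i : ℕ) :
    val (castIso h).hom i = min i m.len := rfl

/-- The sum `f + g : [m + m'] → [n + n']`: it is `f` on the first `m` steps and `g` on the
last `m'` steps. -/
def add {m n m' n' : Fint} (f : m ⟶ n) (g : m' ⟶ n') :
    (⟨m.len + m'.len⟩ : Fint) ⟶ ⟨n.len + n'.len⟩ :=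
  mkHom _ _ (fun i => val f i + val g (i - m.len)) (by simp)
    (by simp [val_of_ge])
    (fun _ _ h _ => Nat.add_le_add (val_mono f h) (val_mono g (by omega)))

lemma val_add {m n m' n' : Fint} (f : m ⟶ n) (g : m' ⟶ n') {i : ℕ} (hi : i ≤ m.len + m'.len) :
    val (add f g) i = val f i + val g (i - m.len) := val_mkHom _ _ _ _ _ _ hi

instance : MonoidalCategoryStruct Fint where
  tensorObj m n := ⟨m.len + n.len⟩
  whiskerLeft m _ _ f := add (𝟙 m) f
  whiskerRight f m := add f (𝟙 m)
  tensorHom f g := add f g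
  tensorUnit := ⟨0⟩
  associator _ _ _ := castIso (Nat.add_assoc _ _ _)
  leftUnitor _ := castIso (Nat.zero_add _)
  rightUnitor _ := castIso (Nat.add_zero _)

lemma tensorObj_len (m n : Fint) : (m ⊗ n).len = m.len + n.len := rfl

lemma val_tensorHom {m n m' n' : Fint} (f : m ⟶ n) (g : m' ⟶ n') {i : ℕ}
    (hi : i ≤ m.len + m'.len) : val (f ⊗ₘ g) i = val f i + val g (i - m.len) := val_add f g hi

lemma val_associator {m n l : Fint} {i : ℕ} (hi : i ≤ m.len + n.len + l.len) :
    val (α_ m n l).hom i = i := val_castIso_hom _ hi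

lemma val_leftUnitor {m : Fint} {i : ℕ} (hi : i ≤ 0 + m.len) :
    val (λ_ m).hom i = i := val_castIso_hom _ hi

lemma val_rightUnitor {m : Fint} {i : ℕ} (hi : i ≤ m.len + 0) :
    val (ρ_ m).hom i = i := val_castIso_hom _ hi

lemma val_id_min (m : Fint) (i : ℕ) : val (𝟙 m) i = min i m.len := rfl

/-- The strict monoidal structure `[m] + [n] = [m + n]`. -/
instance : MonoidalCategory Fint := MonoidalCategory.ofTensorHom
  (id_tensorHom_id := fun m n => hom_ext_val fun i hi => by
    rw [val_tensorHom _ _ hi, val_id_min, val_id_min, val_id_min]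
    rw [tensorObj_len] at *; omega)
  (id_tensorHom := fun _ _ _ _ => rfl)
  (tensorHom_id := fun _ _ => rfl)
  (tensorHom_comp_tensorHom := fun {X₁ Y₁ Z₁ X₂ Y₂ Z₂} f g f' g' => hom_ext_val fun i hi => by
    have hi' : i ≤ X₁.len + X₂.len := hi
    have h1 := val_le f i
    have h2 := val_le g (i - X₁.len)
    rw [val_comp, val_tensorHom _ _ hi, val_tensorHom _ _ (by omega), val_tensorHom _ _ hi,
      val_comp, val_comp]
    rcases le_total i X₁.len with h | h
    · have e : i - X₁.len = 0 := by omega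
      rw [e, val_zero, val_zero, add_zero, Nat.sub_eq_zero_of_le h1, val_zero]
    · rw [val_of_ge f h, val_of_ge f' (by omega : Y₁.len ≤ Y₁.len + _), val_of_ge f' le_rfl,
        Nat.add_sub_cancel_left])
  (associator_naturality := fun {X₁ X₂ X₃ Y₁ Y₂ Y₃} f g h => hom_ext_val fun i hi => by
    have hi' : i ≤ X₁.len + X₂.len + X₃.len := hi
    have h1 := val_le f i
    have h2 := val_le g (i - X₁.len)
    have h3 := val_le h (i - (X₁.len + X₂.len))
    rcases le_total i (X₁.len + X₂.len) with hh | hh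
    · have e : i - (X₁.len + X₂.len) = 0 := by omega
      have e' : i - X₁.len - X₂.len = 0 := by omega
      rw [val_comp, val_comp, val_tensorHom _ _ hi, val_tensorHom _ _ hh, tensorObj_len, e,
        val_zero, val_associator (by omega), val_associator hi',
        val_tensorHom _ _ (by rw [tensorObj_len]; omega),
        val_tensorHom _ _ (by omega), e', val_zero, add_zero, add_zero]
    · have e' : i - X₁.len - X₂.len = i - (X₁.len + X₂.len) := by omega
      rw [val_comp, val_comp, val_tensorHom _ _ hi, val_of_ge (f ⊗ₘ g) hh, tensorObj_len,
        tensorObj_len, val_associator (by omega), val_associator hi',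
        val_tensorHom _ _ (by rw [tensorObj_len]; omega),
        val_tensorHom _ _ (by omega), e', val_of_ge f (by omega), val_of_ge g (by omega)]
      omega)
  (leftUnitor_naturality := fun {X Y} f => hom_ext_val fun i hi => by
    have hi' : i ≤ 0 + X.len := hi
    have h1 := val_le f i
    rw [val_comp, val_comp, val_tensorHom _ _ hi, val_leftUnitor hi', val_id_min]
    have e : (𝟙_ Fint).len = 0 := rfl
    rw [e, min_eq_right (Nat.zero_le _), zero_add, Nat.sub_zero, val_leftUnitor (by omega)])
  (rightUnitor_naturality := fun {X Y} f => hom_ext_val fun i hi => by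
    have hi' : i ≤ X.len + 0 := hi
    have h1 := val_le f i
    rw [val_comp, val_comp, val_tensorHom _ _ hi, val_rightUnitor hi', val_id_min]
    have e : (𝟙_ Fint).len = 0 := rfl
    rw [e, min_eq_right (Nat.zero_le _), add_zero, val_rightUnitor (by omega)])
  (pentagon := fun W X Y Z => hom_ext_val fun i hi => by
    have hi' : i ≤ W.len + X.len + Y.len + Z.len := hi
    have a1 : ∀ (A B C : Fint) (j : ℕ), val (α_ A B C).hom j = min j (A.len + B.len + C.len) :=
      fun _ _ _ _ => rfl
    have e1 : ((W ⊗ X) ⊗ Y).len = W.len + X.len + Y.len := rfl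
    rw [val_comp, val_comp, val_comp, val_tensorHom _ _ hi, a1, a1, a1, a1,
      val_tensorHom _ _ (by simp only [tensorObj_len]; omega), a1, val_id_min, val_id_min]
    simp only [tensorObj_len]
    omega)
  (triangle := fun X Y => hom_ext_val fun i hi => by
    have hi' : i ≤ X.len + 0 + Y.len := hi
    have a1 : ∀ (A B C : Fint) (j : ℕ), val (α_ A B C).hom j = min j (A.len + B.len + C.len) :=
      fun _ _ _ _ => rfl
    have a2 : ∀ (A : Fint) (j : ℕ), val (λ_ A).hom j = min j (0 + A.len) := fun _ _ => rfl
    have a3 : ∀ (A : Fint) (j : ℕ), val (ρ_ A).hom j = min j (A.len + 0) := fun _ _ => rfl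
    have e : (𝟙_ Fint).len = 0 := rfl
    rw [val_comp, a1, val_tensorHom _ _ (by simp only [tensorObj_len]; omega),
      val_tensorHom _ _ hi, a2, a3, val_id_min, val_id_min]
    simp only [tensorObj_len, e]
    omega)

end Fint

/-! ## Necklaces -/

/-- Necklaces: pairs `(T, p)` with `{0, p} ⊆ T ⊆ [p]`. -/
structure Nec where
  len : ℕ
  joints : Finset (Fin (len + 1))
  zero_mem : 0 ∈ joints
  last_mem : Fin.last len ∈ joints

namespace Nec

/-- Morphisms `(T, p) → (U, q)`: morphisms `f : [p] → [q]` of the finite interval category with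
`U ⊆ f(T)`. -/
@[ext]
structure Hom (T U : Nec) where
  toFint : (⟨T.len⟩ : Fint) ⟶ ⟨U.len⟩
  subset : U.joints ⊆ T.joints.image (Fint.fn toFint)

instance : Category Nec where
  Hom := Hom
  id T := ⟨𝟙 _, fun i hi => Finset.mem_image.2 ⟨i, hi, rfl⟩⟩
  comp f g := ⟨f.toFint ≫ g.toFint, fun i hi => by
    obtain ⟨j, hj, rfl⟩ := Finset.mem_image.1 (g.subset hi)
    obtain ⟨l, hl, rfl⟩ := Finset.mem_image.1 (f.subset hj)
    exact Finset.mem_image.2 ⟨l, hl, rfl⟩⟩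

end Nec

/-! ## The functor on necklaces associated to a colax monoidal functor -/

section Beads

/-- The bead `[b - a]` between two joints `a ≤ b` of `[p]`. -/
def seg {p : ℕ} (a b : Fin (p + 1)) : Fint := ⟨(b : ℕ) - a⟩

lemma seg_len {p : ℕ} (a b : Fin (p + 1)) : (seg a b).len = (b : ℕ) - a := rfl

section

variable {p q r : ℕ} (f : (⟨p⟩ : Fint) ⟶ ⟨q⟩) (g : (⟨q⟩ : Fint) ⟶ ⟨r⟩)
  {a b c d : Fin (p + 1)} {a' b' c' : Fin (q + 1)} {a'' b'' : Fin (r + 1)}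

/-- The restriction `[b - a] → [b' - a']` of `f : [p] → [q]` to the bead between `a ≤ b`, where
`a' = f a` and `b' = f b`. -/
def restr (ha : Fint.fn f a = a') (hb : Fint.fn f b = b') : seg a b ⟶ seg a' b' :=
  Fint.mkHom _ _ (fun i => Fint.val f (a + i) - Fint.val f a) (by simp)
    (by
      subst ha hb
      simp only [seg_len, Fint.fn_eq_val]
      rcases le_total (a : ℕ) b with h | h
      · rw [Nat.add_sub_cancel' h]
      · have := Fint.val_mono f h
        rw [Nat.sub_eq_zero_of_le h, Nat.add_zero]; omega)
    (fun _ _ h _ => Nat.sub_le_sub_right (Fint.val_mono f (by omega)) _)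

variable {f g} in
lemma val_restr (ha : Fint.fn f a = a') (hb : Fint.fn f b = b') {i : ℕ}
    (hi : i ≤ (b : ℕ) - a) :
    Fint.val (restr f ha hb) i = Fint.val f (a + i) - Fint.val f a :=
  Fint.val_mkHom _ _ _ _ _ _ hi

lemma restr_id (ha : Fint.fn (𝟙 (⟨p⟩ : Fint)) a = a) (hb : Fint.fn (𝟙 (⟨p⟩ : Fint)) b = b) :
    restr (𝟙 (⟨p⟩ : Fint)) ha hb = 𝟙 (seg a b) :=
  Fint.hom_ext_val fun i hi => by
    have hi' : i ≤ (b : ℕ) - a := hi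
    have := a.2
    have := b.2
    rw [val_restr _ _ hi, Fint.val_id _ hi, Fint.val_id_min, Fint.val_id_min]
    dsimp only
    omega

lemma restr_comp (ha : Fint.fn f a = a') (hb : Fint.fn f b = b') (ha' : Fint.fn g a' = a'')
    (hb' : Fint.fn g b' = b'') (ha'' : Fint.fn (f ≫ g) a = a'') (hb'' : Fint.fn (f ≫ g) b = b'') :
    restr (f ≫ g) ha'' hb'' = restr f ha hb ≫ restr g ha' hb' :=
  Fint.hom_ext_val fun i hi => by
    have h1 := Fint.val_mono f (Nat.le_add_right (a : ℕ) i)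
    have h2 : Fint.val f (a + i) - Fint.val f a ≤ (b' : ℕ) - a' := by
      rw [← val_restr ha hb hi]; exact Fint.val_le (restr f ha hb) i
    have h3 : (a' : ℕ) = Fint.val f a := by rw [← ha, Fint.fn_eq_val]
    rw [Fint.val_comp, val_restr _ _ hi, val_restr _ _ hi, val_restr _ _ h2,
      Fint.val_comp, Fint.val_comp, h3, Nat.add_sub_cancel' h1]

variable (a b c) in
/-- For `a ≤ b ≤ c` this is the identification `[b - a] + [c - b] = [c - a]`. -/
def glue : seg a b ⊗ seg b c ⟶ seg a c :=
  Fint.mkHom _ _ (fun i => min i ((c : ℕ) - a)) (by simp)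
    (by simp only [seg_len, Fint.tensorObj_len]; omega) (fun _ _ _ _ => by omega)

variable (a b c) in
lemma val_glue {i : ℕ} (hi : i ≤ ((b : ℕ) - a) + (c - b)) :
    Fint.val (glue a b c) i = min i ((c : ℕ) - a) := Fint.val_mkHom _ _ _ _ _ _ hi

lemma glue_restr (h1 : a ≤ b) (h2 : b ≤ c) (ha : Fint.fn f a = a') (hb : Fint.fn f b = b')
    (hc : Fint.fn f c = c') :
    glue a b c ≫ restr f ha hc = (restr f ha hb ⊗ₘ restr f hb hc) ≫ glue a' b' c' :=
  Fint.hom_ext_val fun i hi => by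
    have h1' : (a : ℕ) ≤ b := h1
    have h2' : (b : ℕ) ≤ c := h2
    have hi' : i ≤ ((b : ℕ) - a) + (c - b) := hi
    have m1 := Fint.val_mono f h1'
    have m2 := Fint.val_mono f h2'
    have l1 := Fint.val_le (restr f ha hb) i
    have l2 := Fint.val_le (restr f hb hc) (i - ((b : ℕ) - a))
    simp only [seg_len] at l1 l2
    have hi2 : i - ((b : ℕ) - a) ≤ (c : ℕ) - b := by omega
    have ea : (a' : ℕ) = Fint.val f a := by rw [← ha, Fint.fn_eq_val]
    have eb : (b' : ℕ) = Fint.val f b := by rw [← hb, Fint.fn_eq_val]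
    have ec : (c' : ℕ) = Fint.val f c := by rw [← hc, Fint.fn_eq_val]
    rw [Fint.val_comp, Fint.val_comp, val_glue _ _ _ hi', val_restr _ _ (by omega),
      Fint.val_tensorHom _ _ hi, seg_len, val_glue _ _ _ (by omega), val_restr _ _ hi2]
    rw [val_restr _ _ hi2] at l2
    rw [min_eq_left (by omega : i ≤ (c : ℕ) - a)]
    rcases le_total i ((b : ℕ) - a) with h | h
    · have e : (b : ℕ) + (i - (b - a)) = b := by omega
      rw [val_restr _ _ h] at *
      rw [e]
      omega
    · have e : (b : ℕ) + (i - (b - a)) = a + i := by omega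
      rw [Fint.val_of_ge (restr f ha hb) h, seg_len]
      have := Fint.val_mono f (by omega : (b : ℕ) ≤ a + i)
      have := Fint.val_mono f (by omega : a + i ≤ (c : ℕ))
      rw [e]
      omega

lemma glue_assoc (h1 : a ≤ b) (h2 : b ≤ c) (h3 : c ≤ d) :
    (glue a b c ▷ seg c d) ≫ glue a c d =
      (α_ _ _ _).hom ≫ (seg a b ◁ glue b c d) ≫ glue a b d := by
  have h1' : (a : ℕ) ≤ b := h1
  have h2' : (b : ℕ) ≤ c := h2
  have h3' : (c : ℕ) ≤ d := h3
  refine Fint.hom_ext_val fun i hi => ?_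
  have hi' : i ≤ ((b : ℕ) - a) + (c - b) + (d - c) := hi
  have l1 := Fint.val_le (glue a b c) i
  have l2 := Fint.val_le (glue b c d) (i - ((b : ℕ) - a))
  simp only [seg_len] at l1 l2
  rw [← MonoidalCategory.tensorHom_id, ← MonoidalCategory.id_tensorHom, Fint.val_comp,
    Fint.val_comp, Fint.val_comp, Fint.val_associator (by exact hi'),
    Fint.val_tensorHom _ _ hi, Fint.val_tensorHom _ _ (by
      simp only [seg_len, Fint.tensorObj_len]; omega), Fint.val_id_min, Fint.val_id_min]
  simp only [seg_len, Fint.tensorObj_len]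
  rw [val_glue b c d (by omega)] at *
  rw [val_glue a b d (by omega)]
  rcases le_total i (((b : ℕ) - a) + (c - b)) with h | h
  · rw [val_glue a b c h, val_glue a c d (by omega)]
    omega
  · rw [Fint.val_of_ge (glue a b c) h, seg_len, val_glue a c d (by omega)]
    omega

/-- The empty bead. -/
def segSelf (a : Fin (p + 1)) : seg a a ≅ 𝟙_ Fint := Fint.castIso (Nat.sub_self _)

lemma glue_self_left (_ : a ≤ b) :
    glue a a b = ((segSelf a).hom ▷ seg a b) ≫ (λ_ (seg a b)).hom :=
  Fint.hom_ext_val fun i hi => by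
    have hi' : i ≤ ((a : ℕ) - a) + (b - a) := hi
    have e : (𝟙_ Fint).len = 0 := rfl
    have l := Fint.val_le (segSelf a).hom i
    rw [e] at l
    rw [← MonoidalCategory.tensorHom_id, Fint.val_comp, val_glue _ _ _ hi',
      Fint.val_tensorHom _ _ hi, Fint.val_id_min, Fint.val_leftUnitor (by
        simp only [seg_len]; omega)]
    simp only [seg_len]
    omega

lemma glue_self_right (h : a ≤ b) :
    glue a b b = (seg a b ◁ (segSelf b).hom) ≫ (ρ_ (seg a b)).hom :=
  Fint.hom_ext_val fun i hi => by
    have hi' : i ≤ ((b : ℕ) - a) + (b - b) := hi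
    have e : (𝟙_ Fint).len = 0 := rfl
    have l := Fint.val_le (segSelf b).hom (i - ((b : ℕ) - a))
    rw [e] at l
    rw [← MonoidalCategory.id_tensorHom, Fint.val_comp, val_glue _ _ _ hi',
      Fint.val_tensorHom _ _ hi, Fint.val_id_min, Fint.val_rightUnitor (by
        simp only [seg_len]; omega)]
    simp only [seg_len]
    omega

end

variable {V : Type*} [Category V] (X : Fintᵒᵖ ⥤ V)

section

variable {p q r : ℕ} (f : (⟨p⟩ : Fint) ⟶ ⟨q⟩) (g : (⟨q⟩ : Fint) ⟶ ⟨r⟩)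
  {a b c d : Fin (p + 1)} {a' b' c' : Fin (q + 1)} {a'' b'' : Fin (r + 1)}

variable (a b) in
/-- The value of `X` on the bead between `a` and `b`. -/
abbrev bead : V := X.obj (op (seg a b))

/-- The action of `f` between beads. -/
def beadMap (ha : Fint.fn f a = a') (hb : Fint.fn f b = b') : bead X a' b' ⟶ bead X a b :=
  X.map (restr f ha hb).op

lemma beadMap_id (ha : Fint.fn (𝟙 (⟨p⟩ : Fint)) a = a) (hb : Fint.fn (𝟙 (⟨p⟩ : Fint)) b = b) :
    beadMap X (𝟙 (⟨p⟩ : Fint)) ha hb = 𝟙 (bead X a b) := by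
  rw [beadMap, restr_id]; exact X.map_id _

lemma beadMap_comp (ha : Fint.fn f a = a') (hb : Fint.fn f b = b') (ha' : Fint.fn g a' = a'')
    (hb' : Fint.fn g b' = b'') (ha'' : Fint.fn (f ≫ g) a = a'') (hb'' : Fint.fn (f ≫ g) b = b'') :
    beadMap X (f ≫ g) ha'' hb'' = beadMap X g ha' hb' ≫ beadMap X f ha hb := by
  rw [beadMap, restr_comp f g ha hb ha' hb']; exact X.map_comp _ _

variable [MonoidalCategory V]

/-- `beads X z a [b₁, ..., bₘ] = X_{b₁ - a} ⊗ (X_{b₂ - b₁} ⊗ ... ⊗ X_{z - bₘ})`. -/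
@[reducible]
def beads (z : Fin (p + 1)) : Fin (p + 1) → List (Fin (p + 1)) → V
  | a, [] => bead X a z
  | a, b :: l => bead X a b ⊗ beads z b l

/-- The action of `f` on tensor products of beads, bead by bead. -/
def active {z : Fin (p + 1)} {z' : Fin (q + 1)} (hz : Fint.fn f z = z') :
    ∀ {a : Fin (p + 1)} {a' : Fin (q + 1)} (_ : Fint.fn f a = a')
      {l : List (Fin (p + 1))} {l' : List (Fin (q + 1))} (_ : l.map (Fint.fn f) = l'),
      beads X z' a' l' ⟶ beads X z a l
  | _, _, ha, [], [], _ => beadMap X f ha hz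
  | _, _, ha, _ :: _, _ :: _, hl =>
    beadMap X f ha (List.cons.inj hl).1 ⊗ₘ active hz (List.cons.inj hl).1 (List.cons.inj hl).2

lemma active_id {z : Fin (p + 1)} (hz : Fint.fn (𝟙 (⟨p⟩ : Fint)) z = z)
    (ha : Fint.fn (𝟙 (⟨p⟩ : Fint)) a = a) {l : List (Fin (p + 1))}
    (hl : l.map (Fint.fn (𝟙 (⟨p⟩ : Fint))) = l) :
    active X (𝟙 (⟨p⟩ : Fint)) hz ha hl = 𝟙 (beads X z a l) := by
  induction l generalizing a with
  | nil => exact beadMap_id X ha hz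
  | cons b l ih =>
    rw [active, ih, beadMap_id]
    exact id_tensorHom_id _ _

lemma active_comp {z : Fin (p + 1)} {z' : Fin (q + 1)} {z'' : Fin (r + 1)}
    (hz : Fint.fn f z = z') (hz' : Fint.fn g z' = z'') (hz'' : Fint.fn (f ≫ g) z = z'')
    (ha : Fint.fn f a = a') (ha' : Fint.fn g a' = a'') (ha'' : Fint.fn (f ≫ g) a = a'')
    {l : List (Fin (p + 1))} {l' : List (Fin (q + 1))} {l'' : List (Fin (r + 1))}
    (hl : l.map (Fint.fn f) = l') (hl' : l'.map (Fint.fn g) = l'')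
    (hl'' : l.map (Fint.fn (f ≫ g)) = l'') :
    active X (f ≫ g) hz'' ha'' hl'' = active X g hz' ha' hl' ≫ active X f hz ha hl := by
  induction l generalizing a a' a'' l' l'' with
  | nil =>
    subst hl hl'
    exact beadMap_comp X f g ha hz ha' hz' ha'' hz''
  | cons b l ih =>
    subst hl hl'
    simp only [active]
    rw [tensorHom_comp_tensorHom, ← ih, ← beadMap_comp]

variable [X.OplaxMonoidal]

variable (a b c) in
/-- The comultiplication `X_{c - a} → X_{b - a} ⊗ X_{c - b}` for `a ≤ b ≤ c`. -/
def comul : bead X a c ⟶ bead X a b ⊗ bead X b c :=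
  X.map (glue a b c).op ≫ δ X (op (seg a b)) (op (seg b c))

lemma comul_natural (h1 : a ≤ b) (h2 : b ≤ c) (ha : Fint.fn f a = a') (hb : Fint.fn f b = b')
    (hc : Fint.fn f c = c') :
    beadMap X f ha hc ≫ comul X a b c =
      comul X a' b' c' ≫ (beadMap X f ha hb ⊗ₘ beadMap X f hb hc) := by
  have e := congrArg (fun t => X.map t.op) (glue_restr f h1 h2 ha hb hc)
  simp only [op_comp, X.map_comp] at e
  have n := δ_natural X (restr f ha hb).op (restr f hb hc).op
  dsimp only [beadMap, comul]
  rw [Category.assoc, n]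
  exact (Category.assoc _ _ _).symm.trans ((congrArg (· ≫ _) e).trans (Category.assoc _ _ _))

lemma comul_coassoc (h1 : a ≤ b) (h2 : b ≤ c) (h3 : c ≤ d) :
    comul X a c d ≫ (comul X a b c ▷ bead X c d) ≫ (α_ _ _ _).hom =
      comul X a b d ≫ bead X a b ◁ comul X b c d := by
  have e := congrArg (fun t => X.map t.op) (glue_assoc h1 h2 h3)
  simp only [op_comp, X.map_comp, Category.assoc] at e
  have n1 := δ_natural_left X (glue a b c).op (op (seg c d))
  have n2 := δ_natural_right X (op (seg a b)) (glue b c d).op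
  have as := associativity X (op (seg a b)) (op (seg b c)) (op (seg c d))
  dsimp only [comul]
  rw [comp_whiskerRight, MonoidalCategory.whiskerLeft_comp]
  simp only [Category.assoc]
  refine (congrArg (X.map (glue a c d).op ≫ ·)
    ((δ_natural_left_assoc X (glue a b c).op (op (seg c d)) _).trans
      (congrArg (X.map ((glue a b c).op ▷ op (seg c d)) ≫ ·) as))).trans ?_
  refine Eq.trans ?_ (congrArg (X.map (glue a b d).op ≫ ·)
    (δ_natural_right_assoc X (op (seg a b)) (glue b c d).op _).symm)
  have hα : (α_ (op (seg a b)) (op (seg b c)) (op (seg c d))).hom =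
    (α_ (seg a b) (seg b c) (seg c d)).inv.op := rfl
  have k : (glue a c d).op ≫ ((glue a b c).op ▷ op (seg c d)) ≫
      (α_ (op (seg a b)) (op (seg b c)) (op (seg c d))).hom =
      (glue a b d).op ≫ (op (seg a b) ◁ (glue b c d).op) := by
    rw [hα]
    refine Quiver.Hom.unop_inj ?_
    change ((α_ (seg a b) (seg b c) (seg c d)).inv ≫ (glue a b c ▷ seg c d)) ≫ glue a c d =
      (seg a b ◁ glue b c d) ≫ glue a b d
    rw [Category.assoc, glue_assoc h1 h2 h3, Iso.inv_hom_id_assoc]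
  have k' := congrArg X.map k
  simp only [X.map_comp] at k'
  have k'' := congrArg (fun t => t ≫ δ X (op (seg a b)) (op (seg b c) ⊗ op (seg c d)) ≫
    X.obj (op (seg a b)) ◁ δ X (op (seg b c)) (op (seg c d))) k'
  simp only [Category.assoc] at k''
  exact k''.trans ((congrArg (· ≫ _) (X.map_comp (glue a b d).op
    (op (seg a b) ◁ (glue b c d).op))).trans (Category.assoc _ _ _))

/-- The counit on an empty bead. -/
def counit (a : Fin (p + 1)) : bead X a a ⟶ 𝟙_ V := X.map (segSelf a).inv.op ≫ η X

lemma comul_counit_left (h : a ≤ b) :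
    comul X a a b ≫ counit X a ▷ bead X a b = (λ_ _).inv := by
  have h1 := left_unitality X (op (seg a b))
  have h2 := δ_natural_left X (segSelf a).inv.op (op (seg a b))
  dsimp only [comul, counit]
  rw [comp_whiskerRight, Category.assoc, h1]
  refine (congrArg (X.map (glue a a b).op ≫ ·)
    (δ_natural_left_assoc X (segSelf a).inv.op (op (seg a b)) _)).trans ?_
  rw [← Category.assoc, ← Category.assoc]
  refine (Category.assoc _ _ _).trans (congrArg (fun t => t ≫ _) ?_)
  rw [← X.map_comp]
  refine congrArg X.map (Quiver.Hom.unop_inj ?_)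
  change ((segSelf a).inv ▷ seg a b) ≫ glue a a b = (λ_ (seg a b)).hom
  rw [glue_self_left h, ← Category.assoc, ← comp_whiskerRight, Iso.inv_hom_id, id_whiskerRight,
    Category.id_comp]

lemma comul_counit_right (h : a ≤ b) :
    comul X a b b ≫ bead X a b ◁ counit X b = (ρ_ _).inv := by
  have h1 := right_unitality X (op (seg a b))
  dsimp only [comul, counit]
  rw [MonoidalCategory.whiskerLeft_comp, Category.assoc, h1]
  refine (congrArg (X.map (glue a b b).op ≫ ·)
    (δ_natural_right_assoc X (op (seg a b)) (segSelf b).inv.op _)).trans ?_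
  rw [← Category.assoc, ← Category.assoc]
  refine (Category.assoc _ _ _).trans (congrArg (fun t => t ≫ _) ?_)
  rw [← X.map_comp]
  refine congrArg X.map (Quiver.Hom.unop_inj ?_)
  change (seg a b ◁ (segSelf b).inv) ≫ glue a b b = (ρ_ (seg a b)).hom
  rw [glue_self_right h, ← Category.assoc, ← MonoidalCategory.whiskerLeft_comp, Iso.inv_hom_id,
    MonoidalCategory.whiskerLeft_id, Category.id_comp]

/-- Splitting off the bead from `a` to `b`. -/
def cut (z a b : Fin (p + 1)) : ∀ l, beads X z a l ⟶ bead X a b ⊗ beads X z b l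
  | [] => comul X a b z
  | c :: l => comul X a b c ▷ beads X z c l ≫ (α_ _ _ _).hom

lemma cut_cons (z a b c : Fin (p + 1)) (l : List (Fin (p + 1))) :
    cut X z a b (c :: l) = comul X a b c ▷ beads X z c l ≫ (α_ _ _ _).hom := rfl

/-- Comultiplication along a refinement of the joints: the joints `l₁` (between `a` and `z`) are
among the joints `l₂`. -/
def subdiv {z : Fin (p + 1)} : ∀ {a : Fin (p + 1)} {l₁ l₂ : List (Fin (p + 1))} (_ : l₁.Sublist l₂),
      beads X z a l₁ ⟶ beads X z a l₂
  | _, [], [], _ => 𝟙 _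
  | a, [], b :: l₂, _ => cut X z a b [] ≫ bead X a b ◁ subdiv (List.nil_sublist l₂)
  | _, _ :: _, [], h => absurd h (by simp)
  | a, c :: l₁, b :: l₂, h =>
    if e : c = b then by
      subst e
      exact bead X a c ◁ subdiv (List.cons_sublist_cons.1 h)
    else cut X z a b (c :: l₁) ≫ bead X a b ◁ subdiv (List.Sublist.of_cons_of_ne e h)

lemma subdiv_cons_self {z : Fin (p + 1)} {l₁ l₂ : List (Fin (p + 1))}
    (h : (b :: l₁).Sublist (b :: l₂)) :
    subdiv X (z := z) (a := a) h = bead X a b ◁ subdiv X (List.cons_sublist_cons.1 h) := by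
  simp [subdiv]

lemma subdiv_cons_ne {z : Fin (p + 1)} {l₁ l₂ : List (Fin (p + 1))} (h : l₁.Sublist (b :: l₂))
    (h' : l₁.Sublist l₂) (hne : ∀ t, l₁ ≠ b :: t) :
    subdiv X (z := z) (a := a) h = cut X z a b l₁ ≫ bead X a b ◁ subdiv X h' := by
  cases l₁ with
  | nil => rfl
  | cons c t =>
    have : c ≠ b := fun e => hne t (by rw [e])
    simp [subdiv, this]

lemma subdiv_refl {z : Fin (p + 1)} {l : List (Fin (p + 1))} (h : l.Sublist l) :
    subdiv X (z := z) (a := a) h = 𝟙 _ := by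
  induction l generalizing a with
  | nil => rfl
  | cons b l ih => rw [subdiv_cons_self, ih, MonoidalCategory.whiskerLeft_id]

/-- The joints `l` are weakly increasing and lie between `a` and `z`. -/
def Sorted (z : Fin (p + 1)) : Fin (p + 1) → List (Fin (p + 1)) → Prop
  | a, [] => a ≤ z
  | a, b :: l => a ≤ b ∧ Sorted z b l

lemma Sorted.le {z : Fin (p + 1)} {l : List (Fin (p + 1))} (h : Sorted z a l) : a ≤ z := by
  induction l generalizing a with
  | nil => exact h
  | cons b l ih => exact h.1.trans (ih h.2)

lemma Sorted.le_mem {z : Fin (p + 1)} {l : List (Fin (p + 1))} (h : Sorted z a l) :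
    ∀ x ∈ l, a ≤ x := by
  induction l generalizing a with
  | nil => simp
  | cons b l ih =>
    intro x hx
    rcases List.mem_cons.1 hx with rfl | hx
    · exact h.1
    · exact h.1.trans (ih h.2 x hx)

/-- The same joints seen from an earlier starting point. -/
lemma Sorted.from_le {z : Fin (p + 1)} {l : List (Fin (p + 1))} (hab : a ≤ b)
    (h : Sorted z b l) : Sorted z a l := by
  cases l with
  | nil => exact hab.trans h
  | cons c l => exact ⟨hab.trans h.1, h.2⟩

lemma Sorted.sublist {z : Fin (p + 1)} {l l' : List (Fin (p + 1))} (hs : l'.Sublist l)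
    (h : Sorted z a l) : Sorted z a l' := by
  induction hs generalizing a with
  | slnil => exact h
  | cons b _ ih => exact (ih h.2).from_le h.1
  | cons_cons b _ ih => exact ⟨h.1, ih h.2⟩

lemma Sorted.map {z : Fin (p + 1)} {z' : Fin (q + 1)} (hz : Fint.fn f z = z')
    (ha : Fint.fn f a = a') {l : List (Fin (p + 1))} (h : Sorted z a l) :
    Sorted z' a' (l.map (Fint.fn f)) := by
  subst hz ha
  induction l generalizing a with
  | nil => exact (Fint.fn f).monotone h
  | cons b l ih => exact ⟨(Fint.fn f).monotone h.1, ih h.2⟩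

lemma cut_natural {z : Fin (p + 1)} {z' : Fin (q + 1)} (hz : Fint.fn f z = z')
    (ha : Fint.fn f a = a') (hb : Fint.fn f b = b') {l : List (Fin (p + 1))}
    {l' : List (Fin (q + 1))} (hl : l.map (Fint.fn f) = l') (hab : a ≤ b) (hs : Sorted z b l) :
    active X f hz ha hl ≫ cut X z a b l =
      cut X z' a' b' l' ≫ (beadMap X f ha hb ⊗ₘ active X f hz hb hl) := by
  subst hl
  cases l with
  | nil => exact comul_natural X f hab hs ha hb hz
  | cons c l =>
    have n := comul_natural X f hab hs.1 ha hb (c' := Fint.fn f c) rfl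
    change (beadMap X f ha rfl ⊗ₘ active X f hz rfl rfl) ≫ _ ≫ _ =
      (comul X a' b' (Fint.fn f c) ▷ beads X z' _ (l.map (Fint.fn f)) ≫ (α_ _ _ _).hom) ≫
        (beadMap X f ha hb ⊗ₘ (beadMap X f hb rfl ⊗ₘ active X f hz rfl rfl))
    rw [Category.assoc, ← associator_naturality, ← Category.assoc, ← Category.assoc,
      ← MonoidalCategory.tensorHom_id, ← MonoidalCategory.tensorHom_id,
      tensorHom_comp_tensorHom, tensorHom_comp_tensorHom, n, Category.comp_id, Category.id_comp]

lemma cut_cut {z : Fin (p + 1)} {l : List (Fin (p + 1))} (h1 : a ≤ b) (h2 : b ≤ c)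
    (hs : Sorted z c l) :
    cut X z a c l ≫ comul X a b c ▷ beads X z c l ≫ (α_ _ _ _).hom =
      cut X z a b l ≫ bead X a b ◁ cut X z b c l := by
  cases l with
  | nil => exact comul_coassoc X h1 h2 hs
  | cons d l =>
    have n := congrArg (· ▷ beads X z d l) (comul_coassoc X h1 h2 hs.1)
    simp only [comp_whiskerRight] at n
    simp only [cut_cons, MonoidalCategory.whiskerLeft_comp, Category.assoc]
    rw [← associator_naturality_left_assoc, ← pentagon, reassoc_of% n,
      associator_naturality_middle_assoc]

lemma cut_subdiv {z : Fin (p + 1)} {l₁ l₂ : List (Fin (p + 1))} (h : l₁.Sublist l₂) (hab : a ≤ b)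
    (hs : Sorted z b l₂) :
    subdiv X h ≫ cut X z a b l₂ = cut X z a b l₁ ≫ bead X a b ◁ subdiv X h := by
  cases l₂ with
  | nil =>
    cases List.sublist_nil.1 h
    rw [subdiv_refl, subdiv_refl, Category.id_comp, MonoidalCategory.whiskerLeft_id,
      Category.comp_id]
  | cons c t =>
    by_cases hc : ∃ t₁, l₁ = c :: t₁
    · obtain ⟨t₁, rfl⟩ := hc
      rw [subdiv_cons_self, subdiv_cons_self]
      simp only [cut_cons, Category.assoc]
      rw [← associator_naturality_right, whisker_exchange_assoc]
    · have hc' : ∀ t₁, l₁ ≠ c :: t₁ := fun t₁ e => hc ⟨t₁, e⟩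
      have h' : l₁.Sublist t := by
        cases h with
        | cons _ h => exact h
        | cons_cons _ _ => exact absurd rfl (hc' _)
      rw [subdiv_cons_ne X h h' hc', subdiv_cons_ne X h h' hc']
      have k := cut_cut X hab hs.1 (hs.2.sublist h')
      simp only [cut_cons, Category.assoc, MonoidalCategory.whiskerLeft_comp]
      rw [← reassoc_of% k, whisker_exchange_assoc, associator_naturality_right]

lemma sublist_of_not_head {α : Type*} {b : α} {l₁ l₂ : List α} (h : l₁.Sublist (b :: l₂))
    (hne : ∀ t, l₁ ≠ b :: t) : l₁.Sublist l₂ := by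
  cases h with
  | cons _ h => exact h
  | cons_cons _ _ => exact absurd rfl (hne _)

lemma subdiv_trans {z : Fin (p + 1)} {l₁ l₂ l₃ : List (Fin (p + 1))} (h₁ : l₁.Sublist l₂)
    (h₂ : l₂.Sublist l₃) (h₃ : l₁.Sublist l₃) (hs : Sorted z a l₃) :
    subdiv X h₁ ≫ subdiv X h₂ = subdiv X (z := z) (a := a) h₃ := by
  induction l₃ generalizing a l₁ l₂ with
  | nil =>
    cases List.sublist_nil.1 h₂
    cases List.sublist_nil.1 h₁
    exact Category.id_comp _
  | cons b l₃ ih =>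
    by_cases hc : ∃ t₂, l₂ = b :: t₂
    · obtain ⟨t₂, rfl⟩ := hc
      by_cases hc1 : ∃ t₁, l₁ = b :: t₁
      · obtain ⟨t₁, rfl⟩ := hc1
        rw [subdiv_cons_self, subdiv_cons_self, subdiv_cons_self,
          ← MonoidalCategory.whiskerLeft_comp, ih _ _ _ hs.2]
      · have hc1' : ∀ t₁, l₁ ≠ b :: t₁ := fun t₁ e => hc1 ⟨t₁, e⟩
        rw [subdiv_cons_self, subdiv_cons_ne X h₁ (sublist_of_not_head h₁ hc1') hc1',
          subdiv_cons_ne X h₃ (sublist_of_not_head h₃ hc1') hc1', Category.assoc,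
          ← MonoidalCategory.whiskerLeft_comp, ih _ _ _ hs.2]
    · have hc' : ∀ t₂, l₂ ≠ b :: t₂ := fun t₂ e => hc ⟨t₂, e⟩
      have h₂' := sublist_of_not_head h₂ hc'
      have hs₂ : Sorted z b l₂ := hs.2.sublist h₂'
      have hc1' : ∀ t₁, l₁ ≠ b :: t₁ := by
        rintro t₁ rfl
        cases l₂ with
        | nil => simp at h₁
        | cons c t₂ =>
          have hcb : c ≠ b := fun e => hc' t₂ (by rw [e])
          have hb : b ∈ t₂ := (List.mem_cons.1 (h₁.subset List.mem_cons_self)).resolve_left hcb.symm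
          exact hcb (le_antisymm (hs₂.2.le_mem b hb) hs₂.1)
      rw [subdiv_cons_ne X h₂ h₂' hc', ← Category.assoc, cut_subdiv X h₁ hs.1 hs₂,
        subdiv_cons_ne X h₃ (h₁.trans h₂') hc1', Category.assoc,
        ← MonoidalCategory.whiskerLeft_comp, ih _ _ _ hs.2]

lemma cut_counit {z : Fin (p + 1)} {l : List (Fin (p + 1))} (hs : Sorted z a l) :
    cut X z a a l ≫ counit X a ▷ beads X z a l = (λ_ _).inv := by
  cases l with
  | nil => exact comul_counit_left X hs
  | cons b l =>
    have n := congrArg (· ▷ beads X z b l) (comul_counit_left X hs.1)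
    simp only [comp_whiskerRight] at n
    simp only [cut_cons, Category.assoc]
    rw [← associator_naturality_left, reassoc_of% n, leftUnitor_inv_whiskerRight]
    simp

variable [IsIso (η X)]

instance (a : Fin (p + 1)) : IsIso (counit X a) := by
  unfold counit
  infer_instance

lemma cut_self {z : Fin (p + 1)} {l : List (Fin (p + 1))} (hab : a ≤ b) (hs : Sorted z b l) :
    cut X z a b (b :: l) = bead X a b ◁ cut X z b b l := by
  have n := congrArg (· ▷ beads X z b l) (comul_counit_right X hab)
  simp only [comp_whiskerRight] at n
  rw [← cancel_mono (bead X a b ◁ counit X b ▷ beads X z b l),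
    ← MonoidalCategory.whiskerLeft_comp, cut_counit X hs]
  simp only [cut_cons, Category.assoc]
  rw [← associator_naturality_middle, reassoc_of% n]
  exact triangle_assoc_comp_right_inv _ _

lemma subdiv_unit {z : Fin (p + 1)} {l l' : List (Fin (p + 1))} (h : l.Sublist l')
    (h' : l.Sublist (a :: l')) (hs : Sorted z a l') :
    cut X z a a l ≫ bead X a a ◁ subdiv X h = subdiv X h' := by
  induction l' generalizing a l with
  | nil =>
    cases List.sublist_nil.1 h
    rfl
  | cons e l' ih =>
    by_cases hc : ∃ t, l = a :: t
    · obtain ⟨t, rfl⟩ := hc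
      obtain rfl : e = a := by
        rcases List.mem_cons.1 (h.subset List.mem_cons_self) with hh | hh
        · exact hh.symm
        · exact le_antisymm (hs.2.le_mem _ hh) hs.1
      have ht := List.cons_sublist_cons.1 h
      rw [subdiv_cons_self, subdiv_cons_self, cut_self X le_rfl (hs.2.sublist ht),
        ← MonoidalCategory.whiskerLeft_comp, ih ht _ hs.2]
    · exact (subdiv_cons_ne X h' h fun t e => hc ⟨t, e⟩).symm

lemma subdiv_unit_cons {z : Fin (p + 1)} {l l' : List (Fin (p + 1))} (h : (a :: l).Sublist l')
    (h' : l.Sublist l') (hs : Sorted z a l') :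
    cut X z a a l ≫ subdiv X h = subdiv X h' := by
  cases l' with
  | nil => simp at h
  | cons e l' =>
    obtain rfl : e = a := by
      rcases List.mem_cons.1 (h.subset List.mem_cons_self) with hh | hh
      · exact hh.symm
      · exact le_antisymm (hs.2.le_mem _ hh) hs.1
    rw [subdiv_cons_self, subdiv_unit X _ h' hs.2]

lemma subdiv_natural {z : Fin (p + 1)} {z' : Fin (q + 1)} (hz : Fint.fn f z = z')
    (ha : Fint.fn f a = a') {l m : List (Fin (p + 1))} {l' m' : List (Fin (q + 1))}
    (hl : l.map (Fint.fn f) = l') (hm : m.map (Fint.fn f) = m') (h : l.Sublist m)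
    (h' : l'.Sublist m') (hs : Sorted z a m) :
    subdiv X h' ≫ active X f hz ha hm = active X f hz ha hl ≫ subdiv X h := by
  induction m generalizing a a' l l' m' with
  | nil =>
    cases List.sublist_nil.1 h
    subst hl hm
    rw [subdiv_refl, subdiv_refl, Category.id_comp, Category.comp_id]
  | cons b m ih =>
    subst hm
    by_cases hc : ∃ t, l = b :: t
    · obtain ⟨t, rfl⟩ := hc
      subst hl
      simp only [List.map_cons] at h' ⊢
      have i := ih (a' := Fint.fn f b) rfl (l := t) rfl rfl (List.cons_sublist_cons.1 h)
        (List.cons_sublist_cons.1 h') hs.2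
      simp only [subdiv_cons_self, active]
      rw [← MonoidalCategory.id_tensorHom, ← MonoidalCategory.id_tensorHom,
        tensorHom_comp_tensorHom, tensorHom_comp_tensorHom, i, Category.id_comp, Category.comp_id]
    · have hc' : ∀ t, l ≠ b :: t := fun t e => hc ⟨t, e⟩
      have hlm := sublist_of_not_head h hc'
      have hlm' : l'.Sublist (m.map (Fint.fn f)) := by rw [← hl]; exact hlm.map _
      have i := ih (a' := Fint.fn f b) rfl hl rfl hlm hlm' hs.2
      have hs' : Sorted z' (Fint.fn f b) (m.map (Fint.fn f)) := hs.2.map f hz rfl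
      have key : subdiv X h' = cut X z' a' (Fint.fn f b) l' ≫ bead X a' (Fint.fn f b) ◁
          subdiv X hlm' := by
        by_cases hd : ∃ t, l' = Fint.fn f b :: t
        · obtain ⟨t, rfl⟩ := hd
          have ht : t.Sublist (m.map (Fint.fn f)) := (List.sublist_cons_self _ _).trans hlm'
          rw [cut_self X (ha ▸ (Fint.fn f).monotone hs.1) (hs'.sublist ht),
            ← MonoidalCategory.whiskerLeft_comp]
          refine (subdiv_cons_self X h').trans (congrArg _ ?_)
          exact (subdiv_unit_cons X hlm' ht hs').symm
        · exact subdiv_cons_ne X h' hlm' fun t e => hd ⟨t, e⟩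
      rw [subdiv_cons_ne X h hlm hc', ← Category.assoc,
        cut_natural X f hz ha (b' := Fint.fn f b) rfl hl hs.1 (hs.2.sublist hlm), key]
      simp only [active, Category.assoc]
      rw [← MonoidalCategory.id_tensorHom, ← MonoidalCategory.id_tensorHom,
        tensorHom_comp_tensorHom, tensorHom_comp_tensorHom, i, Category.id_comp, Category.comp_id]

end

/-- The interior joints of a necklace, in increasing order. -/
def Nec.inner (T : Nec) : List (Fin (T.len + 1)) :=
  ((T.joints.erase 0).erase (Fin.last _)).sort

lemma sorted_of_pairwise {p : ℕ} {z a : Fin (p + 1)} {l : List (Fin (p + 1))} (haz : a ≤ z)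
    (h1 : ∀ x ∈ l, a ≤ x ∧ x ≤ z) (h2 : l.Pairwise (· ≤ ·)) : Sorted z a l := by
  induction l generalizing a with
  | nil => exact haz
  | cons b l ih =>
    have hb := h1 b List.mem_cons_self
    exact ⟨hb.1, ih hb.2 (fun x hx => ⟨(List.pairwise_cons.1 h2).1 x hx,
      (h1 x (List.mem_cons_of_mem _ hx)).2⟩) (List.pairwise_cons.1 h2).2⟩

lemma Nec.inner_sorted (T : Nec) : Sorted (Fin.last _) 0 T.inner :=
  sorted_of_pairwise (Fin.zero_le _) (fun x _ => ⟨Fin.zero_le x, Fin.le_last x⟩)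
    (Finset.pairwise_sort _ _)

lemma Nec.Hom.inner_sublist {T U : Nec} (f : T ⟶ U) :
    U.inner.Sublist (T.inner.map (Fint.fn (Nec.Hom.toFint f))) := by
  refine List.sublist_of_subperm_of_pairwise (r := (· ≤ ·)) (List.subperm_of_subset
    (Finset.sort_nodup _ _) fun x hx => ?_) (Finset.pairwise_sort _ _)
    ((Finset.pairwise_sort _ _).map _ fun _ _ h => (Fint.fn _).monotone h)
  have hx' : x ≠ Fin.last _ ∧ x ≠ 0 ∧ x ∈ U.joints := by
    simpa [Nec.inner] using hx
  obtain ⟨y, hy, rfl⟩ := Finset.mem_image.1 (Nec.Hom.subset f hx'.2.2)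
  refine List.mem_map.2 ⟨y, ?_, rfl⟩
  have h1 : y ≠ Fin.last _ := fun e => hx'.1 (by rw [e]; exact Fint.fn_last _)
  have h2 : y ≠ 0 := fun e => hx'.2.1 (by rw [e]; exact Fint.fn_zero _)
  simp [Nec.inner, h1, h2, hy]

variable [MonoidalCategory V] [X.OplaxMonoidal] [IsIso (η X)]

/-- The functor `X_• : Necᵒᵖ ⥤ V` associated to a strongly unital colax monoidal functor `X`. For
`T = {0 = t₀ < ... < tₘ = p}` with `p > 0` it takes the value `X_{t₁} ⊗ ... ⊗ X_{p - tₘ₋₁}`; for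
`T = {0}`, where this tensor product is empty, we use `X_0`, which is identified with the monoidal
unit by the counit. On morphisms it is the comultiplication along `U ⊆ f(T)`, followed by the
action of `f` on each bead. -/
@[simps]
def necklicial : Necᵒᵖ ⥤ V where
  obj T := beads X (Fin.last _) 0 T.unop.inner
  map {T U} f := subdiv X (Nec.Hom.inner_sublist f.unop) ≫
    active X (Nec.Hom.toFint f.unop) (Fint.fn_last _) (Fint.fn_zero _) rfl
  map_id T := by
    have key : ∀ (l' : List (Fin (T.unop.len + 1)))
        (hl : T.unop.inner.map (Fint.fn (𝟙 (⟨T.unop.len⟩ : Fint))) = l')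
        (h : T.unop.inner.Sublist l'),
        subdiv X h ≫ active X (𝟙 (⟨T.unop.len⟩ : Fint)) (Fint.fn_last _) (Fint.fn_zero _) hl =
          𝟙 (beads X (Fin.last _) 0 T.unop.inner) := by
      intro l' hl h
      obtain rfl : T.unop.inner = l' := by rw [← hl]; exact (List.map_id _).symm
      rw [subdiv_refl, active_id, Category.id_comp]
    exact key _ rfl (Nec.Hom.inner_sublist (𝟙 T.unop))
  map_comp {T U W} f g := by
    have hfg : (g.unop ≫ f.unop).toFint = g.unop.toFint ≫ f.unop.toFint := rfl
    have hs : Sorted (Fin.last _) 0 (W.unop.inner.map (Fint.fn g.unop.toFint)) :=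
      W.unop.inner_sorted.map _ (Fint.fn_last _) (Fint.fn_zero _)
    have hl : W.unop.inner.map (Fint.fn (g.unop.toFint ≫ f.unop.toFint)) =
      (W.unop.inner.map (Fint.fn g.unop.toFint)).map (Fint.fn f.unop.toFint) := by
      rw [List.map_map]; rfl
    have key : ∀ (l' : List (Fin (T.unop.len + 1)))
        (hl' : W.unop.inner.map (Fint.fn (g.unop.toFint ≫ f.unop.toFint)) = l')
        (h : T.unop.inner.Sublist l')
        (hl'' : (W.unop.inner.map (Fint.fn g.unop.toFint)).map (Fint.fn f.unop.toFint) = l'),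
        subdiv X h ≫ active X (g.unop.toFint ≫ f.unop.toFint) (Fint.fn_last _)
          (Fint.fn_zero _) hl' =
        (subdiv X (Nec.Hom.inner_sublist f.unop) ≫
          active X f.unop.toFint (Fint.fn_last _) (Fint.fn_zero _) rfl) ≫
        subdiv X (Nec.Hom.inner_sublist g.unop) ≫
          active X g.unop.toFint (Fint.fn_last _) (Fint.fn_zero _) rfl := by
      intro l' hl' h hl''
      have hsub := (Nec.Hom.inner_sublist g.unop).map (Fint.fn f.unop.toFint)
      subst hl''
      rw [active_comp X g.unop.toFint f.unop.toFint (Fint.fn_last _) (Fint.fn_last _) _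
        (Fint.fn_zero _) (Fint.fn_zero _) _ rfl rfl, Category.assoc,
        ← Category.assoc (active X f.unop.toFint _ _ _),
        ← subdiv_natural X f.unop.toFint (Fint.fn_last _) (Fint.fn_zero _) rfl rfl
          (Nec.Hom.inner_sublist g.unop) hsub hs, ← Category.assoc, ← Category.assoc,
        ← Category.assoc, subdiv_trans X _ _ h (hs.map _ (Fint.fn_last _) (Fint.fn_zero _)),
        Category.assoc]
    exact key _ rfl (Nec.Hom.inner_sublist (f ≫ g).unop) hl.symm

end Beads

/-! ## Quivers enriched in modules -/

open scoped TensorProduct DirectSum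

/-- `k`-module enriched quivers with vertex set `S`. -/
structure KQuiv (k : Type u) [CommRing k] (S : Type u) where
  obj : S → S → ModuleCat.{u} k

namespace KQuiv

noncomputable section

variable {k : Type u} [CommRing k] {S : Type u}

/-- Quiver morphisms. -/
@[ext]
structure Hom (M N : KQuiv k S) where
  app : ∀ a b, M.obj a b →ₗ[k] N.obj a b

instance : Category (KQuiv k S) where
  Hom := Hom
  id M := ⟨fun _ _ => LinearMap.id⟩
  comp f g := ⟨fun a b => g.app a b ∘ₗ f.app a b⟩

/-- The components of a quiver morphism. -/
def app {M N : KQuiv k S} (f : M ⟶ N) (a b : S) : M.obj a b →ₗ[k] N.obj a b := Hom.app f a b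

/-- Build a quiver morphism from its components. -/
def ofApp {M N : KQuiv k S} (f : ∀ a b, M.obj a b →ₗ[k] N.obj a b) : M ⟶ N := ⟨f⟩

@[simp] lemma app_ofApp {M N : KQuiv k S} (f : ∀ a b, M.obj a b →ₗ[k] N.obj a b) (a b : S) :
    app (ofApp f) a b = f a b := rfl

@[simp] lemma id_app (M : KQuiv k S) (a b : S) (x : M.obj a b) : app (𝟙 M) a b x = x := rfl

@[simp] lemma comp_app {M N P : KQuiv k S} (f : M ⟶ N) (g : N ⟶ P) (a b : S) (x : M.obj a b) :
    app (f ≫ g) a b x = app g a b (app f a b x) := rfl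

lemma hom_ext {M N : KQuiv k S} {f g : M ⟶ N}
    (h : ∀ a b (x : M.obj a b), app f a b x = app g a b x) : f = g :=
  Hom.ext (funext fun a => funext fun b => LinearMap.ext (h a b))

/-- The evaluation functor at a pair of vertices. -/
@[simps]
def eval (a b : S) : KQuiv k S ⥤ ModuleCat.{u} k where
  obj M := M.obj a b
  map f := ModuleCat.ofHom (app f a b)

open Classical in
/-- The tensor product `(M ⊗_S N)(a, b) = ⨁_c M(a, c) ⊗ N(c, b)`. -/
def tensor (M N : KQuiv k S) : KQuiv k S :=
  ⟨fun a b => ModuleCat.of k (⨁ c : S, M.obj a c ⊗[k] N.obj c b)⟩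

/-- The unit quiver: `I_S(a, b)` is the free module on one generator if `a = b`, on no generators
otherwise. -/
def unit (k : Type u) [CommRing k] (S : Type u) : KQuiv k S :=
  ⟨fun a b => ModuleCat.of k (PLift (a = b) →₀ k)⟩

section

variable {M N P Q M' N' P' : KQuiv k S} {a b c d : S}

open Classical in
/-- The bilinear map `M(a, c) × N(c, b) → (M ⊗_S N)(a, b)`. -/
def incl (M N : KQuiv k S) (a b c : S) : M.obj a c ⊗[k] N.obj c b →ₗ[k] (tensor M N).obj a b :=
  DirectSum.lof k S (fun c => M.obj a c ⊗[k] N.obj c b) c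

/-- Pure tensors. -/
def tmk (M N : KQuiv k S) {a b : S} (c : S) (m : M.obj a c) (n : N.obj c b) :
    (tensor M N).obj a b :=
  incl M N a b c (m ⊗ₜ n)

lemma tmk_add_left (m m' : M.obj a c) (n : N.obj c b) :
    tmk M N c (m + m') n = tmk M N c m n + tmk M N c m' n :=
  (congrArg _ (TensorProduct.add_tmul m m' n)).trans (map_add _ _ _)

lemma tmk_add_right (m : M.obj a c) (n n' : N.obj c b) :
    tmk M N c m (n + n') = tmk M N c m n + tmk M N c m n' :=
  (congrArg _ (TensorProduct.tmul_add m n n')).trans (map_add _ _ _)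

lemma tmk_zero_left (n : N.obj c b) : tmk M N c (0 : M.obj a c) n = 0 :=
  (congrArg _ (TensorProduct.zero_tmul _ n)).trans (map_zero _)

lemma tmk_zero_right (m : M.obj a c) : tmk M N c m (0 : N.obj c b) = 0 :=
  (congrArg _ (TensorProduct.tmul_zero _ m)).trans (map_zero _)

lemma tmk_smul_left (r : k) (m : M.obj a c) (n : N.obj c b) :
    tmk M N c (r • m) n = r • tmk M N c m n :=
  (congrArg _ (TensorProduct.smul_tmul' r m n).symm).trans (map_smul _ _ _)

lemma tmk_smul_right (r : k) (m : M.obj a c) (n : N.obj c b) :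
    tmk M N c m (r • n) = r • tmk M N c m n :=
  (congrArg _ (TensorProduct.tmul_smul r m n)).trans (map_smul _ _ _)

lemma tensor_ind {p : (tensor M N).obj a b → Prop} (h0 : p 0)
    (hadd : ∀ x y, p x → p y → p (x + y)) (h : ∀ c m n, p (tmk M N c m n)) (x) : p x := by
  classical
  refine DirectSum.induction_on (motive := p) x h0 (fun c y => ?_) hadd
  induction y with
  | zero => rw [map_zero]; exact h0
  | tmul m n => exact h c m n
  | add y z hy hz => rw [map_add]; exact hadd _ _ hy hz

open Classical in
/-- Maps out of the tensor product. -/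
def lift {W : Type u} [AddCommMonoid W] [Module k W]
    (φ : ∀ c, M.obj a c →ₗ[k] N.obj c b →ₗ[k] W) :
    (tensor M N).obj a b →ₗ[k] W := DirectSum.toModule k S W fun c => TensorProduct.lift (φ c)

@[simp] lemma lift_tmk {W : Type u} [AddCommMonoid W] [Module k W]
    (φ : ∀ c, M.obj a c →ₗ[k] N.obj c b →ₗ[k] W) (c : S) (m : M.obj a c) (n : N.obj c b) :
    lift φ (tmk M N c m n) = φ c m n := by
  classical
  exact (DirectSum.toModule_lof (φ := fun c => TensorProduct.lift (φ c)) k c (m ⊗ₜ n)).trans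
    (TensorProduct.lift.tmul m n)

variable (M N) in
/-- Pure tensors as a bilinear map. -/
def tmkₗ (a b c : S) : M.obj a c →ₗ[k] N.obj c b →ₗ[k] (tensor M N).obj a b :=
  LinearMap.mk₂ k (fun m n => tmk M N c m n) tmk_add_left tmk_smul_left tmk_add_right
    tmk_smul_right

@[simp] lemma tmkₗ_apply (m : M.obj a c) (n : N.obj c b) :
    tmkₗ M N a b c m n = tmk M N c m n := rfl

/-- The tensor product of morphisms. -/
def map (f : M ⟶ M') (g : N ⟶ N') : tensor M N ⟶ tensor M' N' :=
  ofApp fun a b => lift fun c => (tmkₗ M' N' a b c).compl₁₂ (app f a c) (app g c b)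

@[simp] lemma map_tmk (f : M ⟶ M') (g : N ⟶ N') (m : M.obj a c) (n : N.obj c b) :
    app (map f g) a b (tmk M N c m n) = tmk M' N' c (app f a c m) (app g c b n) :=
  lift_tmk _ _ _ _

variable (M N P) in
/-- The associator, `(m ⊗ n) ⊗ x ↦ m ⊗ (n ⊗ x)`. -/
def assocHom : tensor (tensor M N) P ⟶ tensor M (tensor N P) :=
  ofApp fun a b => lift fun d => lift fun c =>
    LinearMap.mk₂ k
      (fun m n => tmkₗ M (tensor N P) a b c m ∘ₗ tmkₗ N P c b d n)
      (fun m m' n => by ext; simp) (fun r m n => by ext; simp)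
      (fun m n n' => by ext; simp [tmk_add_right]) (fun r m n => by ext; simp)

variable (M N P) in
/-- The inverse associator, `m ⊗ (n ⊗ x) ↦ (m ⊗ n) ⊗ x`. -/
def assocInv : tensor M (tensor N P) ⟶ tensor (tensor M N) P :=
  ofApp fun a b => lift fun c => LinearMap.flip (lift fun d =>
    LinearMap.mk₂ k
      (fun n x => (tmkₗ (tensor M N) P a b d).flip x ∘ₗ (tmkₗ M N a d c).flip n)
      (fun m m' n => by ext; simp) (fun r m n => by ext; simp)
      (fun m n n' => by ext; simp) (fun r m n => by ext; simp))

@[simp] lemma assocHom_tmk (m : M.obj a c) (n : N.obj c d) (x : P.obj d b) :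
    app (assocHom M N P) a b (tmk (tensor M N) P d (tmk M N c m n) x) =
      tmk M (tensor N P) c m (tmk N P d n x) := by
  simp [assocHom]

@[simp] lemma assocInv_tmk (m : M.obj a c) (n : N.obj c d) (x : P.obj d b) :
    app (assocInv M N P) a b (tmk M (tensor N P) c m (tmk N P d n x)) =
      tmk (tensor M N) P d (tmk M N c m n) x := by
  simp [assocInv]

lemma hom_ext₂ {f g : tensor M N ⟶ Q}
    (h : ∀ a b c (m : M.obj a c) (n : N.obj c b), app f a b (tmk M N c m n) =
      app g a b (tmk M N c m n)) : f = g :=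
  hom_ext fun a b x => tensor_ind (p := fun x => app f a b x = app g a b x) (by simp)
    (fun x y hx hy => by simp only [map_add, hx, hy]) (h a b) x

lemma hom_ext₃ {f g : tensor (tensor M N) P ⟶ Q}
    (h : ∀ a b c d (m : M.obj a c) (n : N.obj c d) (x : P.obj d b),
      app f a b (tmk (tensor M N) P d (tmk M N c m n) x) =
      app g a b (tmk (tensor M N) P d (tmk M N c m n) x)) : f = g :=
  hom_ext₂ fun a b d y x => tensor_ind (p := fun y => app f a b (tmk (tensor M N) P d y x) =
      app g a b (tmk (tensor M N) P d y x)) (by simp only [tmk_zero_left, map_zero])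
    (fun x y hx hy => by simp only [tmk_add_left, map_add, hx, hy])
    (fun c m n => h a b c d m n x) y

lemma hom_ext₃' {f g : tensor M (tensor N P) ⟶ Q}
    (h : ∀ a b c d (m : M.obj a c) (n : N.obj c d) (x : P.obj d b),
      app f a b (tmk M (tensor N P) c m (tmk N P d n x)) =
      app g a b (tmk M (tensor N P) c m (tmk N P d n x))) : f = g :=
  hom_ext₂ fun a b c m y => tensor_ind (p := fun y => app f a b (tmk M (tensor N P) c m y) =
      app g a b (tmk M (tensor N P) c m y)) (by simp only [tmk_zero_right, map_zero])
    (fun x y hx hy => by simp only [tmk_add_right, map_add, hx, hy])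
    (fun d n x => h a b c d m n x) y

lemma hom_ext₄ {f g : tensor (tensor (tensor M N) P) M' ⟶ Q}
    (h : ∀ a b c d e (m : M.obj a c) (n : N.obj c d) (x : P.obj d e) (y : M'.obj e b),
      app f a b (tmk (tensor (tensor M N) P) M' e (tmk (tensor M N) P d (tmk M N c m n) x) y) =
      app g a b (tmk (tensor (tensor M N) P) M' e (tmk (tensor M N) P d (tmk M N c m n) x) y)) :
    f = g :=
  hom_ext₃ fun a b d e z x y => tensor_ind
    (p := fun z => app f a b (tmk (tensor (tensor M N) P) M' e (tmk (tensor M N) P d z x) y) =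
      app g a b (tmk (tensor (tensor M N) P) M' e (tmk (tensor M N) P d z x) y))
    (by simp only [tmk_zero_left, map_zero])
    (fun x y hx hy => by simp only [tmk_add_left, map_add, hx, hy])
    (fun c m n => h a b c d e m n x y) z

variable (M N P) in
/-- The associator isomorphism. -/
def assocIso : tensor (tensor M N) P ≅ tensor M (tensor N P) where
  hom := assocHom M N P
  inv := assocInv M N P
  hom_inv_id := hom_ext₃ fun a b c d m n x => by simp
  inv_hom_id := hom_ext₃' fun a b c d m n x => by simp

/-- Transport along an equality of the source vertex. -/
def castL (M : KQuiv k S) (b : S) (h : a = c) : M.obj c b →ₗ[k] M.obj a b := h ▸ LinearMap.id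

/-- Transport along an equality of the target vertex. -/
def castR (M : KQuiv k S) (a : S) (h : c = b) : M.obj a c →ₗ[k] M.obj a b := h ▸ LinearMap.id

/-- The generator of `I_S(a, b)` for `a = b`. -/
def one (k : Type u) [CommRing k] (h : a = b) : (unit k S).obj a b :=
  Finsupp.single ⟨h⟩ (1 : k)

lemma unit_ind {p : (unit k S).obj a b → Prop} (h0 : p 0) (h : ∀ (e : a = b) (r : k),
    p (r • one k e)) (x : (unit k S).obj a b) : p x := by
  by_cases e : a = b
  · have : x = (show PLift (a = b) →₀ k from x) ⟨e⟩ • one k e := by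
      refine Finsupp.ext fun i => ?_
      obtain ⟨_⟩ := i
      refine Eq.trans ?_ (Finsupp.smul_apply _ _ _).symm
      simp only [one, Finsupp.single_eq_same, smul_eq_mul, mul_one]
    rw [this]
    exact h e _
  · have : x = 0 := Finsupp.ext fun i => absurd i.down e
    rw [this]; exact h0

/-- Maps out of the unit quiver. -/
def unitLift {W : Type u} [AddCommMonoid W] [Module k W] (φ : a = b → W) :
    (unit k S).obj a b →ₗ[k] W :=
  Finsupp.lsum k fun h : PLift (a = b) => LinearMap.toSpanSingleton k W (φ h.down)

@[simp] lemma unitLift_one {W : Type u} [AddCommMonoid W] [Module k W] (φ : a = b → W)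
    (h : a = b) : unitLift φ (one k h) = φ h := by
  refine (Finsupp.lsum_single _ _ _ _).trans ?_
  simp

variable (M) in
/-- The left unit isomorphism. -/
def leftHom : tensor (unit k S) M ⟶ M := ofApp fun _ b => lift fun _ =>
  unitLift fun h => castL M b h

variable (M) in
/-- The inverse of the left unit isomorphism. -/
def leftInv : M ⟶ tensor (unit k S) M := ofApp fun a b => tmkₗ (unit k S) M a b a (one k rfl)

variable (M) in
/-- The right unit isomorphism. -/
def rightHom : tensor M (unit k S) ⟶ M := ofApp fun a _ => lift fun _ =>
  LinearMap.flip (unitLift fun h => castR M a h)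

variable (M) in
/-- The inverse of the right unit isomorphism. -/
def rightInv : M ⟶ tensor M (unit k S) := ofApp fun a b =>
  (tmkₗ M (unit k S) a b b).flip (one k rfl)

@[simp] lemma leftHom_tmk (m : M.obj a b) :
    app (leftHom M) a b (tmk (unit k S) M a (one k rfl) m) = m := by
  simp [leftHom, castL]

@[simp] lemma rightHom_tmk (m : M.obj a b) :
    app (rightHom M) a b (tmk M (unit k S) b m (one k rfl)) = m := by
  simp [rightHom, castR]

@[simp] lemma leftInv_apply (m : M.obj a b) :
    app (leftInv M) a b m = tmk (unit k S) M a (one k rfl) m := rfl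

@[simp] lemma rightInv_apply (m : M.obj a b) :
    app (rightInv M) a b m = tmk M (unit k S) b m (one k rfl) := rfl

lemma hom_ext_left {f g : tensor (unit k S) M ⟶ Q}
    (h : ∀ a b (m : M.obj a b), app f a b (tmk (unit k S) M a (one k rfl) m) =
      app g a b (tmk (unit k S) M a (one k rfl) m)) : f = g :=
  hom_ext₂ fun a b c x m => unit_ind
    (p := fun x => app f a b (tmk (unit k S) M c x m) = app g a b (tmk (unit k S) M c x m))
    (by simp only [tmk_zero_left, map_zero])
    (fun e r => by subst e; simp only [tmk_smul_left, map_smul, h]) x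

lemma hom_ext_right {f g : tensor M (unit k S) ⟶ Q}
    (h : ∀ a b (m : M.obj a b), app f a b (tmk M (unit k S) b m (one k rfl)) =
      app g a b (tmk M (unit k S) b m (one k rfl))) : f = g :=
  hom_ext₂ fun a b c m x => unit_ind
    (p := fun x => app f a b (tmk M (unit k S) c m x) = app g a b (tmk M (unit k S) c m x))
    (by simp only [tmk_zero_right, map_zero])
    (fun e r => by subst e; simp only [tmk_smul_right, map_smul, h]) x

variable (M) in
/-- The left unitor. -/
def leftIso : tensor (unit k S) M ≅ M where
  hom := leftHom M
  inv := leftInv M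
  hom_inv_id := hom_ext_left fun a b m => by simp
  inv_hom_id := hom_ext fun a b m => by simp

variable (M) in
/-- The right unitor. -/
def rightIso : tensor M (unit k S) ≅ M where
  hom := rightHom M
  inv := rightInv M
  hom_inv_id := hom_ext_right fun a b m => by simp
  inv_hom_id := hom_ext fun a b m => by simp

instance : MonoidalCategoryStruct (KQuiv k S) where
  tensorObj := tensor
  whiskerLeft M _ _ f := map (𝟙 M) f
  whiskerRight f M := map f (𝟙 M)
  tensorHom f g := map f g
  tensorUnit := unit k S
  associator := assocIso
  leftUnitor := leftIso
  rightUnitor := rightIso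

lemma triangle_aux (M N : KQuiv k S) :
    assocHom M (unit k S) N ≫ map (𝟙 M) (leftHom N) = map (rightHom M) (𝟙 N) :=
  hom_ext₂ fun a b c z n => by
    refine tensor_ind (p := fun z => app (assocHom M (unit k S) N ≫ map (𝟙 M) (leftHom N)) a b
        (tmk (tensor M (unit k S)) N c z n) =
        app (map (rightHom M) (𝟙 N)) a b (tmk (tensor M (unit k S)) N c z n))
      (by simp only [tmk_zero_left, map_zero])
      (fun x y hx hy => by simp only [tmk_add_left, map_add, hx, hy]) (fun d m x => ?_) z
    refine unit_ind (p := fun x => app (assocHom M (unit k S) N ≫ map (𝟙 M) (leftHom N)) a b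
        (tmk (tensor M (unit k S)) N c (tmk M (unit k S) d m x) n) =
        app (map (rightHom M) (𝟙 N)) a b
          (tmk (tensor M (unit k S)) N c (tmk M (unit k S) d m x) n))
      (by simp only [tmk_zero_left, tmk_zero_right, map_zero]) (fun e r => ?_) x
    subst e
    simp only [tmk_smul_left, tmk_smul_right, map_smul, comp_app, map_tmk, assocHom_tmk,
      leftHom_tmk, rightHom_tmk, id_app]

/-- The monoidal structure `(⊗_S, I_S)` on quivers. -/
instance : MonoidalCategory (KQuiv k S) := MonoidalCategory.ofTensorHom
  (id_tensorHom_id := fun M N => hom_ext₂ fun a b c m n => map_tmk _ _ _ _)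
  (id_tensorHom := fun _ _ _ _ => rfl)
  (tensorHom_id := fun _ _ => rfl)
  (tensorHom_comp_tensorHom := fun f g f' g' => by
    change map f g ≫ map f' g' = map (f ≫ f') (g ≫ g')
    exact hom_ext₂ fun a b c m n => by simp)
  (associator_naturality := fun {X₁ X₂ X₃ Y₁ Y₂ Y₃} f g h => by
    change map (map f g) h ≫ assocHom Y₁ Y₂ Y₃ = assocHom X₁ X₂ X₃ ≫ map f (map g h)
    exact hom_ext₃ fun a b c d m n x => by simp)
  (leftUnitor_naturality := fun {M N} f => by
    change map (𝟙 _) f ≫ leftHom N = leftHom M ≫ f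
    exact hom_ext_left fun a b m => by simp)
  (rightUnitor_naturality := fun {M N} f => by
    change map f (𝟙 _) ≫ rightHom N = rightHom M ≫ f
    exact hom_ext_right fun a b m => by simp)
  (pentagon := fun W X Y Z => by
    change map (assocHom W X Y) (𝟙 Z) ≫ assocHom W (tensor X Y) Z ≫ map (𝟙 W) (assocHom X Y Z) =
      assocHom (tensor W X) Y Z ≫ assocHom W X (tensor Y Z)
    exact hom_ext₄ fun a b c d e m n x y => by simp)
  (triangle := fun M N => triangle_aux M N)

end

end

end KQuiv

/-! ## Templicial modules -/

/-- A templicial `k`-module with vertex set `S`: a strongly unital colax monoidal functor from the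
opposite of the finite interval category to quivers. -/
structure TemplicialModule (k : Type u) [CommRing k] (S : Type u) where
  X : Fintᵒᵖ ⥤ KQuiv k S
  [colax : X.OplaxMonoidal]
  [unital : IsIso (η X)]

attribute [instance] TemplicialModule.colax TemplicialModule.unital

/-- Necklicial `k`-modules. -/
abbrev NecklicialModule (k : Type u) [CommRing k] := Necᵒᵖ ⥤ ModuleCat.{u} k

namespace TemplicialModule

noncomputable section

variable {k : Type u} [CommRing k] {S : Type u}

/-- The necklicial module `X_•(a, b)`. -/
def nec (A : TemplicialModule k S) (a b : S) : NecklicialModule k :=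
  necklicial A.X ⋙ KQuiv.eval a b

/-- Levelwise flatness: all the modules `X_n(a, b)` are flat. -/
def LevelwiseFlat (A : TemplicialModule k S) : Prop :=
  ∀ (n : ℕ) (a b : S), Module.Flat k ((A.X.obj (op ⟨n⟩)).obj a b)

end

end TemplicialModule

/-! ## Free templicial modules -/

namespace Free

open Simplicial SimplexCategory

/-- The inclusion of the finite interval category into the simplex category. -/
def toSimplex {m n : Fint} (f : m ⟶ n) : ⦋m.len⦌ ⟶ ⦋n.len⦌ := SimplexCategory.mkHom (Fint.fn f)

/-- The `i`-th vertex of a simplex. -/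
def vertex (K : SSet.{u}) {n : ℕ} (i : Fin (n + 1)) (x : K _⦋n⦌) : K _⦋0⦌ :=
  K.map (SimplexCategory.const ⦋0⦌ ⦋n⦌ i).op x

/-- The `n`-simplices with first vertex `a` and last vertex `b`. -/
def Simp (K : SSet.{u}) (n : ℕ) (a b : K _⦋0⦌) : Type u :=
  {x : K _⦋n⦌ // vertex K 0 x = a ∧ vertex K (Fin.last n) x = b}

variable (K : SSet.{u})

lemma map_map {l m n : ℕ} (φ : ⦋l⦌ ⟶ ⦋m⦌) (ψ : ⦋m⦌ ⟶ ⦋n⦌) (x : K _⦋n⦌) :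
    K.map φ.op (K.map ψ.op x) = K.map (φ ≫ ψ).op x := by
  rw [op_comp, Functor.map_comp_apply]

lemma vertex_map {m n : ℕ} (φ : ⦋m⦌ ⟶ ⦋n⦌) (i : Fin (m + 1)) (x : K _⦋n⦌) :
    vertex K i (K.map φ.op x) = vertex K (φ.toOrderHom i) x := by
  unfold vertex
  rw [map_map, SimplexCategory.const_comp]

lemma vertex_vertex (x : K _⦋0⦌) (i : Fin 1) : vertex K i x = x := by
  unfold vertex
  rw [SimplexCategory.hom_zero_zero (SimplexCategory.const _ _ _), op_id, Functor.map_id_apply]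

lemma vertex_app {K L : SSet.{u}} (φ : K ⟶ L) {n : ℕ} (i : Fin (n + 1)) (x : K _⦋n⦌) :
    vertex L i (φ.app _ x) = φ.app _ (vertex K i x) :=
  (NatTrans.naturality_apply φ (SimplexCategory.const ⦋0⦌ ⦋n⦌ i).op x).symm

noncomputable section

variable (k : Type u) [CommRing k]

/-- The quiver `F(K_n)`: its value at `(a, b)` is the free module on the `n`-simplices from `a`
to `b`. -/
def quiver (n : ℕ) : KQuiv k (K _⦋0⦌) :=
  ⟨fun a b => ModuleCat.of k (Simp K n a b →₀ k)⟩

variable {K} {n m l : ℕ} {a b : K _⦋0⦌}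

/-- The generator given by a simplex. -/
def gen (x : K _⦋n⦌) (ha : vertex K 0 x = a) (hb : vertex K (Fin.last n) x = b) :
    (quiver K k n).obj a b := Finsupp.single (⟨x, ha, hb⟩ : Simp K n a b) (1 : k)

variable {k}

/-- Maps out of `F(K_n)(a, b)`. -/
def lift {W : Type u} [AddCommMonoid W] [Module k W] (φ : Simp K n a b → W) :
    (quiver K k n).obj a b →ₗ[k] W := Finsupp.linearCombination k φ

@[simp] lemma lift_gen {W : Type u} [AddCommMonoid W] [Module k W] (φ : Simp K n a b → W)
    (x : K _⦋n⦌) (ha : vertex K 0 x = a) (hb : vertex K (Fin.last n) x = b) :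
    lift φ (gen k x ha hb) = φ ⟨x, ha, hb⟩ :=
  (Finsupp.linearCombination_single _ _ _).trans (one_smul _ _)

lemma hom_ext {M : KQuiv k (K _⦋0⦌)} {f g : quiver K k n ⟶ M}
    (h : ∀ a b (x : K _⦋n⦌) (ha : vertex K 0 x = a) (hb : vertex K (Fin.last n) x = b),
      KQuiv.app f a b (gen k x ha hb) = KQuiv.app g a b (gen k x ha hb)) : f = g :=
  KQuiv.Hom.ext (funext fun a => funext fun b => Finsupp.lhom_ext' fun x =>
    LinearMap.ext_ring (h a b x.1 x.2.1 x.2.2))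

lemma gen_congr {x x' : K _⦋n⦌} (h : x = x') (ha : vertex K 0 x = a)
    (hb : vertex K (Fin.last n) x = b) (ha' : vertex K 0 x' = a)
    (hb' : vertex K (Fin.last n) x' = b) : gen k x ha hb = gen k x' ha' hb' := by
  subst h; rfl

lemma tmk_congr {x x' : K _⦋n⦌} {y y' : K _⦋m⦌} {c c' : K _⦋0⦌} (h : x = x') (h' : y = y')
    (ha : vertex K 0 x = a) (hc : vertex K (Fin.last n) x = c)
    (hd : vertex K 0 y = c) (hb : vertex K (Fin.last m) y = b)
    (ha' : vertex K 0 x' = a) (hc' : vertex K (Fin.last n) x' = c')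
    (hd' : vertex K 0 y' = c') (hb' : vertex K (Fin.last m) y' = b) :
    KQuiv.tmk _ _ c (gen k x ha hc) (gen k y hd hb) =
      KQuiv.tmk _ _ c' (gen k x' ha' hc') (gen k y' hd' hb') := by
  subst h h' hc hc'; rfl

lemma tmk_congr₃ {x x' : K _⦋n⦌} {y y' : K _⦋m⦌} {z z' : K _⦋l⦌} {c c' d d' : K _⦋0⦌}
    (h : x = x') (h' : y = y') (h'' : z = z')
    (h1 : vertex K 0 x = a) (h2 : vertex K (Fin.last n) x = c)
    (h3 : vertex K 0 y = c) (h4 : vertex K (Fin.last m) y = d)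
    (h5 : vertex K 0 z = d) (h6 : vertex K (Fin.last l) z = b)
    (h1' : vertex K 0 x' = a) (h2' : vertex K (Fin.last n) x' = c')
    (h3' : vertex K 0 y' = c') (h4' : vertex K (Fin.last m) y' = d')
    (h5' : vertex K 0 z' = d') (h6' : vertex K (Fin.last l) z' = b) :
    KQuiv.tmk _ _ c (gen k x h1 h2) (KQuiv.tmk _ _ d (gen k y h3 h4) (gen k z h5 h6)) =
      KQuiv.tmk _ _ c' (gen k x' h1' h2')
        (KQuiv.tmk _ _ d' (gen k y' h3' h4') (gen k z' h5' h6')) := by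
  subst h h' h'' h2 h2' h4 h4'; rfl

variable (K k) in
/-- The action of a morphism of the finite interval category. -/
def mapHom {m n : Fint} (f : m ⟶ n) : quiver K k n.len ⟶ quiver K k m.len :=
  KQuiv.ofApp fun _ _ => lift fun x => gen k (K.map (toSimplex f).op x.1)
    (by rw [vertex_map]; exact (congrArg (vertex K · x.1) (Fint.fn_zero f)).trans x.2.1)
    (by rw [vertex_map]; exact (congrArg (vertex K · x.1) (Fint.fn_last f)).trans x.2.2)

lemma mapHom_gen {m n : Fint} (f : m ⟶ n) (x : K _⦋n.len⦌)
    (ha : vertex K 0 x = a) (hb : vertex K (Fin.last _) x = b) :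
    KQuiv.app (mapHom K k f) a b (gen k x ha hb) =
      gen k (K.map (toSimplex f).op x)
        (by rw [vertex_map]; exact (congrArg (vertex K · x) (Fint.fn_zero f)).trans ha)
        (by rw [vertex_map]; exact (congrArg (vertex K · x) (Fint.fn_last f)).trans hb) :=
  lift_gen _ x ha hb

lemma mapHom_id (n : Fint) : mapHom K k (𝟙 n) = 𝟙 (quiver K k n.len) :=
    hom_ext fun a b x ha hb => by
  rw [mapHom_gen, KQuiv.id_app]
  refine gen_congr ?_ _ _ _ _
  exact ConcreteCategory.congr_hom (K.map_id (op ⦋n.len⦌)) x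

lemma mapHom_comp {l m n : Fint} (f : l ⟶ m) (g : m ⟶ n) :
    mapHom K k (f ≫ g) = mapHom K k g ≫ mapHom K k f := hom_ext fun a b x ha hb => by
  rw [KQuiv.comp_app, mapHom_gen, mapHom_gen, mapHom_gen]
  refine gen_congr ?_ _ _ _ _
  rw [map_map]; rfl

variable (K k) in
/-- The underlying functor of the free templicial module on `K`. -/
def functor : Fintᵒᵖ ⥤ KQuiv k (K _⦋0⦌) where
  obj n := quiver K k n.unop.len
  map f := mapHom K k f.unop
  map_id n := mapHom_id n.unop
  map_comp f g := mapHom_comp g.unop f.unop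

/-- The front face of dimension `m` of an `(m + n)`-simplex. -/
def front (m n : ℕ) (x : K _⦋m + n⦌) : K _⦋m⦌ := K.map (subinterval 0 m (by omega)).op x

/-- The back face of dimension `n` of an `(m + n)`-simplex. -/
def back (m n : ℕ) (x : K _⦋m + n⦌) : K _⦋n⦌ := K.map (subinterval m n le_rfl).op x

lemma front_zero (x : K _⦋m + n⦌) : vertex K 0 (front m n x) = vertex K 0 x := by
  rw [front, vertex_map]; rfl

lemma back_last (x : K _⦋m + n⦌) :
    vertex K (Fin.last _) (back m n x) = vertex K (Fin.last _) x := by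
  rw [back, vertex_map]; exact congrArg (vertex K · x) (Fin.ext (Nat.add_comm _ _))

lemma front_last (x : K _⦋m + n⦌) :
    vertex K (Fin.last _) (front m n x) = vertex K 0 (back m n x) := by
  rw [front, back, vertex_map, vertex_map]
  exact congrArg (vertex K · x) (Fin.ext (Nat.add_comm _ _))

variable (K k) in
/-- The comultiplication `x ↦ x|_{0, ..., m} ⊗ x|_{m, ..., m + n}`. -/
def comul (m n : ℕ) : quiver K k (m + n) ⟶ KQuiv.tensor (quiver K k m) (quiver K k n) :=
  KQuiv.ofApp fun _ _ => lift fun x => KQuiv.tmk _ _ (vertex K 0 (back m n x.1))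
    (gen k (front m n x.1) ((front_zero x.1).trans x.2.1) (front_last x.1))
    (gen k (back m n x.1) rfl ((back_last x.1).trans x.2.2))

lemma comul_gen (x : K _⦋m + n⦌) (ha : vertex K 0 x = a) (hb : vertex K (Fin.last _) x = b) :
    KQuiv.app (comul K k m n) a b (gen k x ha hb) =
      KQuiv.tmk _ _ (vertex K 0 (back m n x))
        (gen k (front m n x) ((front_zero x).trans ha) (front_last x))
        (gen k (back m n x) rfl ((back_last x).trans hb)) :=
  lift_gen _ _ _ _

variable (K k) in
/-- The counit `F(K_0) → I`. -/
def counit : quiver K k 0 ⟶ KQuiv.unit k (K _⦋0⦌) :=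
  KQuiv.ofApp fun _ _ => lift fun x => KQuiv.one k
    (by have := x.2; rw [vertex_vertex, vertex_vertex] at this; exact this.1.symm.trans this.2)

variable (K k) in
/-- The inverse of the counit. -/
def counitInv : KQuiv.unit k (K _⦋0⦌) ⟶ quiver K k 0 :=
  KQuiv.ofApp fun a _ => KQuiv.unitLift fun h => gen k a (vertex_vertex K _ _)
    ((vertex_vertex K _ _).trans h)

lemma counit_gen (x : K _⦋0⦌) (ha : vertex K 0 x = a) (hb : vertex K (Fin.last _) x = b) :
    KQuiv.app (counit K k) a b (gen k x ha hb) =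
      KQuiv.one k (ha.symm.trans ((vertex_vertex K x _).trans
        ((vertex_vertex K x _).symm.trans hb))) :=
  lift_gen _ _ _ _

lemma simplex_ext {m n : ℕ} {f g : ⦋m⦌ ⟶ ⦋n⦌}
    (h : ∀ i : Fin (m + 1), (f.toOrderHom i : ℕ) = g.toOrderHom i) : f = g :=
  SimplexCategory.Hom.ext _ _ (OrderHom.ext _ _ (funext fun i => Fin.ext (h i)))

lemma comul_natural {m n m' n' : Fint} (f : m' ⟶ m) (g : n' ⟶ n) :
    comul K k m.len n.len ≫ KQuiv.map (mapHom K k f) (mapHom K k g) =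
      mapHom K k (Fint.add f g) ≫ comul K k m'.len n'.len :=
  hom_ext fun a b x ha hb => by
    rw [KQuiv.comp_app, KQuiv.comp_app, mapHom_gen, comul_gen, comul_gen, KQuiv.map_tmk,
      mapHom_gen, mapHom_gen]
    refine tmk_congr ?_ ?_ _ _ _ _ _ _ _ _
    · rw [front, front, map_map, map_map]
      refine congrArg (fun φ => K.map (Quiver.Hom.op φ) x) (simplex_ext fun i => ?_)
      change (Fint.fn f i : ℕ) + 0 = (Fint.fn (Fint.add f g) _ : ℕ)
      have hi : (i : ℕ) ≤ m'.len := Nat.le_of_lt_succ i.2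
      rw [Fint.fn_eq_val, Fint.fn_eq_val]
      change _ = Fint.val (Fint.add f g) (i + 0)
      rw [Fint.val_add _ _ (by omega), add_zero, add_zero, Nat.sub_eq_zero_of_le hi, Fint.val_zero,
        add_zero]
    · rw [back, back, map_map, map_map]
      refine congrArg (fun φ => K.map (Quiver.Hom.op φ) x) (simplex_ext fun i => ?_)
      change (Fint.fn g i : ℕ) + m.len = (Fint.fn (Fint.add f g) _ : ℕ)
      have hi : (i : ℕ) ≤ n'.len := Nat.le_of_lt_succ i.2
      rw [Fint.fn_eq_val, Fint.fn_eq_val]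
      change _ = Fint.val (Fint.add f g) (i + m'.len)
      rw [Fint.val_add _ _ (by omega), Fint.val_of_ge f (by omega), Nat.add_sub_cancel, add_comm]

lemma comul_assoc (m n l : Fint) :
    comul K k (m.len + n.len) l.len ≫ KQuiv.map (comul K k m.len n.len) (𝟙 _) ≫
      KQuiv.assocHom _ _ _ =
    mapHom K k (α_ m n l).inv ≫ comul K k m.len (n.len + l.len) ≫
      KQuiv.map (𝟙 _) (comul K k n.len l.len) :=
  hom_ext fun a b x ha hb => by
    rw [KQuiv.comp_app, KQuiv.comp_app, KQuiv.comp_app, KQuiv.comp_app, mapHom_gen, comul_gen,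
      comul_gen, KQuiv.map_tmk, KQuiv.map_tmk, comul_gen, comul_gen, KQuiv.id_app, KQuiv.id_app,
      KQuiv.assocHom_tmk]
    refine tmk_congr₃ ?_ ?_ ?_ _ _ _ _ _ _ _ _ _ _ _ _
    · simp only [front, map_map]
      exact congrArg (fun φ => K.map (Quiver.Hom.op φ) x) (simplex_ext fun i => rfl)
    · simp only [front, back, map_map]
      exact congrArg (fun φ => K.map (Quiver.Hom.op φ) x) (simplex_ext fun i => by
        change (i : ℕ) + m.len + 0 = (i : ℕ) + 0 + m.len
        omega)
    · simp only [back, map_map]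
      exact congrArg (fun φ => K.map (Quiver.Hom.op φ) x) (simplex_ext fun i => by
        change (i : ℕ) + (m.len + n.len) = (i : ℕ) + n.len + m.len
        omega)

lemma tmk_one_left {x y : K _⦋n⦌} {c : K _⦋0⦌} (h : y = x) (e : a = c) (ha : vertex K 0 x = a)
    (hb : vertex K (Fin.last _) x = b) (ha' : vertex K 0 y = c)
    (hb' : vertex K (Fin.last _) y = b) :
    KQuiv.tmk (KQuiv.unit k _) _ c (KQuiv.one k e) (gen k y ha' hb') =
      KQuiv.tmk _ _ a (KQuiv.one k rfl) (gen k x ha hb) := by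
  subst h e; rfl

lemma tmk_one_right {x y : K _⦋n⦌} {c : K _⦋0⦌} (h : y = x) (e : c = b) (ha : vertex K 0 x = a)
    (hb : vertex K (Fin.last _) x = b) (ha' : vertex K 0 y = a)
    (hb' : vertex K (Fin.last _) y = c) :
    KQuiv.tmk _ (KQuiv.unit k _) c (gen k y ha' hb') (KQuiv.one k e) =
      KQuiv.tmk _ _ b (gen k x ha hb) (KQuiv.one k rfl) := by
  subst h e; rfl

lemma comul_left (n : Fint) :
    mapHom K k (λ_ n).hom ≫ comul K k 0 n.len ≫ KQuiv.map (counit K k) (𝟙 _) =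
      KQuiv.leftInv _ :=
  hom_ext fun a b x ha hb => by
    rw [KQuiv.comp_app, KQuiv.comp_app, mapHom_gen, comul_gen, KQuiv.map_tmk, counit_gen]
    rw [KQuiv.id_app, KQuiv.leftInv_apply]
    refine tmk_one_left ?_ _ _ _ _ _
    simp only [back, map_map]
    refine Eq.trans ?_ (ConcreteCategory.congr_hom (K.map_id (op ⦋n.len⦌)) x)
    exact congrArg (fun φ => K.map (Quiver.Hom.op φ) x) (simplex_ext fun i => rfl)

lemma comul_right (n : Fint) :
    mapHom K k (ρ_ n).hom ≫ comul K k n.len 0 ≫ KQuiv.map (𝟙 _) (counit K k) =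
      KQuiv.rightInv _ :=
  hom_ext fun a b x ha hb => by
    rw [KQuiv.comp_app, KQuiv.comp_app, mapHom_gen, comul_gen, KQuiv.map_tmk, counit_gen]
    rw [KQuiv.id_app, KQuiv.rightInv_apply]
    refine tmk_one_right ?_ _ _ _ _ _
    simp only [front, map_map]
    refine Eq.trans ?_ (ConcreteCategory.congr_hom (K.map_id (op ⦋n.len⦌)) x)
    exact congrArg (fun φ => K.map (Quiver.Hom.op φ) x) (simplex_ext fun i => rfl)

instance : (functor K k).OplaxMonoidal where
  η := counit K k
  δ m n := comul K k m.unop.len n.unop.len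
  δ_natural_left f m := by
    have := comul_natural (K := K) (k := k) f.unop (𝟙 m.unop)
    rw [mapHom_id] at this
    exact this
  δ_natural_right m f := by
    have := comul_natural (K := K) (k := k) (𝟙 m.unop) f.unop
    rw [mapHom_id] at this
    exact this
  oplax_associativity m n l := comul_assoc m.unop n.unop l.unop
  oplax_left_unitality n := (comul_left n.unop).symm
  oplax_right_unitality n := (comul_right n.unop).symm

lemma counitInv_one (h : a = b) :
    KQuiv.app (counitInv K k) a b (KQuiv.one k h) =
      gen k a (vertex_vertex K _ _) ((vertex_vertex K _ _).trans h) := by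
  rw [counitInv, KQuiv.app_ofApp, KQuiv.unitLift_one]

lemma counit_counitInv : counit K k ≫ counitInv K k = 𝟙 (quiver K k 0) :=
  hom_ext fun a b x ha hb => by
    rw [KQuiv.comp_app, counit_gen, KQuiv.id_app, counitInv_one]
    exact gen_congr (ha.symm.trans (vertex_vertex K x _)) _ _ _ _

lemma counitInv_counit : counitInv K k ≫ counit K k = 𝟙 (KQuiv.unit k (K _⦋0⦌)) :=
  KQuiv.hom_ext fun a b x => by
    refine KQuiv.unit_ind (p := fun x => KQuiv.app (counitInv K k ≫ counit K k) a b x =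
      KQuiv.app (𝟙 (KQuiv.unit k (K _⦋0⦌))) a b x) (by rw [map_zero, map_zero])
      (fun e r => ?_) x
    rw [map_smul, map_smul, KQuiv.comp_app, KQuiv.id_app, counitInv_one, counit_gen]

instance : IsIso (η (functor K k)) := ⟨counitInv K k, counit_counitInv, counitInv_counit⟩

variable (K k) in
/-- The free templicial module `F̃(K)` on a simplicial set `K`. -/
def templicial : TemplicialModule k (K _⦋0⦌) where
  X := functor K k

end

end Free

/-! ## Naturality of the functor on necklaces -/

section Change

variable {V W : Type*} [Category V] [MonoidalCategory V] [Category W] [MonoidalCategory W]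
  (X : Fintᵒᵖ ⥤ V) [X.OplaxMonoidal] (Y : Fintᵒᵖ ⥤ W) [Y.OplaxMonoidal]
  (G : W ⥤ V) [G.LaxMonoidal] (α : X ⟶ Y ⋙ G)

open Functor.LaxMonoidal (μ μ_natural μ_natural_left μ_natural_right)

/-- Compatibility of `α : X → G ∘ Y` with the comultiplications, for a lax monoidal functor `G`. -/
def CompatComul : Prop :=
  ∀ m n : Fintᵒᵖ, α.app (m ⊗ n) ≫ G.map (δ Y m n) =
    δ X m n ≫ (α.app m ⊗ₘ α.app n) ≫ μ G (Y.obj m) (Y.obj n)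

variable {p q : ℕ}

/-- The map induced by `α` on tensor products of beads. -/
def beadsMap (z : Fin (p + 1)) : ∀ (a : Fin (p + 1)) (l : List (Fin (p + 1))),
    beads X z a l ⟶ G.obj (beads Y z a l)
  | a, [] => α.app (op (seg a z))
  | a, b :: l => (α.app (op (seg a b)) ⊗ₘ beadsMap z b l) ≫ μ G _ _

lemma beadsMap_active (f : (⟨p⟩ : Fint) ⟶ ⟨q⟩) {z a : Fin (p + 1)} {z' a' : Fin (q + 1)}
    (hz : Fint.fn f z = z') (ha : Fint.fn f a = a') {l : List (Fin (p + 1))}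
    {l' : List (Fin (q + 1))} (hl : l.map (Fint.fn f) = l') :
    active X f hz ha hl ≫ beadsMap X Y G α z a l =
      beadsMap X Y G α z' a' l' ≫ G.map (active Y f hz ha hl) := by
  induction l generalizing a a' l' with
  | nil =>
    subst hl
    exact α.naturality (restr f ha hz).op
  | cons b l ih =>
    subst hl
    have n := α.naturality (restr f ha (rfl : Fint.fn f b = _)).op
    have i := ih (a' := Fint.fn f b) rfl rfl
    change (beadMap X f ha rfl ⊗ₘ active X f hz rfl rfl) ≫
        (α.app (op (seg a b)) ⊗ₘ beadsMap X Y G α z b l) ≫ μ G _ _ =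
      ((α.app (op (seg a' (Fint.fn f b))) ⊗ₘ beadsMap X Y G α z' _ (l.map (Fint.fn f))) ≫
        μ G _ _) ≫ G.map (beadMap Y f ha rfl ⊗ₘ active Y f hz rfl rfl)
    rw [Category.assoc, ← μ_natural, ← Category.assoc, ← Category.assoc,
      tensorHom_comp_tensorHom, tensorHom_comp_tensorHom, i]
    exact congrArg (fun t => (t ⊗ₘ _) ≫ _) n

variable {X Y G α} in
lemma CompatComul.comul (hα : CompatComul X Y G α) (a b c : Fin (p + 1)) :
    α.app (op (seg a c)) ≫ G.map (comul Y a b c) =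
      comul X a b c ≫ (α.app (op (seg a b)) ⊗ₘ α.app (op (seg b c))) ≫ μ G _ _ := by
  have n := α.naturality (glue a b c).op
  have h := hα (op (seg a b)) (op (seg b c))
  dsimp only [Templicial.comul]
  rw [G.map_comp, Category.assoc, ← h]
  refine (Category.assoc _ _ _).symm.trans ?_
  refine Eq.trans ?_ (Category.assoc _ _ _)
  exact congrArg (· ≫ _) n.symm

lemma assoc_aux {V W : Type*} [Category V] [MonoidalCategory V] [Category W] [MonoidalCategory W]
    (G : W ⥤ V) [G.LaxMonoidal] {x y z l : V} {x' y' z' l' : W} (d : x ⟶ y ⊗ z)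
    (d' : x' ⟶ y' ⊗ z') (α : x ⟶ G.obj x') (β : y ⟶ G.obj y') (γ : z ⟶ G.obj z')
    (θ : l ⟶ G.obj l')
    (h : α ≫ G.map d' = d ≫ (β ⊗ₘ γ) ≫ Functor.LaxMonoidal.μ G y' z') :
    ((α ⊗ₘ θ) ≫ Functor.LaxMonoidal.μ G x' l') ≫ G.map (d' ▷ l' ≫ (α_ y' z' l').hom) =
      (d ▷ l ≫ (α_ y z l).hom) ≫ (β ⊗ₘ ((γ ⊗ₘ θ) ≫ Functor.LaxMonoidal.μ G z' l')) ≫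
        Functor.LaxMonoidal.μ G y' (z' ⊗ l') := by
  have as := Functor.LaxMonoidal.associativity G y' z' l'
  have e1 : (β ⊗ₘ ((γ ⊗ₘ θ) ≫ Functor.LaxMonoidal.μ G z' l')) =
      (β ⊗ₘ (γ ⊗ₘ θ)) ≫ G.obj y' ◁ Functor.LaxMonoidal.μ G z' l' := by
    rw [← MonoidalCategory.id_tensorHom, tensorHom_comp_tensorHom, Category.comp_id]
  have e2 : (α ⊗ₘ θ) ≫ G.map d' ▷ G.obj l' =
      d ▷ l ≫ ((β ⊗ₘ γ) ⊗ₘ θ) ≫ Functor.LaxMonoidal.μ G y' z' ▷ G.obj l' := by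
    rw [← MonoidalCategory.tensorHom_id, ← MonoidalCategory.tensorHom_id,
      ← MonoidalCategory.tensorHom_id, tensorHom_comp_tensorHom, tensorHom_comp_tensorHom,
      tensorHom_comp_tensorHom, h, Category.comp_id, Category.id_comp]
  rw [G.map_comp, Category.assoc, Category.assoc, ← Functor.LaxMonoidal.μ_natural_left_assoc,
    reassoc_of% e2, as, e1, Category.assoc,
    MonoidalCategory.associator_naturality_assoc]

variable {X Y G α} in
lemma beadsMap_cut (hα : CompatComul X Y G α) (z a b : Fin (p + 1)) (l : List (Fin (p + 1))) :
    beadsMap X Y G α z a l ≫ G.map (cut Y z a b l) =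
      cut X z a b l ≫ (α.app (op (seg a b)) ⊗ₘ beadsMap X Y G α z b l) ≫ μ G _ _ := by
  cases l with
  | nil => exact hα.comul a b z
  | cons c l =>
    exact assoc_aux G _ _ _ _ _ _ (hα.comul a b c)

variable {X Y G α} in
lemma beadsMap_subdiv (hα : CompatComul X Y G α) {z a : Fin (p + 1)}
    {l₁ l₂ : List (Fin (p + 1))} (h : l₁.Sublist l₂) :
    subdiv X h ≫ beadsMap X Y G α z a l₂ = beadsMap X Y G α z a l₁ ≫ G.map (subdiv Y h) := by
  induction l₂ generalizing a l₁ with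
  | nil =>
    cases List.sublist_nil.1 h
    rw [subdiv_refl, subdiv_refl, Category.id_comp, G.map_id, Category.comp_id]
  | cons b l₂ ih =>
    by_cases hc : ∃ t, l₁ = b :: t
    · obtain ⟨t, rfl⟩ := hc
      rw [subdiv_cons_self, subdiv_cons_self]
      simp only [beadsMap, Category.assoc]
      rw [← μ_natural_right, ← MonoidalCategory.id_tensorHom, ← MonoidalCategory.id_tensorHom,
        ← Category.assoc, ← Category.assoc, tensorHom_comp_tensorHom, tensorHom_comp_tensorHom,
        ih, Category.id_comp]
      exact congrArg (fun t => (t ⊗ₘ _) ≫ _) (Category.comp_id _).symm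
    · have hc' : ∀ t, l₁ ≠ b :: t := fun t e => hc ⟨t, e⟩
      have h' := sublist_of_not_head h hc'
      rw [subdiv_cons_ne X h h' hc', subdiv_cons_ne Y h h' hc', G.map_comp, ← Category.assoc,
        beadsMap_cut hα, Category.assoc, Category.assoc, Category.assoc]
      simp only [beadsMap]
      rw [← μ_natural_right, ← MonoidalCategory.id_tensorHom, ← MonoidalCategory.id_tensorHom,
        tensorHom_comp_tensorHom_assoc, tensorHom_comp_tensorHom_assoc,
        ih, Category.id_comp]
      exact congrArg (fun t => _ ≫ (t ⊗ₘ _) ≫ _) (Category.comp_id _).symm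

variable [IsIso (η X)] [IsIso (η Y)]

variable {X Y G α} in
/-- The natural transformation `X_• → G ∘ Y_•` induced by `α : X → G ∘ Y`. -/
def necklicialMap (hα : CompatComul X Y G α) : necklicial X ⟶ necklicial Y ⋙ G where
  app T := beadsMap X Y G α (Fin.last _) 0 T.unop.inner
  naturality T U f := by
    have h1 := beadsMap_active X Y G α f.unop.toFint (Fint.fn_last _) (Fint.fn_zero _)
      (rfl : U.unop.inner.map (Fint.fn f.unop.toFint) = _)
    have h2 := beadsMap_subdiv hα (z := Fin.last _) (a := 0) f.unop.inner_sublist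
    refine (Category.assoc _ _ _).trans ((congrArg (_ ≫ ·) h1).trans ?_)
    refine (Category.assoc _ _ _).symm.trans ((congrArg (· ≫ _) h2).trans ?_)
    exact (Category.assoc _ _ _).trans (congrArg (_ ≫ ·) (G.map_comp _ _).symm)

end Change

namespace KQuiv

noncomputable section

variable {k : Type u} [CommRing k] {S S' : Type u} (g : S → S')

/-- Restriction of quivers along a map of vertices. -/
@[reducible]
def pull (M : KQuiv k S') : KQuiv k S := ⟨fun a b => M.obj (g a) (g b)⟩

/-- Restriction of morphisms of quivers along a map of vertices. -/
def pullMap {M N : KQuiv k S'} (f : M ⟶ N) : pull g M ⟶ pull g N :=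
  ofApp fun a b => app f (g a) (g b)

/-- The restriction functor `g^*` along a map of vertices. -/
def pullback : KQuiv k S' ⥤ KQuiv k S where
  obj := pull g
  map := pullMap g

/-- The canonical map `g^*M ⊗_S g^*N → g^*(M ⊗_{S'} N)`. -/
def pullTensor (M N : KQuiv k S') : tensor (pull g M) (pull g N) ⟶ pull g (tensor M N) :=
  ofApp fun a b => lift fun c => tmkₗ M N (g a) (g b) (g c)

/-- The canonical map `I_S → g^*I_{S'}`. -/
def pullUnit : unit k S ⟶ pull g (unit k S') :=
  ofApp fun a b => unitLift (W := (unit k S').obj (g a) (g b)) fun h => one k (congrArg g h)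

variable {g} in
lemma pullMap_app {M N : KQuiv k S'} (f : M ⟶ N) (a b : S) (x : M.obj (g a) (g b)) :
    app (pullMap g f) a b x = app f (g a) (g b) x := rfl

lemma pullTensor_tmk (M N : KQuiv k S') {a b : S} (c : S) (m : M.obj (g a) (g c))
    (n : N.obj (g c) (g b)) :
    app (pullTensor g M N) a b (tmk (pull g M) (pull g N) c m n) = tmk M N (g c) m n :=
  lift_tmk _ _ _ _

lemma pullUnit_one {a b : S} (h : a = b) :
    app (pullUnit (k := k) g) a b (one k h) =
      (one k (congrArg g h) : (unit k S').obj (g a) (g b)) := by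
  rw [pullUnit, app_ofApp, unitLift_one]

lemma pullTensor_natural {M N M' N' : KQuiv k S'} (f : M ⟶ M') (f' : N ⟶ N') :
    map (pullMap g f) (pullMap g f') ≫ pullTensor g M' N' =
      pullTensor g M N ≫ pullMap g (map f f') :=
  hom_ext₂ fun a b c m n => by
    rw [comp_app, comp_app, map_tmk, pullTensor_tmk, pullTensor_tmk, pullMap_app,
      pullMap_app, pullMap_app, map_tmk]

lemma pullTensor_assoc (M N P : KQuiv k S') :
    map (pullTensor g M N) (𝟙 (pull g P)) ≫ pullTensor g (tensor M N) P ≫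
        pullMap g (assocHom M N P) =
      assocHom _ _ _ ≫ map (𝟙 (pull g M)) (pullTensor g N P) ≫ pullTensor g M (tensor N P) :=
  hom_ext₃ fun a b c d m n x => by
    rw [comp_app, comp_app, comp_app, comp_app, map_tmk, pullTensor_tmk, id_app, pullTensor_tmk,
      pullMap_app, assocHom_tmk, assocHom_tmk, map_tmk, pullTensor_tmk, id_app, pullTensor_tmk]

lemma pullTensor_left (M : KQuiv k S') :
    leftHom (pull g M) =
      map (pullUnit g) (𝟙 (pull g M)) ≫ pullTensor g (unit k S') M ≫ pullMap g (leftHom M) :=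
  hom_ext_left fun a b m => by
    rw [comp_app, comp_app, map_tmk, pullUnit_one, pullTensor_tmk, pullMap_app,
      leftHom_tmk, leftHom_tmk, id_app]

lemma pullTensor_right (M : KQuiv k S') :
    rightHom (pull g M) =
      map (𝟙 (pull g M)) (pullUnit g) ≫ pullTensor g M (unit k S') ≫ pullMap g (rightHom M) :=
  hom_ext_right fun a b m => by
    rw [comp_app, comp_app, map_tmk, pullUnit_one, pullTensor_tmk, pullMap_app,
      rightHom_tmk, rightHom_tmk, id_app]

instance : (pullback (k := k) g).LaxMonoidal where
  ε := pullUnit g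
  μ M N := pullTensor g M N
  μ_natural_left f N := pullTensor_natural g f (𝟙 N)
  μ_natural_right M f := pullTensor_natural g (𝟙 M) f
  associativity M N P := pullTensor_assoc g M N P
  left_unitality M := pullTensor_left g M
  right_unitality M := pullTensor_right g M

end

end KQuiv

/-! ## Functoriality of free templicial modules -/

namespace Free

open Simplicial SimplexCategory

noncomputable section

variable {k : Type u} [CommRing k] {K L : SSet.{u}} (φ : K ⟶ L)

/-- The action of a map of simplicial sets in degree `n`. -/
def alphaApp (n : ℕ) : quiver K k n ⟶ KQuiv.pull (φ.app (op ⦋0⦌)) (quiver L k n) :=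
  KQuiv.ofApp fun _ _ => lift fun x => gen k (φ.app _ x.1)
    ((vertex_app φ _ _).trans (congrArg _ x.2.1)) ((vertex_app φ _ _).trans (congrArg _ x.2.2))

lemma alphaApp_gen {n : ℕ} {a b : K _⦋0⦌} (x : K _⦋n⦌) (ha : vertex K 0 x = a)
    (hb : vertex K (Fin.last n) x = b) :
    KQuiv.app (alphaApp φ n) a b (gen k x ha hb) =
      (gen k (φ.app _ x) ((vertex_app φ _ _).trans (congrArg _ ha))
        ((vertex_app φ _ _).trans (congrArg _ hb)) :
        (quiver L k n).obj (φ.app _ a) (φ.app _ b)) :=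
  lift_gen _ x ha hb

variable (k) in
/-- The morphism `F̃(K) → F̃(L)` over `K_0 → L_0` given by `x ↦ φ(x)`. -/
def alpha : functor K k ⟶ functor L k ⋙ KQuiv.pullback (φ.app (op ⦋0⦌)) where
  app n := alphaApp φ n.unop.len
  naturality m n f := hom_ext fun a b x ha hb => by
    change KQuiv.app (mapHom K k f.unop ≫ alphaApp φ _) a b _ =
      KQuiv.app (alphaApp φ _ ≫ KQuiv.pullMap _ (mapHom L k f.unop)) a b _
    rw [KQuiv.comp_app, KQuiv.comp_app, mapHom_gen, alphaApp_gen, alphaApp_gen,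
      KQuiv.pullMap_app, mapHom_gen]
    exact gen_congr (NatTrans.naturality_apply φ _ _) _ _ _ _

lemma alpha_comul : CompatComul (functor K k) (functor L k) _ (alpha k φ) := fun m n =>
    hom_ext fun a b x ha hb => by
  change KQuiv.app (alphaApp φ _ ≫ KQuiv.pullMap _ (comul L k m.unop.len n.unop.len)) a b _ =
    KQuiv.app (comul K k m.unop.len n.unop.len ≫ KQuiv.map (alphaApp φ _) (alphaApp φ _) ≫
      KQuiv.pullTensor _ _ _) a b _
  rw [KQuiv.comp_app, KQuiv.comp_app, KQuiv.comp_app, comul_gen, alphaApp_gen,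
    KQuiv.pullMap_app, comul_gen, KQuiv.map_tmk, alphaApp_gen, alphaApp_gen,
    KQuiv.pullTensor_tmk]
  exact tmk_congr (NatTrans.naturality_apply φ _ _).symm (NatTrans.naturality_apply φ _ _).symm
    _ _ _ _ _ _ _ _

variable (k) in
/-- The morphism `F̃(K)_•(a, b) → F̃(L)_•(φ(a), φ(b))` induced by `φ : K → L`. -/
def necMap (a b : K _⦋0⦌) :
    (templicial K k).nec a b ⟶ (templicial L k).nec (φ.app _ a) (φ.app _ b) where
  app T := ModuleCat.ofHom (KQuiv.app ((necklicialMap (alpha_comul φ)).app T) a b)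
  naturality _ _ f := ModuleCat.hom_ext (LinearMap.ext fun x =>
    congrArg (fun t => KQuiv.app t a b x) ((necklicialMap (alpha_comul (k := k) φ)).naturality f))

end

end Free

/-! ## Weak Kan necklicial modules -/

section WeakKan

open Simplicial

/-- The `i`-th vertex of the horn `Λ^{n+2}_j`. -/
def hornVertex {n : ℕ} (j i : Fin (n + 3)) : (Λ[n + 2, j] : SSet.{u}) _⦋0⦌ :=
  ⟨SSet.stdSimplex.obj₀Equiv.symm i, by simp⟩

variable {k : Type u} [CommRing k]

/-- A necklicial module `Y` is weak Kan if for all `0 < j < n`, every morphism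
`F̃(Λ^n_j)_•(0, n) → Y` extends along `F̃(Λ^n_j)_•(0, n) → F̃(Δ^n)_•(0, n)`. As `0 < j < n` forces
`2 ≤ n`, we write `n + 2` for `n`. -/
def NecklicialModule.WeakKan (Y : NecklicialModule k) : Prop :=
  ∀ (n : ℕ) (j : Fin (n + 3)), 0 < j → j < Fin.last (n + 2) →
    ∀ φ : (Free.templicial Λ[n + 2, j] k).nec (hornVertex j 0) (hornVertex j (Fin.last _)) ⟶ Y,
      ∃ ψ : (Free.templicial Δ[n + 2] k).nec (Λ[n + 2, j].ι.app _ (hornVertex j 0))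
          (Λ[n + 2, j].ι.app _ (hornVertex j (Fin.last _))) ⟶ Y,
        Free.necMap k Λ[n + 2, j].ι (hornVertex j 0) (hornVertex j (Fin.last _)) ≫ ψ = φ

/-- The necklicial module `T ↦ Y_T ⊗_k N`. -/
noncomputable def NecklicialModule.tensor (Y : NecklicialModule k) (N : ModuleCat.{u} k) :
    NecklicialModule k :=
  Y ⋙ tensorRight N

/-- A quasi-category in `Mod(k)`: all the necklicial modules `X_•(a, b)` are weak Kan. -/
def TemplicialModule.IsQuasiCategory {S : Type u} (A : TemplicialModule k S) : Prop :=
  ∀ a b : S, NecklicialModule.WeakKan (A.nec a b)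

end WeakKan

end Templicial

/-! The necklicial module `F̃(Δ^n)_•(0, n)` is the `k`-linearisation of the presheaf represented by
the necklace `Δ^n`: its basis consists of pure tensors of simplices, and such a tensor is the same
as a necklace map `T → Δ^n`. For an inner horn the basis is a sieve, formed by the maps that send
some joint to an inner vertex (they factor through a wedge `Δ^i ∨ Δ^{n-i}`) and the maps that omit
an inner vertex other than `j`. So weak Kan means that compatible families on this sieve come from
an element over `Δ^n` (`NecklicialModule.WeakKan.fills`, `weakKan_of_fills`).

For free coefficients the claim is easy: the module is a direct sum of modules `X_•(a, c)`, and
because the sieve is finitely generated only finitely many summands matter (`fills_free`). For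
general coefficients `P` take a free cover `F → P` with kernel `K`. Flatness of `X_T` keeps `0 → X_T
⊗ K → X_T ⊗ F → X_T ⊗ P → 0` exact. If a horn in `X_• ⊗ P` lifts to `X_• ⊗ F`, it can be filled
there and the filler pushed down (`Fills.of_lifts`). The lift is built one generator of the sieve at
a time: an arbitrary lift over the new generator differs from the lift already built by a family in
`X_• ⊗ K` on the overlap, and filling this family corrects the choice (`Lifts.adjoin`).

It remains to fill the overlaps, and this is an induction on dimension. The overlap with an inner
face is a box of dimension one less (`boxSieve_pullback_face`), and boxes fill once horns do, by
adding the missing faces (`FillsBoxes.of_horns`). The overlap with `Δ^i ∨ Δ^m` is generated by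
necklaces `T ∨ Δ^m`, where `X_{T ∨ Δ^m} ⊗ K = X_T ⊗ (X_m ⊗ K)` (`wedgeIso`). It therefore fills by
the case of dimension `i` with coefficients `X_m ⊗ K` (`fillsWedges`).

The last step forces the coefficients to be quivers rather than modules, and `fillsBoxes` proves the
statement for all quivers `P` at once. A module `N` is recovered from the constant quiver with value
`N`, since `X_•(a, b) ⊗ N` is a direct summand of `(X_• ⊗_S P)(a, b)`. -/

namespace Templicial

/-! ## Compatible families on sieves -/

section Sieves

variable {k : Type u} [CommRing k] {C : Type*} [Category C]

/-- A compatible family of elements of a presheaf of modules on a sieve. -/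
structure SieveFamily (Y : Cᵒᵖ ⥤ ModuleCat.{u} k) {U : C} (R : Sieve U) where
  val : ∀ {T : C} (f : T ⟶ U), R f → Y.obj (op T)
  compat : ∀ {T T' : C} (v : T' ⟶ T) (f : T ⟶ U) (hf : R f),
    val (v ≫ f) (R.downward_closed hf v) = Y.map v.op (val f hf)

/-- Every compatible family on the sieve `R` is the restriction of an element. -/
def Fills (Y : Cᵒᵖ ⥤ ModuleCat.{u} k) {U : C} (R : Sieve U) : Prop :=
  ∀ y : SieveFamily Y R, ∃ t : Y.obj (op U), ∀ (T : C) (f : T ⟶ U) (hf : R f),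
    Y.map f.op t = y.val f hf

variable {Y Z K F N : Cᵒᵖ ⥤ ModuleCat.{u} k} {U V : C}

lemma map_op_comp (Y : Cᵒᵖ ⥤ ModuleCat.{u} k) {T T' : C} (v : T' ⟶ T) (f : T ⟶ U)
    (t : Y.obj (op U)) : Y.map (v ≫ f).op t = Y.map v.op (Y.map f.op t) := by
  rw [op_comp, Y.map_comp]; rfl

lemma app_naturality (p : Y ⟶ Z) {T : C} (f : T ⟶ U) (t : Y.obj (op U)) :
    p.app (op T) (Y.map f.op t) = Z.map f.op (p.app (op U) t) :=
  NatTrans.naturality_apply p f.op t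

namespace SieveFamily

/-- The image of a compatible family under a morphism of presheaves. -/
def map {R : Sieve U} (y : SieveFamily Y R) (p : Y ⟶ Z) : SieveFamily Z R where
  val f hf := p.app _ (y.val f hf)
  compat v f hf := by rw [y.compat, app_naturality]

/-- The restriction of a compatible family to a smaller sieve. -/
def restrict {R R' : Sieve U} (y : SieveFamily Y R') (h : ∀ {T : C} (f : T ⟶ U), R f → R' f) :
    SieveFamily Y R where
  val f hf := y.val f (h f hf)
  compat v f hf := y.compat v f (h f hf)

/-- The pullback of a compatible family. -/
def pullback {R : Sieve U} (y : SieveFamily Y R) (g : V ⟶ U) : SieveFamily Y (R.pullback g) where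
  val f hf := y.val (f ≫ g) hf
  compat v f hf := by
    have := y.compat v (f ≫ g) hf
    simp only [← Category.assoc] at this
    exact this

lemma val_congr {R : Sieve U} (y : SieveFamily Y R) {T : C} {f f' : T ⟶ U} (h : f = f')
    (hf : R f) : y.val f hf = y.val f' (h ▸ hf) := by subst h; rfl

open Classical in
/-- The extension of a compatible family on `R` by an element over a monomorphism `g`. -/
noncomputable def adjoin {R R' : Sieve U} (y : SieveFamily Y R) (g : V ⟶ U) [Mono g]
    (hR' : ∀ {T : C} (f : T ⟶ U), R' f ↔ R f ∨ ∃ h : T ⟶ V, h ≫ g = f) (t : Y.obj (op V))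
    (ht : ∀ (T : C) (h : T ⟶ V) (hh : R (h ≫ g)), Y.map h.op t = y.val (h ≫ g) hh) :
    SieveFamily Y R' where
  val f hf := if h : R f then y.val f h else
    Y.map (((hR' f).1 hf).resolve_left h).choose.op t
  compat {T T'} v f hf := by
    by_cases h : R f
    · rw [dif_pos h, dif_pos (R.downward_closed h v), y.compat]
    · rw [dif_neg h, ← map_op_comp]
      have e := (((hR' f).1 hf).resolve_left h).choose_spec
      generalize (((hR' f).1 hf).resolve_left h).choose = w at e
      -- On the overlap with `R` the two prescriptions agree by `ht`; off it, the chosen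
      -- factorisation through `g` is unique because `g` is a monomorphism.
      by_cases h' : R (v ≫ f)
      · rw [dif_pos h']
        subst e
        rw [ht _ (v ≫ w) (by rwa [Category.assoc])]
        exact y.val_congr (Category.assoc _ _ _).symm _
      · rw [dif_neg h']
        have e' := (((hR' _).1 (R'.downward_closed hf v)).resolve_left h').choose_spec
        generalize (((hR' _).1 (R'.downward_closed hf v)).resolve_left h').choose = w' at e'
        obtain rfl : w' = v ≫ w := by
          rw [← cancel_mono g, e', ← e, Category.assoc]
        rfl

section

variable {R R' : Sieve U} (y : SieveFamily Y R) (g : V ⟶ U) [Mono g]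
    (hR' : ∀ {T : C} (f : T ⟶ U), R' f ↔ R f ∨ ∃ h : T ⟶ V, h ≫ g = f) (t : Y.obj (op V))
    (ht : ∀ (T : C) (h : T ⟶ V) (hh : R (h ≫ g)), Y.map h.op t = y.val (h ≫ g) hh)

lemma adjoin_of_mem {T : C} (f : T ⟶ U) (h : R f) (hf : R' f) :
    (y.adjoin g hR' t ht).val f hf = y.val f h := dif_pos h

lemma adjoin_comp {T : C} (h : T ⟶ V) (hf : R' (h ≫ g)) :
    (y.adjoin g hR' t ht).val (h ≫ g) hf = Y.map h.op t := by
  by_cases hh : R (h ≫ g)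
  · rw [adjoin_of_mem y g hR' t ht _ hh, ht]
  · refine (dif_neg hh).trans ?_
    have e := (((hR' _).1 hf).resolve_left hh).choose_spec
    generalize (((hR' _).1 hf).resolve_left hh).choose = w at e
    rw [(cancel_mono g).1 e]

end

end SieveFamily

/-- Filling for a larger sieve implies filling for a smaller one if the pullback fills. -/
lemma Fills.of_adjoin {R R' : Sieve U} (g : V ⟶ U) [Mono g]
    (hR' : ∀ {T : C} (f : T ⟶ U), R' f ↔ R f ∨ ∃ h : T ⟶ V, h ≫ g = f)
    (hg : Fills Y (R.pullback g)) (h : Fills Y R') : Fills Y R := fun y => by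
  obtain ⟨t, ht⟩ := hg (y.pullback g)
  have ht' : ∀ (T : C) (f : T ⟶ V) (hf : R (f ≫ g)), Y.map f.op t = y.val (f ≫ g) hf := ht
  obtain ⟨s, hs⟩ := h (y.adjoin g hR' t ht')
  exact ⟨s, fun T f hf => by
    rw [hs T f ((hR' f).2 (Or.inl hf)), SieveFamily.adjoin_of_mem _ _ _ _ _ _ hf]⟩

/-- Every compatible family on `R` lifts along `p`. -/
def Lifts (p : F ⟶ N) {U : C} (R : Sieve U) : Prop :=
  ∀ y : SieveFamily N R, ∃ w : SieveFamily F R, ∀ (T : C) (f : T ⟶ U) (hf : R f),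
    p.app _ (w.val f hf) = y.val f hf

lemma Fills.of_lifts {p : F ⟶ N} {R : Sieve U} (hp : Lifts p R) (hF : Fills F R) :
    Fills N R := fun y => by
  obtain ⟨w, hw⟩ := hp y
  obtain ⟨t, ht⟩ := hF w
  exact ⟨p.app _ t, fun T f hf => by rw [← app_naturality, ht T f hf, hw]⟩

lemma Lifts.of_eq_bot {p : F ⟶ N} {R : Sieve U} (hR : ∀ {T : C} (f : T ⟶ U), ¬ R f) :
    Lifts p R := fun _ =>
  ⟨⟨fun f hf => absurd hf (hR f), fun _ f hf => absurd hf (hR f)⟩,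
    fun _ f hf => absurd hf (hR f)⟩

lemma Fills.of_eq_bot {R : Sieve U} (hR : ∀ {T : C} (f : T ⟶ U), ¬ R f) :
    Fills Y R := fun _ => ⟨0, fun _ f hf => absurd hf (hR f)⟩

lemma Fills.congr {R R' : Sieve U} (h : ∀ {T : C} (f : T ⟶ U), R f ↔ R' f) (hR : Fills Y R) :
    Fills Y R' := by
  obtain rfl : R = R' := Sieve.ext fun _ f => h f
  exact hR

lemma Lifts.congr {p : F ⟶ N} {R R' : Sieve U} (h : ∀ {T : C} (f : T ⟶ U), R f ↔ R' f)
    (hR : Lifts p R) : Lifts p R' := by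
  obtain rfl : R = R' := Sieve.ext fun _ f => h f
  exact hR

/-- Lifting of families extends to a larger sieve if families of elements of the kernel fill. -/
lemma Lifts.adjoin {i : K ⟶ F} {p : F ⟶ N} (hi : ∀ T, Function.Injective (i.app (op T)))
    (hip : ∀ T, Function.Exact (i.app (op T)) (p.app (op T)))
    (hp : ∀ T, Function.Surjective (p.app (op T))) {R R' : Sieve U} (g : V ⟶ U) [Mono g]
    (hR' : ∀ {T : C} (f : T ⟶ U), R' f ↔ R f ∨ ∃ h : T ⟶ V, h ≫ g = f)
    (hg : Fills K (R.pullback g)) (h : Lifts p R) : Lifts p R' := fun y => by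
  have hle : ∀ {T : C} (f : T ⟶ U), R f → R' f := fun f hf => (hR' f).2 (Or.inl hf)
  have hgg : R' g := (hR' g).2 (Or.inr ⟨𝟙 _, Category.id_comp _⟩)
  obtain ⟨w, hw⟩ := h (y.restrict hle)
  obtain ⟨r, hr⟩ := hp V (y.val g hgg)
  -- On the overlap both `w` and the restrictions of `r` lift `y`, so their difference comes from
  -- the kernel.
  have hd : ∀ (T : C) (f : T ⟶ V) (hf : R (f ≫ g)),
      ∃ x, i.app (op T) x = w.val (f ≫ g) hf - F.map f.op r := fun T f hf => by
    refine (hip _ _).1 ?_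
    rw [map_sub, app_naturality, hr, hw, ← y.compat]
    exact sub_self _
  choose d hd using hd
  -- Compatibility holds in `F`, and injectivity of `i` carries it back to `K`.
  have hc : ∀ {T T' : C} (v : T' ⟶ T) (f : T ⟶ V) (hf : R (f ≫ g)) (hf' : R ((v ≫ f) ≫ g)),
      d _ (v ≫ f) hf' = K.map v.op (d _ f hf) := fun v f hf hf' => hi _ (by
    rw [app_naturality, hd, hd, map_sub, ← w.compat, ← map_op_comp]
    congr 1
    exact w.val_congr (Category.assoc _ _ _) _)
  obtain ⟨t, ht⟩ := hg ⟨fun f hf => d _ f hf, fun v f hf => hc v f hf _⟩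
  -- The filler `t` of the differences turns `r` into a lift over `g` that agrees with `w` on the
  -- overlap.
  have key : ∀ (T : C) (f : T ⟶ V) (hf : R (f ≫ g)),
      F.map f.op (r + i.app _ t) = w.val (f ≫ g) hf := fun T f hf => by
    rw [map_add, ← app_naturality, ht T f hf]
    change _ + i.app _ (d T f hf) = _
    rw [hd, add_sub_cancel]
  refine ⟨w.adjoin g hR' _ key, fun T f hf => ?_⟩
  by_cases h : R f
  · rw [SieveFamily.adjoin_of_mem _ _ _ _ _ _ h, hw]; rfl
  · obtain ⟨f', rfl⟩ := ((hR' f).1 hf).resolve_left h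
    have e : p.app (op V) (i.app (op V) t) = 0 := (hip _ _).2 ⟨t, rfl⟩
    rw [SieveFamily.adjoin_comp, app_naturality, map_add, hr, e, add_zero, ← y.compat]

/-- Filling passes to retracts. -/
lemma Fills.of_retract {R : Sieve U} (i : Y ⟶ Z) (p : Z ⟶ Y)
    (h : ∀ T (x : Y.obj T), p.app T (i.app T x) = x) (hZ : Fills Z R) : Fills Y R := fun y => by
  obtain ⟨t, ht⟩ := hZ (y.map i)
  refine ⟨p.app _ t, fun T f hf => ?_⟩
  rw [← app_naturality, ht T f hf]
  exact h _ _

/-- Filling of a finitely generated sieve passes to direct sums. -/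
lemma Fills.of_decomposition {R : Sieve U} {I J : Type*} [Finite J] {Z : I → Cᵒᵖ ⥤ ModuleCat.{u} k}
    (ι : ∀ i, Z i ⟶ Y) (π : ∀ i, Y ⟶ Z i)
    (hsum : ∀ T (x : Y.obj T), ∃ s : Finset I, ∀ s', s ⊆ s' →
      ∑ i ∈ s', (ι i).app T ((π i).app T x) = x)
    {V : J → C} (g : ∀ j, V j ⟶ U) (hg : ∀ j, R (g j))
    (hR : ∀ {T : C} (f : T ⟶ U), R f → ∃ j, ∃ h : T ⟶ V j, h ≫ g j = f)
    (hZ : ∀ i, Fills (Z i) R) : Fills Y R := fun y => by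
  classical
  cases nonempty_fintype J
  choose t ht using fun i => hZ i (y.map (π i))
  choose s hs using fun j => hsum _ (y.val (g j) (hg j))
  -- Infinitely many fillers `t i` may be nonzero. The sum can be cut down to the components that
  -- occur in the values on the finitely many generators `g j`, which determine the family.
  refine ⟨∑ i ∈ Finset.univ.biUnion s, (ι i).app _ (t i), fun T f hf => ?_⟩
  obtain ⟨j, h, rfl⟩ := hR f hf
  rw [map_op_comp, y.compat _ _ (hg j), map_sum]
  congr 1
  refine Eq.trans (Finset.sum_congr rfl fun i _ => ?_)
    (hs j _ (Finset.subset_biUnion_of_mem s (Finset.mem_univ j)))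
  rw [← app_naturality, ht i _ _ (hg j)]
  rfl

end Sieves

/-! ## Generators of free necklicial modules -/

namespace Free

open Simplicial SimplexCategory

section Eval

variable {K L : SSet.{u}} {n : ℕ} (ι : K ⟶ Δ[n])

/-- The vertices of a simplex of `K` as vertices of `Δ[n]`. -/
def ev {m : ℕ} (s : K _⦋m⦌) (i : Fin (m + 1)) : ℕ := ((ι.app _ s : Δ[n] _⦋m⦌) i : Fin (n + 1))

lemma ev_mono {m : ℕ} (s : K _⦋m⦌) {i j : Fin (m + 1)} (h : i ≤ j) : ev ι s i ≤ ev ι s j :=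
  SSet.stdSimplex.monotone_apply (ι.app _ s : Δ[n] _⦋m⦌) h

lemma ev_map {m m' : ℕ} (φ : ⦋m⦌ ⟶ ⦋m'⦌) (s : K _⦋m'⦌) (i : Fin (m + 1)) :
    ev ι (K.map φ.op s) i = ev ι s (φ.toOrderHom i) := by
  have := NatTrans.naturality_apply ι φ.op s
  simp only [ev]
  rw [this]; rfl

lemma ev_vertex {m : ℕ} (s : K _⦋m⦌) (i : Fin (m + 1)) (j : Fin 1) :
    ev ι (vertex K i s) j = ev ι s i := by
  rw [vertex, ev_map]; rfl

-- A simplex of `Δ[n]` is determined by its vertices, so for levelwise injective `ι` equalities in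
-- `K` become equalities of numbers.
variable {ι} in
lemma ev_ext (hι : ∀ m, Function.Injective (ι.app (op ⦋m⦌))) {m : ℕ} {s t : K _⦋m⦌}
    (h : ∀ i, ev ι s i = ev ι t i) : s = t :=
  hι m (SSet.stdSimplex.ext _ _ fun i => Fin.ext (h i))

/-- The vertices of a simplex as a function on the natural numbers, constant after `m`. -/
def evn {m : ℕ} (s : K _⦋m⦌) (i : ℕ) : ℕ := ev ι s ⟨min i m, by omega⟩

end Eval

end Free

/-! ### Pure tensors of simplices and their vertex functions -/

namespace Free

open SimplexCategory

noncomputable section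

variable {K : SSet.{u}} {n : ℕ} (ι : K ⟶ SSet.stdSimplex.obj (mk n)) {k : Type u} [CommRing k]
  {p : ℕ}

/-- The element `x` is the tensor product of the restrictions of `f` to the beads. -/
def IsGen (z : Fin (p + 1)) : ∀ (a : Fin (p + 1)) (l : List (Fin (p + 1))) {v w : K.obj (op (mk (0)))}
    (_ : (beads (functor K k) z a l).obj v w) (_ : ℕ → ℕ), Prop
  | a, [], v, w, x, f => ∃ (s : K.obj (op (mk ((z : ℕ) - a)))) (ha : vertex K 0 s = v)
      (hb : vertex K (Fin.last _) s = w), (∀ i, ev ι s i = f (a + i)) ∧ x = gen k s ha hb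
  | a, b :: l, v, w, x, f => ∃ (c : K.obj (op (mk (0)))) (s : K.obj (op (mk ((b : ℕ) - a)))) (ha : vertex K 0 s = v)
      (hb : vertex K (Fin.last _) s = c) (y : (beads (functor K k) z b l).obj c w),
      (∀ i, ev ι s i = f (a + i)) ∧ IsGen z b l y f ∧
        x = KQuiv.tmk (quiver K k (b - a)) (beads (functor K k) z b l) c (gen k s ha hb) y

/-- Every restriction of `f` to a bead is a simplex of `K`. -/
def BeadsIn (z : Fin (p + 1)) : ∀ (_ : Fin (p + 1)) (_ : List (Fin (p + 1))) (_ : ℕ → ℕ), Prop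
  | a, [], f => ∃ s : K.obj (op (mk ((z : ℕ) - a))), ∀ i, ev ι s i = f (a + i)
  | a, b :: l, f => (∃ s : K.obj (op (mk ((b : ℕ) - a))), ∀ i, ev ι s i = f (a + i)) ∧ BeadsIn z b l f

/-- The linear map on the tensor product of beads that sends the generator of `f` to the value
`Φ f`. -/
def beadsLift {W : Type u} [AddCommMonoid W] [Module k W] (z : Fin (p + 1)) :
    ∀ (a : Fin (p + 1)) (l : List (Fin (p + 1))) (v w : K.obj (op (mk (0)))) (_ : (ℕ → ℕ) → W),
      (beads (functor K k) z a l).obj v w →ₗ[k] W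
  | a, [], _, _, Φ => lift fun s : Simp K ((z : ℕ) - a) _ _ => Φ fun i => evn ι s.1 (i - a)
  | a, b :: l, _, w, Φ => KQuiv.lift fun c => lift fun s : Simp K ((b : ℕ) - a) _ _ =>
      beadsLift z b l c w fun g => Φ fun i => if i ≤ b then evn ι s.1 (i - a) else g i

end

end Free

namespace Free

open Simplicial SimplexCategory

noncomputable section

variable {K L : SSet.{u}} {n : ℕ} (ι : K ⟶ Δ[n]) {k : Type u} [CommRing k] {p q : ℕ}

variable {ι} {z a b : Fin (p + 1)} {l : List (Fin (p + 1))} {v w : K _⦋0⦌} {f g : ℕ → ℕ}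

/-- Vertex functions are defined on all of `ℕ` to avoid dependent types; only their values on `[a,
z]` carry information. -/
lemma IsGen.congr {x : (beads (functor K k) z a l).obj v w} (hs : Sorted z a l)
    (h : IsGen ι z a l x f) (hfg : ∀ i, (a : ℕ) ≤ i → i ≤ z → f i = g i) :
    IsGen ι z a l x g := by
  induction l generalizing a v with
  | nil =>
    obtain ⟨s, ha, hb, h1, rfl⟩ := h
    refine ⟨s, ha, hb, fun i => ?_, rfl⟩
    have : (a : ℕ) ≤ z := hs
    rw [h1, hfg _ (by omega) (by omega)]
  | cons b l ih =>
    obtain ⟨c, s, ha, hb, y, h1, h2, rfl⟩ := h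
    have h3 : (a : ℕ) ≤ b := hs.1
    have h4 : (b : ℕ) ≤ z := hs.2.le
    exact ⟨c, s, ha, hb, y, fun i => by rw [h1, hfg _ (by omega) (by omega)],
      ih hs.2 h2 fun i h5 h6 => hfg i (h3.trans h5) h6, rfl⟩

lemma IsGen.first {x : (beads (functor K k) z a l).obj v w} (h : IsGen ι z a l x f) :
    f a = ev ι v 0 := by
  cases l with
  | nil =>
    obtain ⟨s, rfl, hb, h1, rfl⟩ := h
    rw [ev_vertex, h1]; rfl
  | cons b l =>
    obtain ⟨c, s, rfl, hb, y, h1, h2, rfl⟩ := h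
    rw [ev_vertex, h1]; rfl

lemma IsGen.last {x : (beads (functor K k) z a l).obj v w} (hs : Sorted z a l)
    (h : IsGen ι z a l x f) : f z = ev ι w 0 := by
  induction l generalizing a v with
  | nil =>
    obtain ⟨s, ha, rfl, h1, rfl⟩ := h
    rw [ev_vertex, h1]
    have : (a : ℕ) ≤ z := hs
    congr 1
    simp only [Fin.val_last]
    omega
  | cons b l ih =>
    obtain ⟨c, s, ha, hb, y, h1, h2, rfl⟩ := h
    exact ih hs.2 h2

/-- Each bead is monotone, and consecutive beads share the vertex at their joint, so a comparison
across a joint `b` passes through `f b`. -/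
lemma IsGen.mono {x : (beads (functor K k) z a l).obj v w} (hs : Sorted z a l)
    (h : IsGen ι z a l x f) {i j : ℕ} (hi : a ≤ i) (hij : i ≤ j) (hj : j ≤ z) : f i ≤ f j := by
  have aux : ∀ (m : ℕ) (s : K _⦋m⦌) (a i j : ℕ), (∀ i, ev ι s i = f (a + i)) → a ≤ i → i ≤ j →
      j ≤ a + m → f i ≤ f j := fun m s a i j h h1 h2 h3 => by
    have := ev_mono ι s (i := ⟨i - a, by omega⟩) (j := ⟨j - a, by omega⟩)
      (Fin.mk_le_mk.2 (by omega))
    rw [h, h] at this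
    simp only [] at this
    rwa [show a + (i - a) = i by omega, show a + (j - a) = j by omega] at this
  induction l generalizing a v i j with
  | nil =>
    obtain ⟨s, ha, hb, h1, rfl⟩ := h
    exact aux _ s a i j h1 hi hij (by omega)
  | cons b l ih =>
    obtain ⟨c, s, ha, hb, y, h1, h2, rfl⟩ := h
    have h3 : (a : ℕ) ≤ b := hs.1
    rcases le_total (b : ℕ) i with h | h
    · exact ih hs.2 h2 h hij hj
    · rcases le_total j b with h' | h'
      · exact aux _ s a i j h1 hi hij (by omega)
      · exact (aux _ s a i b h1 hi h (by omega)).trans (ih hs.2 h2 le_rfl h' hj)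

lemma IsGen.beadsIn {x : (beads (functor K k) z a l).obj v w} (h : IsGen ι z a l x f) :
    BeadsIn ι z a l f := by
  induction l generalizing a v with
  | nil =>
    obtain ⟨s, ha, hb, h1, rfl⟩ := h
    exact ⟨s, h1⟩
  | cons b l ih =>
    obtain ⟨c, s, ha, hb, y, h1, h2, rfl⟩ := h
    exact ⟨⟨s, h1⟩, ih h2⟩

/-- The vertex function determines the simplex on each bead, and the vertex of `K` between two beads
is the last vertex of the earlier simplex. -/
lemma IsGen.unique (hι : ∀ m, Function.Injective (ι.app (op ⦋m⦌)))
    {x y : (beads (functor K k) z a l).obj v w} (h : IsGen ι z a l x f)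
    (h' : IsGen ι z a l y f) : x = y := by
  induction l generalizing a v with
  | nil =>
    obtain ⟨s, ha, hb, h1, rfl⟩ := h
    obtain ⟨s', ha', hb', h1', rfl⟩ := h'
    obtain rfl : s = s' := ev_ext hι fun i => by rw [h1, h1']
    rfl
  | cons b l ih =>
    obtain ⟨c, s, ha, hb, y, h1, h2, rfl⟩ := h
    obtain ⟨c', s', ha', hb', y', h1', h2', rfl⟩ := h'
    obtain rfl : s = s' := ev_ext hι fun i => by rw [h1, h1']
    obtain rfl : c = c' := hb.symm.trans hb'
    rw [ih h2 h2']

lemma vertex_eq_of_ev (hι : ∀ m, Function.Injective (ι.app (op ⦋m⦌))) {m : ℕ} {s : K _⦋m⦌}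
    {i : Fin (m + 1)} (h : ev ι s i = ev ι v 0) : vertex K i s = v :=
  ev_ext hι fun j => by
    rw [ev_vertex, h]
    rw [Fin.fin_one_eq_zero j]

-- The bead simplices can be tensored together because neighbours have the same image at the joint,
-- hence the same vertex in `K`.
variable (k) in
lemma BeadsIn.exists_isGen (hι : ∀ m, Function.Injective (ι.app (op ⦋m⦌)))
    (hs : Sorted z a l) (h : BeadsIn ι z a l f) (hv : f a = ev ι v 0) (hw : f z = ev ι w 0) :
    ∃ x : (beads (functor K k) z a l).obj v w, IsGen ι z a l x f := by
  induction l generalizing a v with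
  | nil =>
    obtain ⟨s, h1⟩ := h
    refine ⟨_, s, vertex_eq_of_ev hι (by rw [h1, ← hv]; rfl), vertex_eq_of_ev hι ?_, h1, rfl⟩
    rw [h1, ← hw]
    congr 1
    have : (a : ℕ) ≤ z := hs
    simp only [Fin.val_last]
    omega
  | cons b l ih =>
    obtain ⟨⟨s, h1⟩, h2⟩ := h
    obtain ⟨y, hy⟩ := ih (v := vertex K (Fin.last _) s) hs.2 h2 (by
      rw [ev_vertex, h1]
      congr 1
      have : (a : ℕ) ≤ b := hs.1
      simp only [Fin.val_last]
      omega)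
    exact ⟨_, _, s, vertex_eq_of_ev hι (by rw [h1, ← hv]; rfl), rfl, y, h1, hy, rfl⟩

/-- The generators span. -/
lemma isGen_induction {z a : Fin (p + 1)} {l : List (Fin (p + 1))} (hs : Sorted z a l)
    {v w : K _⦋0⦌} {P : (beads (functor K k) z a l).obj v w → Prop}
    (h0 : P 0) (hadd : ∀ x y, P x → P y → P (x + y)) (hsmul : ∀ (r : k) x, P x → P (r • x))
    (hgen : ∀ x f, IsGen ι z a l x f → P x) (x) : P x := by
  have single : ∀ {m : ℕ} {v w : K _⦋0⦌} {P : (quiver K k m).obj v w → Prop} (_ : P 0)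
      (_ : ∀ x y, P x → P y → P (x + y)) (_ : ∀ (r : k) x, P x → P (r • x))
      (_ : ∀ s ha hb, P (gen k s ha hb)) (x), P x := by
    intro m v w P h0 hadd hsmul hgen x
    refine Finsupp.induction_linear (motive := P) x h0 hadd fun s r => ?_
    have : (Finsupp.single s r : Simp K m v w →₀ k) = r • Finsupp.single s 1 := by
      rw [Finsupp.smul_single, smul_eq_mul, mul_one]
    rw [this]
    exact hsmul _ _ (hgen s.1 s.2.1 s.2.2)
  induction l generalizing a v with
  | nil =>
    refine single h0 hadd hsmul (fun s ha hb => hgen _ (fun i => evn ι s (i - a))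
      ⟨s, ha, hb, fun i => ?_, rfl⟩) x
    have : (i : ℕ) ≤ z - a := Nat.le_of_lt_succ i.2
    simp only [evn]
    congr 1
    exact Fin.ext (by change (i : ℕ) = min ((a : ℕ) + i - a) ((z : ℕ) - a); omega)
  | cons b l ih =>
    refine KQuiv.tensor_ind h0 hadd (fun c m y => ?_) x
    refine single (P := fun m => P (KQuiv.tmk (quiver K k (b - a)) _ c m y)) ?_ ?_ ?_ ?_ m
    · rw [KQuiv.tmk_zero_left]; exact h0
    · intro x y hx hy; rw [KQuiv.tmk_add_left]; exact hadd _ _ hx hy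
    · intro r x hx; rw [KQuiv.tmk_smul_left]; exact hsmul _ _ hx
    · intro s ha hb
      refine ih hs.2 (P := fun y => P (KQuiv.tmk (quiver K k (b - a))
        (beads (functor K k) z b l) c (gen k s ha hb) y)) ?_ ?_ ?_ ?_ y
      · rw [KQuiv.tmk_zero_right]; exact h0
      · intro x y hx hy; rw [KQuiv.tmk_add_right]; exact hadd _ _ hx hy
      · intro r x hx; rw [KQuiv.tmk_smul_right]; exact hsmul _ _ hx
      · intro y f hy
        -- The vertex function of `s ⊗ y` follows `s` before the joint `b` and `f` from `b` on.
        refine hgen _ (fun i => if i < b then evn ι s (i - a) else f i)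
          ⟨c, s, ha, hb, y, fun i => ?_, hy.congr hs.2 fun i hi _ => (if_neg (by omega)).symm, rfl⟩
        have h1 := i.2
        have h2 : (a : ℕ) ≤ b := hs.1
        have key : ev ι s i = evn ι s (a + i - a) := by
          simp only [evn]
          congr 1
          exact Fin.ext (by change (i : ℕ) = min _ _; omega)
        change _ = if a + (i : ℕ) < b then _ else _
        rcases lt_or_ge (a + (i : ℕ)) b with h | h
        · rw [if_pos h, key]
        -- At the joint itself the two formulas agree: `c` is the last vertex of `s` and the first
        -- vertex of `y`.
        · rw [if_neg (by omega), show a + (i : ℕ) = b by omega, hy.first, ← hb, ev_vertex]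
          congr 1
          exact Fin.ext (by simp only [Fin.val_last]; omega)

/-- The function that `beadsLift` rebuilds from the simplices is constant before `a` and after `z`,
which is why the argument of `f` is clamped to `[a, z]`. -/
lemma beadsLift_isGen {W : Type u} [AddCommMonoid W] [Module k W] {z a : Fin (p + 1)}
    {l : List (Fin (p + 1))} (hs : Sorted z a l) {v w : K _⦋0⦌} (Φ : (ℕ → ℕ) → W)
    {x : (beads (functor K k) z a l).obj v w} {f : ℕ → ℕ} (h : IsGen ι z a l x f) :
    beadsLift ι z a l v w Φ x = Φ fun i => f (max a (min i z)) := by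
  induction l generalizing a v Φ with
  | nil =>
    obtain ⟨s, ha, hb, h1, rfl⟩ := h
    refine (lift_gen _ s ha hb).trans (congrArg Φ (funext fun i => ?_))
    have : (a : ℕ) ≤ z := hs
    rw [evn, h1]
    congr 1
    simp only []
    omega
  | cons b l ih =>
    obtain ⟨c, s, ha, hb, y, h1, h2, rfl⟩ := h
    refine (KQuiv.lift_tmk _ _ _ _).trans ?_
    refine (LinearMap.congr_fun (lift_gen _ s ha hb) y).trans ?_
    refine (ih hs.2 _ h2).trans (congrArg Φ (funext fun i => ?_))
    have h3 : (a : ℕ) ≤ b := hs.1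
    have h4 : (b : ℕ) ≤ z := hs.2.le
    simp only []
    split_ifs with h5
    · rw [evn, h1]
      congr 1
      simp only []
      omega
    · congr 1
      omega

end

end Free

/-! ### Structure maps on generators -/

namespace Free

open Simplicial SimplexCategory

noncomputable section

variable {K L : SSet.{u}} {n : ℕ} {ι : K ⟶ Δ[n]} {k : Type u} [CommRing k] {p q : ℕ}

lemma ev_mapHom {m m' : Fint} (f : m ⟶ m') (s : K _⦋m'.len⦌) (i : Fin (m.len + 1)) :
    ev ι (K.map (toSimplex f).op s) i = ev ι s (Fint.fn f i) := ev_map ι _ _ _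

/-- On the bead starting at `a` the restriction of `u` is `i ↦ u (a + i) - u a`. The bead of `f`
starts at `a' = u a`, so the offset cancels and `f ∘ u` results. -/
lemma isGen_active (u : (⟨p⟩ : Fint) ⟶ ⟨q⟩) {z a : Fin (p + 1)} {z' a' : Fin (q + 1)}
    (hz : Fint.fn u z = z') (ha : Fint.fn u a = a') {l : List (Fin (p + 1))}
    {l' : List (Fin (q + 1))} (hl : l.map (Fint.fn u) = l') (hs : Sorted z a l) {v w : K _⦋0⦌}
    {x : (beads (functor K k) z' a' l').obj v w} {f : ℕ → ℕ} (h : IsGen ι z' a' l' x f) :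
    IsGen ι z a l (KQuiv.app (active (functor K k) u hz ha hl) v w x)
      (fun i => f (Fint.val u i)) := by
  have aux : ∀ {a b : Fin (p + 1)} {a' b' : Fin (q + 1)} (ha : Fint.fn u a = a')
      (hb : Fint.fn u b = b') (s : K _⦋(b' : ℕ) - a'⦌), a ≤ b → (∀ i, ev ι s i = f (a' + i)) →
      ∀ i, ev ι (K.map (toSimplex (restr u ha hb)).op s) i = f (Fint.val u (a + i)) := by
    intro a b a' b' ha hb s hab hs i
    have hi : (i : ℕ) ≤ (b : ℕ) - a := Nat.le_of_lt_succ i.2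
    have h2 := Fint.val_mono u (Nat.le_add_right (a : ℕ) i)
    refine (ev_mapHom (restr u ha hb) s i).trans ((hs _).trans (congrArg f ?_))
    rw [Fint.fn_eq_val, val_restr _ _ hi, ← ha, Fint.fn_eq_val]
    omega
  induction l generalizing a a' l' v with
  | nil =>
    subst hl
    obtain ⟨s, hv, hw, h1, rfl⟩ := h
    exact ⟨_, _, _, aux ha hz s hs h1, mapHom_gen (restr u ha hz) s hv hw⟩
  | cons b l ih =>
    subst hl
    obtain ⟨c, s, hv, hc, y, h1, h2, rfl⟩ := h
    refine ⟨c, _, _, _, _, aux ha rfl s hs.1 h1, ih rfl rfl hs.2 h2,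
      (KQuiv.map_tmk (beadMap (functor K k) u ha rfl) (active (functor K k) u hz rfl rfl)
        (gen k s hv hc) y).trans (congrArg (fun t => KQuiv.tmk (quiver K k (b - a)) _ c t _)
          (mapHom_gen (restr u ha rfl) s hv hc))⟩

lemma comul_isGen {a b c : Fin (p + 1)} (hab : a ≤ b) (hbc : b ≤ c) {f : ℕ → ℕ} {v w : K _⦋0⦌}
    (s : K _⦋(c : ℕ) - a⦌) (ha : vertex K 0 s = v) (hb : vertex K (Fin.last _) s = w)
    (h : ∀ i, ev ι s i = f (a + i)) :
    ∃ (d : K _⦋0⦌) (s₁ : K _⦋(b : ℕ) - a⦌) (s₂ : K _⦋(c : ℕ) - b⦌) (h1 : vertex K 0 s₁ = v)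
      (h2 : vertex K (Fin.last _) s₁ = d) (h3 : vertex K 0 s₂ = d)
      (h4 : vertex K (Fin.last _) s₂ = w), (∀ i, ev ι s₁ i = f (a + i)) ∧
      (∀ i, ev ι s₂ i = f (b + i)) ∧
      KQuiv.app (Templicial.comul (functor K k) a b c) v w (gen k s ha hb) =
        KQuiv.tmk (quiver K k (b - a)) (quiver K k (c - b)) d (gen k s₁ h1 h2)
          (gen k s₂ h3 h4) := by
  have hab' : (a : ℕ) ≤ b := hab
  have hbc' : (b : ℕ) ≤ c := hbc
  have e : KQuiv.app (Templicial.comul (functor K k) a b c) v w (gen k s ha hb) =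
    KQuiv.app (comul K k (b - a) (c - b)) v w (KQuiv.app (mapHom K k (glue a b c)) v w
      (gen k s ha hb)) := rfl
  have e1 := mapHom_gen (k := k) (glue a b c) s ha hb
  have e2 := fun (x : K _⦋((b : ℕ) - a) + (c - b)⦌) h1 h2 =>
    comul_gen (k := k) (a := v) (b := w) x h1 h2
  refine ⟨_, _, _, _, _, _, _, ?_, ?_, e.trans ((congrArg _ e1).trans (e2 _ _ _))⟩
  · intro i
    have hi : (i : ℕ) ≤ (b : ℕ) - a := Nat.le_of_lt_succ i.2
    refine (ev_map ι _ _ i).trans ((ev_mapHom (glue a b c) s _).trans ((h _).trans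
      (congrArg f ?_)))
    refine (congrArg ((a : ℕ) + ·) (Fint.fn_eq_val (glue a b c) _)).trans ?_
    change (a : ℕ) + Fint.val (glue a b c) (i + 0) = _
    rw [val_glue _ _ _ (by omega)]
    omega
  · intro i
    have hi : (i : ℕ) ≤ (c : ℕ) - b := Nat.le_of_lt_succ i.2
    refine (ev_map ι _ _ i).trans ((ev_mapHom (glue a b c) s _).trans ((h _).trans
      (congrArg f ?_)))
    refine (congrArg ((a : ℕ) + ·) (Fint.fn_eq_val (glue a b c) _)).trans ?_
    change (a : ℕ) + Fint.val (glue a b c) (i + ((b : ℕ) - a)) = _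
    rw [val_glue _ _ _ (by omega)]
    omega

/-- The comultiplication splits a simplex into its front and back faces at `b`: the joints change,
the vertices do not. -/
lemma isGen_cut {z a b : Fin (p + 1)} {l : List (Fin (p + 1))} (hab : a ≤ b) (hs : Sorted z b l)
    {v w : K _⦋0⦌} {x : (beads (functor K k) z a l).obj v w} {f : ℕ → ℕ}
    (h : IsGen ι z a l x f) :
    IsGen ι z a (b :: l) (KQuiv.app (cut (functor K k) z a b l) v w x) f := by
  cases l with
  | nil =>
    obtain ⟨s, hv, hw, h1, rfl⟩ := h
    obtain ⟨d, s₁, s₂, e1, e2, e3, e4, h3, h4, h5⟩ := comul_isGen (k := k) hab hs s hv hw h1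
    exact ⟨d, s₁, e1, e2, _, h3, ⟨s₂, e3, e4, h4, rfl⟩, h5⟩
  | cons c l =>
    obtain ⟨d', s, hv, hw, y, h1, h2, rfl⟩ := h
    obtain ⟨d, s₁, s₂, e1, e2, e3, e4, h3, h4, h5⟩ := comul_isGen (k := k) hab hs.1 s hv hw h1
    refine ⟨d, s₁, e1, e2, _, h3, ⟨d', s₂, e3, e4, y, h4, h2, rfl⟩, ?_⟩
    have e6 := KQuiv.map_tmk (Templicial.comul (functor K k) a b c)
      (𝟙 (beads (functor K k) z c l)) (gen k s hv hw) y
    rw [h5] at e6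
    exact (congrArg _ e6).trans (KQuiv.assocHom_tmk _ _ _)

lemma isGen_subdiv {z a : Fin (p + 1)} {l₁ l₂ : List (Fin (p + 1))} (hl : l₁.Sublist l₂)
    (hs : Sorted z a l₂) {v w : K _⦋0⦌} {x : (beads (functor K k) z a l₁).obj v w} {f : ℕ → ℕ}
    (h : IsGen ι z a l₁ x f) :
    IsGen ι z a l₂ (KQuiv.app (subdiv (functor K k) hl) v w x) f := by
  induction l₂ generalizing a l₁ v with
  | nil =>
    cases List.sublist_nil.1 hl
    exact h
  | cons b l₂ ih =>
    by_cases hc : ∃ t, l₁ = b :: t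
    · obtain ⟨t, rfl⟩ := hc
      rw [subdiv_cons_self]
      obtain ⟨c, s, hv, hc, y, h1, h2, rfl⟩ := h
      refine ⟨c, s, hv, hc, _, h1, ih (List.cons_sublist_cons.1 hl) hs.2 h2, ?_⟩
      exact KQuiv.map_tmk (𝟙 (bead (functor K k) a b)) (subdiv (functor K k) _) (gen k s hv hc) y
    · have hc' : ∀ t, l₁ ≠ b :: t := fun t e => hc ⟨t, e⟩
      have h' := sublist_of_not_head hl hc'
      rw [subdiv_cons_ne _ hl h' hc']
      have h3 := isGen_cut hs.1 (hs.2.sublist h') h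
      rw [KQuiv.comp_app]
      generalize KQuiv.app (cut (functor K k) z a b l₁) v w x = x' at h3
      obtain ⟨c, s, hv, hc, y, h1, h2, rfl⟩ := h3
      refine ⟨c, s, hv, hc, _, h1, ih h' hs.2 h2, ?_⟩
      exact KQuiv.map_tmk (𝟙 (bead (functor K k) a b)) (subdiv (functor K k) _) (gen k s hv hc) y

/-- Subdivision preserves the vertex function and the action on beads precomposes it with `g`.
Generators are thus permuted by restriction exactly as in a presheaf of necklace maps into `Δ^n`. -/
lemma isGen_map {T U : Nec} (g : T ⟶ U) {v w : K _⦋0⦌}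
    {x : ((templicial K k).nec v w).obj (op U)} {f : ℕ → ℕ}
    (h : IsGen ι (Fin.last _) 0 U.inner x f) :
    IsGen ι (Fin.last _) 0 T.inner (((templicial K k).nec v w).map g.op x)
      (fun i => f (Fint.val g.toFint i)) :=
  isGen_active g.toFint (Fint.fn_last _) (Fint.fn_zero _) rfl T.inner_sorted
    (isGen_subdiv g.inner_sublist (T.inner_sorted.map _ (Fint.fn_last _) (Fint.fn_zero _)) h)

/-- A simplex of `L` and its image in `K` have the same vertices in `Δ[n]`, so a pure tensor keeps
its vertex function. -/
lemma isGen_beadsMap (φ : L ⟶ K) {z a : Fin (p + 1)} {l : List (Fin (p + 1))} {v w : L _⦋0⦌}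
    {x : (beads (functor L k) z a l).obj v w} {f : ℕ → ℕ} (h : IsGen (φ ≫ ι) z a l x f) :
    IsGen ι z a l (KQuiv.app (beadsMap (functor L k) (functor K k)
      (KQuiv.pullback (φ.app (op ⦋0⦌))) (alpha k φ) z a l) v w x) f := by
  induction l generalizing a v with
  | nil =>
    obtain ⟨s, hv, hw, h1, rfl⟩ := h
    exact ⟨φ.app _ s, _, _, h1, alphaApp_gen φ s hv hw⟩
  | cons b l ih =>
    obtain ⟨c, s, hv, hc, y, h1, h2, rfl⟩ := h
    have e1 := KQuiv.map_tmk ((alpha k φ).app (op (seg a b))) (beadsMap (functor L k) (functor K k)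
      (KQuiv.pullback (φ.app (op ⦋0⦌))) (alpha k φ) z b l) (gen k s hv hc) y
    have e2 := KQuiv.pullTensor_tmk (g := φ.app (op ⦋0⦌)) (quiver K k ((b : ℕ) - a))
      (beads (functor K k) z b l) (a := v) (b := w) c (KQuiv.app (alphaApp φ (b - a)) v c
        (gen k s hv hc)) (KQuiv.app (beadsMap (functor L k) (functor K k)
          (KQuiv.pullback (φ.app (op ⦋0⦌))) (alpha k φ) z b l) c w y)
    have e3 := alphaApp_gen (k := k) φ s hv hc
    exact ⟨φ.app _ c, φ.app _ s, _, _, _, h1, ih h2,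
      ((congrArg (KQuiv.app (KQuiv.pullTensor _ _ _) v w) e1).trans e2).trans
        (congrArg (fun t => KQuiv.tmk (quiver K k (b - a)) _ _ t _) e3)⟩

lemma isGen_necMap (φ : L ⟶ K) {T : Nec} {v w : L _⦋0⦌}
    {x : ((templicial L k).nec v w).obj (op T)} {f : ℕ → ℕ}
    (h : IsGen (φ ≫ ι) (Fin.last _) 0 T.inner x f) :
    IsGen ι (Fin.last _) 0 T.inner ((necMap k φ v w).app (op T) x) f :=
  isGen_beadsMap φ h

end

end Free

/-! ## Sieves of horn type -/

namespace Nec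

/-- The necklace with the single bead `Δ^n`. -/
def simp (n : ℕ) : Nec := ⟨n, {0, Fin.last n}, by simp, by simp⟩

/-- Morphisms to a necklace with a single bead. -/
def homSimp {T : Nec} {n : ℕ} (f : (⟨T.len⟩ : Fint) ⟶ ⟨n⟩) : T ⟶ simp n where
  toFint := f
  subset i hi := by
    rcases Finset.mem_insert.1 hi with rfl | hi
    · exact Finset.mem_image.2 ⟨0, T.zero_mem, Fint.fn_zero f⟩
    · obtain rfl := Finset.mem_singleton.1 hi
      exact Finset.mem_image.2 ⟨Fin.last _, T.last_mem, Fint.fn_last f⟩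

lemma simp_inner (n : ℕ) : (simp n).inner = [] := by
  have : ((({0, Fin.last n} : Finset (Fin (n + 1))).erase 0).erase (Fin.last n)) = ∅ := by
    ext i
    simp only [Finset.mem_erase, Finset.mem_insert, Finset.mem_singleton, Finset.notMem_empty,
      iff_false]
    tauto
  exact (congrArg (fun s => Finset.sort s (· ≤ ·)) this).trans (Finset.sort_empty _)

lemma mem_inner {T : Nec} {t : Fin (T.len + 1)} :
    t ∈ T.inner ↔ t ∈ T.joints ∧ t ≠ 0 ∧ t ≠ Fin.last _ := by
  simp [inner, and_comm, and_left_comm]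

@[simp] lemma comp_toFint {T U V : Nec} (f : T ⟶ U) (g : U ⟶ V) :
    Hom.toFint (f ≫ g) = Hom.toFint f ≫ Hom.toFint g := rfl

/-- Some joint of `T` is sent to `i`. -/
def Hits {T U : Nec} (f : T ⟶ U) (i : ℕ) : Prop :=
  ∃ t ∈ T.joints, (Fint.fn (Hom.toFint f) t : ℕ) = i

/-- The vertex `i` is not in the image. -/
def Misses {T U : Nec} (f : T ⟶ U) (i : ℕ) : Prop :=
  ∀ t, (Fint.fn (Hom.toFint f) t : ℕ) ≠ i

lemma Hits.comp {T T' U : Nec} {f : T ⟶ U} {i : ℕ} (h : Hits f i) (v : T' ⟶ T) :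
    Hits (v ≫ f) i := by
  obtain ⟨t, ht, rfl⟩ := h
  obtain ⟨t', ht', rfl⟩ := Finset.mem_image.1 (Hom.subset v ht)
  exact ⟨t', ht', rfl⟩

lemma Misses.comp {T T' U : Nec} {f : T ⟶ U} {i : ℕ} (h : Misses f i) (v : T' ⟶ T) :
    Misses (v ≫ f) i := fun _ => h _

end Nec

/-- The sieve on `Δ^n` generated by the wedges `Δ^i ∨ Δ^{n - i}` for `i ∈ B` and by the faces
omitting `i` for `i ∈ A`, where `0 < i < n`. -/
def boxSieve (n : ℕ) (B A : Set ℕ) : Sieve (Nec.simp n) where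
  arrows _ f := (∃ i ∈ B, 0 < i ∧ i < n ∧ Nec.Hits f i) ∨
    ∃ i ∈ A, 0 < i ∧ i < n ∧ Nec.Misses f i
  downward_closed := by
    rintro T T' f (⟨i, hi, h0, hn, h⟩ | ⟨i, hi, h0, hn, h⟩) v
    · exact Or.inl ⟨i, hi, h0, hn, h.comp v⟩
    · exact Or.inr ⟨i, hi, h0, hn, h.comp v⟩

lemma boxSieve_iff {n : ℕ} {B A : Set ℕ} {T : Nec} {f : T ⟶ Nec.simp n} :
    boxSieve n B A f ↔ (∃ i ∈ B, 0 < i ∧ i < n ∧ Nec.Hits f i) ∨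
      ∃ i ∈ A, 0 < i ∧ i < n ∧ Nec.Misses f i := Iff.rfl

/-! ## Morphisms out of free necklicial modules -/

namespace Free

open Simplicial SimplexCategory

noncomputable section

section Desc

variable {K : SSet.{u}} {n : ℕ} {ι : K ⟶ Δ[n]} {k : Type u} [CommRing k]

/-- The end vertices `0` and `n` are what makes a vertex function endpoint preserving. There is no
condition on joints, since `Δ^n` has only its two ends. -/
lemma exists_hom_of_isGen {T : Nec} {v w : K _⦋0⦌} (hv : ev ι v 0 = 0) (hw : ev ι w 0 = n)
    {x : ((templicial K k).nec v w).obj (op T)} {f : ℕ → ℕ}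
    (h : IsGen ι (Fin.last _) 0 T.inner x f) :
    ∃ g : T ⟶ Nec.simp n, IsGen ι (Fin.last _) 0 T.inner x (Fint.val (Nec.Hom.toFint g)) := by
  have hs := T.inner_sorted
  have h1 : f 0 = 0 := h.first.trans hv
  have h2 : f T.len = n := (h.last hs).trans hw
  have h3 : ∀ i j, i ≤ j → j ≤ T.len → f i ≤ f j := fun i j hij hj =>
    h.mono hs (Nat.zero_le i) hij hj
  exact ⟨Nec.homSimp (Fint.mkHom ⟨T.len⟩ ⟨n⟩ f h1 h2 h3), h.congr hs fun i _ hi =>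
    (Fint.val_mkHom ⟨T.len⟩ ⟨n⟩ f h1 h2 h3 hi).symm⟩

variable {Y : NecklicialModule k} {R : Sieve (Nec.simp n)} (y : SieveFamily Y R)

open Classical in
/-- The value of a compatible family on the function underlying a morphism. -/
def familyFun (T : Nec) (f : ℕ → ℕ) : Y.obj (op T) :=
  -- The default `0` never matters in `desc`: the hypothesis `hR` there places every generator in
  -- `R`.
  if h : ∃ g : T ⟶ Nec.simp n, R g ∧ ∀ i ≤ T.len, Fint.val (Nec.Hom.toFint g) i = f i then
    y.val h.choose h.choose_spec.1 else 0

/-- The choice made in `familyFun` is harmless because a morphism is determined by its values on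
`[0, T.len]`. -/
lemma familyFun_val {T : Nec} (g : T ⟶ Nec.simp n) (hg : R g) {f : ℕ → ℕ}
    (hf : ∀ i ≤ T.len, Fint.val (Nec.Hom.toFint g) i = f i) : familyFun y T f = y.val g hg := by
  have h : ∃ g : T ⟶ Nec.simp n, R g ∧ ∀ i ≤ T.len, Fint.val (Nec.Hom.toFint g) i = f i :=
    ⟨g, hg, hf⟩
  refine (dif_pos h).trans (y.val_congr (Nec.Hom.ext (Fint.hom_ext_val fun i hi => ?_)) _)
  rw [hf i hi, h.choose_spec.2 i hi]

lemma beadsLift_familyFun {T : Nec} {v w : K _⦋0⦌}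
    {x : ((templicial K k).nec v w).obj (op T)} {g : T ⟶ Nec.simp n}
    (h : IsGen ι (Fin.last _) 0 T.inner x (Fint.val (Nec.Hom.toFint g))) (hg : R g) :
    beadsLift ι (Fin.last _) 0 T.inner v w (familyFun y T) x = y.val g hg := by
  rw [beadsLift_isGen T.inner_sorted _ h]
  refine familyFun_val y g hg fun i hi => ?_
  congr 1
  simp only [Fin.val_zero, Fin.val_last]
  omega

/-- Two linear maps out of a free necklicial module agree if they agree on generators. -/
lemma nec_ext {T : Nec} {v w : K _⦋0⦌} (hv : ev ι v 0 = 0) (hw : ev ι w 0 = n) {W : Type u}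
    [AddCommGroup W] [Module k W] {φ ψ : ((templicial K k).nec v w).obj (op T) →ₗ[k] W}
    (h : ∀ (x : ((templicial K k).nec v w).obj (op T)) (g : T ⟶ Nec.simp n),
      IsGen ι (Fin.last _) 0 T.inner x (Fint.val (Nec.Hom.toFint g)) → φ x = ψ x) : φ = ψ :=
  LinearMap.ext fun x => isGen_induction (ι := ι) T.inner_sorted
    (P := fun x : ((templicial K k).nec v w).obj (op T) => φ x = ψ x)
    ((map_zero φ).trans (map_zero ψ).symm)
    (fun x y hx hy => (map_add φ x y).trans ((congrArg₂ _ hx hy).trans (map_add ψ x y).symm))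
    (fun r x hx => (map_smul φ r x).trans ((congrArg _ hx).trans (map_smul ψ r x).symm))
    (fun x f hx => by
      obtain ⟨g, hg⟩ := exists_hom_of_isGen hv hw hx
      exact h x g hg) x

/-- The morphism out of a free necklicial module given by a compatible family. -/
def desc {v w : K _⦋0⦌} (hv : ev ι v 0 = 0) (hw : ev ι w 0 = n)
    (hR : ∀ (T : Nec) (x : ((templicial K k).nec v w).obj (op T)) (g : T ⟶ Nec.simp n),
      IsGen ι (Fin.last _) 0 T.inner x (Fint.val (Nec.Hom.toFint g)) → R g) :
    (templicial K k).nec v w ⟶ Y where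
  app T := ModuleCat.ofHom
    (beadsLift ι (Fin.last _) 0 T.unop.inner v w (familyFun y T.unop))
  naturality U T f := ModuleCat.hom_ext (nec_ext hv hw fun x g hx => by
    have h1 := isGen_map f.unop hx
    have h2 : (fun i => Fint.val (Nec.Hom.toFint g) (Fint.val f.unop.toFint i)) =
        Fint.val (Nec.Hom.toFint (f.unop ≫ g)) := funext fun i => (Fint.val_comp _ _ _).symm
    rw [h2] at h1
    have hg := hR _ _ _ hx
    refine (beadsLift_familyFun y h1 (R.downward_closed hg _)).trans ?_
    refine (y.compat _ _ hg).trans ?_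
    exact (congrArg (Y.map f) (beadsLift_familyFun y hx hg)).symm)

lemma desc_isGen {v w : K _⦋0⦌} (hv : ev ι v 0 = 0) (hw : ev ι w 0 = n)
    (hR : ∀ (T : Nec) (x : ((templicial K k).nec v w).obj (op T)) (g : T ⟶ Nec.simp n),
      IsGen ι (Fin.last _) 0 T.inner x (Fint.val (Nec.Hom.toFint g)) → R g) {T : Nec}
    {x : ((templicial K k).nec v w).obj (op T)} {g : T ⟶ Nec.simp n}
    (h : IsGen ι (Fin.last _) 0 T.inner x (Fint.val (Nec.Hom.toFint g))) (hg : R g) :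
    (desc y hv hw hR).app (op T) x = y.val g hg :=
  beadsLift_familyFun y h hg

end Desc

/-! ## Beads in horns -/

section Horn

variable {n : ℕ} {j : Fin (n + 1)}

lemma exists_simplex_horn {f : ℕ → ℕ} {a m : ℕ} (hf : ∀ i i', a ≤ i → i ≤ i' → i' ≤ a + m →
    f i ≤ f i') (hn : ∀ i, a ≤ i → i ≤ a + m → f i ≤ n) {c : ℕ} (hc : c ≤ n) (hcj : c ≠ j)
    (hfc : ∀ i, a ≤ i → i ≤ a + m → f i ≠ c) :
    ∃ s : (Λ[n, j] : SSet.{u}) _⦋m⦌, ∀ i, ev Λ[n, j].ι s i = f (a + i) := by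
  let φ : Fin (m + 1) →o Fin (n + 1) :=
    { toFun := fun i => ⟨f (a + i), Nat.lt_succ_of_le (hn _ (by omega) (by omega))⟩
      monotone' := fun i i' h => hf _ _ (by omega) (by have : (i : ℕ) ≤ i' := h; omega) (by omega) }
  refine ⟨⟨SSet.stdSimplex.objMk φ, ?_⟩, fun i => rfl⟩
  refine (SSet.mem_horn_iff_notMem_range _ _).2 ⟨⟨c, by omega⟩, fun h => hcj (congrArg Fin.val h), ?_⟩
  rintro ⟨i, hi⟩
  exact hfc _ (by omega) (by have := i.2; omega) (congrArg Fin.val hi)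

lemma exists_notMem_of_horn {m : ℕ} (s : (Λ[n, j] : SSet.{u}) _⦋m⦌) :
    ∃ c ≤ n, c ≠ j ∧ ∀ i, ev Λ[n, j].ι s i ≠ c := by
  obtain ⟨c, hc, h⟩ := (SSet.mem_horn_iff_notMem_range _ _).1 s.2
  exact ⟨c, Nat.le_of_lt_succ c.2, fun e => hc (Fin.ext e), fun i hi => h ⟨i, Fin.ext hi⟩⟩

variable {p : ℕ} {z a : Fin (p + 1)} {l : List (Fin (p + 1))} {f : ℕ → ℕ}

/-- A simplex lies in the horn as soon as it omits one vertex other than `j`; here the same `c`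
serves for every bead. -/
lemma beadsIn_horn_of_misses (hs : Sorted z a l)
    (hf : ∀ i i', (a : ℕ) ≤ i → i ≤ i' → i' ≤ z → f i ≤ f i')
    (hn : ∀ i, (a : ℕ) ≤ i → i ≤ z → f i ≤ n) {c : ℕ} (hc : c ≤ n) (hcj : c ≠ j)
    (hfc : ∀ i, (a : ℕ) ≤ i → i ≤ z → f i ≠ c) : BeadsIn Λ[n, j].ι.{u} z a l f := by
  have haz : (a : ℕ) ≤ z := hs.le
  induction l generalizing a with
  | nil =>
    exact exists_simplex_horn (fun i i' h1 h2 h3 => hf i i' h1 h2 (by omega))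
      (fun i h1 h2 => hn i h1 (by omega)) hc hcj (fun i h1 h2 => hfc i h1 (by omega))
  | cons b l ih =>
    have h1 : (a : ℕ) ≤ b := hs.1
    have h2 : (b : ℕ) ≤ z := hs.2.le
    exact ⟨exists_simplex_horn (fun i i' h1 h2 h3 => hf i i' h1 h2 (by omega))
      (fun i h1 h2 => hn i h1 (by omega)) hc hcj (fun i h1 h2 => hfc i h1 (by omega)),
      ih hs.2 (fun i i' h3 => hf i i' (by omega)) (fun i h3 => hn i (by omega))
        (fun i h3 => hfc i (by omega)) h2⟩

/-- By monotonicity the beads up to `t` stay below `n` and the later ones stay above `0`. They omit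
`n` and `0` respectively, and both differ from `j` because the horn is inner. -/
lemma beadsIn_horn_of_mem (hj0 : 0 < (j : ℕ)) (hjn : (j : ℕ) < n) (hs : Sorted z a l)
    (hf : ∀ i i', (a : ℕ) ≤ i → i ≤ i' → i' ≤ z → f i ≤ f i')
    (hn : ∀ i, (a : ℕ) ≤ i → i ≤ z → f i ≤ n) {t : Fin (p + 1)} (ht : t ∈ l) (h0 : 0 < f t)
    (htn : f t < n) : BeadsIn Λ[n, j].ι.{u} z a l f := by
  induction l generalizing a with
  | nil => simp at ht
  | cons b l ih =>
    have h1 : (a : ℕ) ≤ b := hs.1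
    have h2 : (b : ℕ) ≤ z := hs.2.le
    have hbt : (b : ℕ) ≤ t := by
      rcases List.mem_cons.1 ht with rfl | ht
      · rfl
      · exact hs.2.le_mem t ht
    have htz : (t : ℕ) ≤ z := by
      have := hs.sublist (List.singleton_sublist.2 ht)
      exact this.2
    refine ⟨exists_simplex_horn (fun i i' h1 h2 h3 => hf i i' h1 h2 (by omega))
      (fun i h1 h2 => hn i h1 (by omega)) le_rfl hjn.ne' (fun i h1 h2 => ?_), ?_⟩
    · have := hf i t h1 (by omega) htz
      omega
    · rcases List.mem_cons.1 ht with rfl | ht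
      · exact beadsIn_horn_of_misses hs.2 (fun i i' h3 => hf i i' (by omega))
          (fun i h3 => hn i (by omega)) (Nat.zero_le _) hj0.ne
          (fun i h3 h4 => by have := hf t i (by omega) h3 h4; omega)
      · exact ih hs.2 (fun i i' h3 => hf i i' (by omega)) (fun i h3 => hn i (by omega)) ht

/-- Some bead runs from `0` all the way to `n`. It omits a vertex `c ≠ j`, which is inner because
both ends are attained. Everything before this bead has value `0` and everything after it has value
`n`, so `c` is omitted throughout. -/
lemma exists_misses_of_beadsIn_horn (hs : Sorted z a l)
    (hf : ∀ i i', (a : ℕ) ≤ i → i ≤ i' → i' ≤ z → f i ≤ f i')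
    (hn : ∀ i, (a : ℕ) ≤ i → i ≤ z → f i ≤ n) (ha : f a = 0) (hz : f z = n)
    (hl : ∀ t ∈ l, f t = 0 ∨ f t = n) (h : BeadsIn Λ[n, j].ι.{u} z a l f) :
    ∃ c, 0 < c ∧ c < n ∧ c ≠ j ∧ ∀ i, (a : ℕ) ≤ i → i ≤ z → f i ≠ c := by
  have single : ∀ a b : Fin (p + 1), a ≤ b → f a = 0 → f b = n →
      (∃ s : (Λ[n, j] : SSet.{u}) _⦋(b : ℕ) - a⦌, ∀ i, ev Λ[n, j].ι s i = f (a + i)) →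
      ∃ c, 0 < c ∧ c < n ∧ c ≠ j ∧ ∀ i, (a : ℕ) ≤ i → i ≤ b → f i ≠ c := by
    rintro a b hab ha hb ⟨s, h⟩
    have hab' : (a : ℕ) ≤ b := hab
    obtain ⟨c, hc, hcj, hsc⟩ := exists_notMem_of_horn s
    have key : ∀ i, (a : ℕ) ≤ i → i ≤ b → f i ≠ c := fun i h1 h2 e => by
      refine hsc ⟨i - a, by omega⟩ ((h _).trans ?_)
      rw [← e]
      congr 1
      simp only []
      omega
    have h3 := key a le_rfl hab'
    have h4 := key b hab' le_rfl
    exact ⟨c, by omega, by omega, hcj, key⟩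
  induction l generalizing a with
  | nil => exact single a z hs ha hz h
  | cons b l ih =>
    have hab : (a : ℕ) ≤ b := hs.1
    have hbz : (b : ℕ) ≤ z := hs.2.le
    rcases hl b List.mem_cons_self with hb | hb
    · obtain ⟨c, h0, hcn, hcj, key⟩ := ih hs.2 (fun i i' h3 => hf i i' (by omega))
        (fun i h3 => hn i (by omega)) hb (fun t ht => hl t (List.mem_cons_of_mem _ ht)) h.2
      refine ⟨c, h0, hcn, hcj, fun i h1 h2 => ?_⟩
      rcases le_total (b : ℕ) i with h3 | h3
      · exact key i h3 h2
      · have := hf i b h1 h3 hbz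
        omega
    · obtain ⟨c, h0, hcn, hcj, key⟩ := single a b hs.1 ha hb h.1
      refine ⟨c, h0, hcn, hcj, fun i h1 h2 => ?_⟩
      rcases le_total (b : ℕ) i with h3 | h3
      · have h4 := hf b i hab h3 h2
        have h5 := hn i h1 h2
        omega
      · exact key i h1 h3

/-- This identifies the generators of the horn with a sieve. If some joint goes to an inner vertex,
all beads lie in the horn automatically; otherwise an inner vertex other than `j` must be omitted.
-/
lemma beadsIn_horn_iff (hj0 : 0 < (j : ℕ)) (hjn : (j : ℕ) < n) {T : Nec} (g : T ⟶ Nec.simp n) :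
    BeadsIn Λ[n, j].ι.{u} (Fin.last _) 0 T.inner (Fint.val (Nec.Hom.toFint g)) ↔
      boxSieve n Set.univ {(j : ℕ)}ᶜ g := by
  have hs := T.inner_sorted
  have hf := fun i i' (_ : ((0 : Fin (T.len + 1)) : ℕ) ≤ i) (h : i ≤ i')
    (_ : i' ≤ (Fin.last T.len : ℕ)) => Fint.val_mono (Nec.Hom.toFint g) h
  have hn := fun i (_ : ((0 : Fin (T.len + 1)) : ℕ) ≤ i) (_ : i ≤ (Fin.last T.len : ℕ)) =>
    Fint.val_le (Nec.Hom.toFint g) i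
  have hlen : (⟨T.len⟩ : Fint).len = T.len := rfl
  have hlen' : (⟨(Nec.simp n).len⟩ : Fint).len = n := rfl
  constructor
  · intro h
    by_contra hg
    have hl : ∀ t ∈ T.inner, Fint.val (Nec.Hom.toFint g) t = 0 ∨
        Fint.val (Nec.Hom.toFint g) t = n := fun t ht => by
      by_contra hc
      push Not at hc
      refine hg (Or.inl ⟨_, trivial, Nat.pos_of_ne_zero hc.1, lt_of_le_of_ne
        (Fint.val_le (Nec.Hom.toFint g) t) hc.2, t, (Nec.mem_inner.1 ht).1, ?_⟩)
      rw [Fint.fn_eq_val]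
    obtain ⟨c, h0, hcn, hcj, key⟩ := exists_misses_of_beadsIn_horn hs hf hn (Fint.val_zero _)
      (Fint.val_of_ge _ le_rfl) hl h
    refine hg (Or.inr ⟨c, hcj, h0, hcn, fun t => ?_⟩)
    rw [Fint.fn_eq_val]
    exact key t (Nat.zero_le _) (Nat.le_of_lt_succ t.2)
  · rintro (⟨i, -, h0, hi, t, ht, rfl⟩ | ⟨i, hij, h0, hi, h⟩)
    · rw [Fint.fn_eq_val] at h0 hi
      refine beadsIn_horn_of_mem hj0 hjn hs hf hn (t := t) (Nec.mem_inner.2 ⟨ht, ?_, ?_⟩) h0 hi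
      · rintro rfl
        rw [Fin.val_zero, Fint.val_zero] at h0
        omega
      · rintro rfl
        rw [Fint.val_of_ge _ (by simp)] at hi
        omega
    · refine beadsIn_horn_of_misses hs hf hn hi.le hij fun i' _ hi' => ?_
      have := h ⟨i', Nat.lt_succ_of_le hi'⟩
      rwa [Fint.fn_eq_val] at this

end Horn

end

end Free

/-! ### The weak Kan condition as filling of the horn sieve -/

section WeakKanIff

open Simplicial SimplexCategory Free

variable {k : Type u} [CommRing k]

/-- The compatible family of restrictions of an element. -/
def SieveFamily.ofElement {C : Type*} [Category C] (Y : Cᵒᵖ ⥤ ModuleCat.{u} k) {U : C}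
    (R : Sieve U) (t : Y.obj (op U)) : SieveFamily Y R where
  val f _ := Y.map f.op t
  compat v f _ := map_op_comp Y v f t

lemma horn_ι_injective {n : ℕ} (j : Fin (n + 1)) (m : ℕ) :
    Function.Injective (Λ[n, j].ι.app (op ⦋m⦌) : (Λ[n, j] : SSet.{u}) _⦋m⦌ → _) :=
  fun _ _ h => Subtype.ext h

/-- The universal generator: the nondegenerate `n`-simplex on a single bead. Evaluation at it is the
Yoneda correspondence for `Δ^n`. -/
lemma exists_isGen_id (k : Type u) [CommRing k] (n : ℕ) {v w : (Δ[n] : SSet.{u}) _⦋0⦌}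
    (hv : ev (𝟙 _) v 0 = 0) (hw : ev (𝟙 _) w 0 = n) :
    ∃ x : ((Free.templicial Δ[n] k).nec v w).obj (op (Nec.simp n)),
      IsGen (𝟙 _) (Fin.last _) 0 (Nec.simp n).inner x
        (Fint.val (Nec.Hom.toFint (𝟙 (Nec.simp n)))) := by
  refine BeadsIn.exists_isGen k (fun m => Function.injective_id) (Nec.inner_sorted _) ?_
    ((Fint.val_zero _).trans hv.symm) ((Fint.val_of_ge _ le_rfl).trans hw.symm)
  rw [Nec.simp_inner]
  refine ⟨SSet.stdSimplex.objMk OrderHom.id, fun i => ?_⟩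
  exact ((congrArg (Fint.val (𝟙 (⟨n⟩ : Fint))) (Nat.zero_add (i : ℕ))).trans
    (Fint.val_id (⟨n⟩ : Fint) (Nat.le_of_lt_succ i.2))).symm

variable {n : ℕ} {j : Fin (n + 3)} (h0 : 0 < j) (hj : j < Fin.last (n + 2))

include h0 hj in
lemma isGen_horn_mem {v w : (Λ[n + 2, j] : SSet.{u}) _⦋0⦌} (T : Nec)
    (x : ((Free.templicial Λ[n + 2, j] k).nec v w).obj (op T)) (g : T ⟶ Nec.simp (n + 2))
    (h : IsGen Λ[n + 2, j].ι (Fin.last _) 0 T.inner x (Fint.val (Nec.Hom.toFint g))) :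
    boxSieve (n + 2) Set.univ {(j : ℕ)}ᶜ g :=
  (beadsIn_horn_iff h0 hj g).1 h.beadsIn

include h0 hj in
variable (k) in
lemma exists_isGen_horn {T : Nec} (g : T ⟶ Nec.simp (n + 2))
    (hg : boxSieve (n + 2) Set.univ {(j : ℕ)}ᶜ g) :
    ∃ x : ((Free.templicial Λ[n + 2, j] k).nec (hornVertex.{u} j 0)
        (hornVertex j (Fin.last _))).obj (op T),
      IsGen Λ[n + 2, j].ι (Fin.last _) 0 T.inner x (Fint.val (Nec.Hom.toFint g)) :=
  ((beadsIn_horn_iff h0 hj g).2 hg).exists_isGen k (horn_ι_injective j) T.inner_sorted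
    (Fint.val_zero _) (Fint.val_of_ge _ le_rfl)

include h0 hj in
/-- Filling of horns in weak Kan necklicial modules in terms of compatible families. -/
lemma NecklicialModule.WeakKan.fills {Y : NecklicialModule k} (hY : Y.WeakKan) :
    Fills Y (boxSieve (n + 2) Set.univ {(j : ℕ)}ᶜ) := fun y => by
  obtain ⟨ψ, hψ⟩ := hY n j h0 hj (desc (ι := Λ[n + 2, j].ι) y rfl rfl (isGen_horn_mem h0 hj))
  obtain ⟨x₀, hx₀⟩ := exists_isGen_id k (n + 2)
    (v := Λ[n + 2, j].ι.app _ (hornVertex j 0))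
    (w := Λ[n + 2, j].ι.app _ (hornVertex j (Fin.last _))) rfl rfl
  -- The family `y` defines a morphism on the horn, `ψ` extends it, and the filler is the value of
  -- `ψ` at the universal generator.
  refine ⟨ψ.app _ x₀, fun T f hf => ?_⟩
  obtain ⟨x, hx⟩ := exists_isGen_horn k h0 hj f hf
  rw [← desc_isGen (ι := Λ[n + 2, j].ι) y rfl rfl (isGen_horn_mem h0 hj) hx hf, ← hψ,
    ← app_naturality]
  refine congrArg (ψ.app (op T)) ?_
  have h1 := isGen_map f hx₀
  have h2 := isGen_necMap (ι := 𝟙 _) (Λ[n + 2, j].ι) (by rwa [Category.comp_id])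
  have h3 : (fun i => Fint.val (Nec.Hom.toFint (𝟙 (Nec.simp (n + 2)))) (Fint.val f.toFint i)) =
      Fint.val f.toFint := funext fun i => Fint.val_id _ (Fint.val_le _ i)
  rw [h3] at h1
  -- The restriction of `x₀` along `f` and the image of the horn generator `x` have the same vertex
  -- function, so they coincide.
  exact h1.unique (fun m => Function.injective_id) h2

/-- The weak Kan condition in terms of compatible families. -/
lemma weakKan_of_fills {Y : NecklicialModule k}
    (hY : ∀ (n : ℕ) (j : ℕ), 0 < j → j < n + 2 → Fills Y (boxSieve (n + 2) Set.univ {j}ᶜ)) :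
    Y.WeakKan := fun n j h0 hj φ => by
  choose x hx using fun (T : Nec) (g : T ⟶ Nec.simp (n + 2)) => exists_isGen_horn k h0 hj g
  -- The values of `φ` on generators are compatible, because a restriction of a generator is the
  -- generator of the composite.
  let y : SieveFamily Y (boxSieve (n + 2) Set.univ {(j : ℕ)}ᶜ) :=
    { val := fun {T} g hg => φ.app (op T) (x T g hg)
      compat := fun {T T'} v f hf => by
        rw [← app_naturality]
        refine congrArg (φ.app (op T')) ?_
        have h1 := isGen_map v (hx T f hf)
        have h2 : (fun i => Fint.val (Nec.Hom.toFint f) (Fint.val v.toFint i)) =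
            Fint.val (Nec.Hom.toFint (v ≫ f)) := funext fun i => (Fint.val_comp _ _ _).symm
        rw [h2] at h1
        exact (hx T' _ _).unique (horn_ι_injective j) h1 }
  obtain ⟨t, ht⟩ := hY n j h0 hj y
  -- On `Δ^n` every necklace map is a generator, so the extension is the morphism given by the
  -- restrictions of `t` along all of them.
  refine ⟨desc (ι := 𝟙 _) (SieveFamily.ofElement Y ⊤ t) rfl rfl fun _ _ _ _ => trivial, ?_⟩
  refine NatTrans.ext (funext fun T => ModuleCat.hom_ext (nec_ext (ι := Λ[n + 2, j].ι)
    (T := T.unop) rfl rfl fun x' g hg => ?_))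
  have hg' := isGen_horn_mem h0 hj _ _ _ hg
  have h2 := isGen_necMap (ι := 𝟙 _) (Λ[n + 2, j].ι) (by rwa [Category.comp_id])
  refine (desc_isGen (ι := 𝟙 _) (SieveFamily.ofElement Y ⊤ t) rfl rfl (fun _ _ _ _ => trivial)
    h2 trivial).trans ?_
  refine (ht _ g hg').trans ?_
  exact congrArg (φ.app T) ((hx _ g hg').unique (horn_ι_injective j) hg)

end WeakKanIff

/-! ### Inner faces and wedges as monomorphisms of necklaces -/

namespace Nec

lemma mono_of_injective {T U : Nec} (f : T ⟶ U)
    (h : ∀ i j, i ≤ T.len → j ≤ T.len → Fint.val f.toFint i = Fint.val f.toFint j → i = j) :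
    Mono f where
  right_cancellation {V} g g' e := Hom.ext (Fint.hom_ext_val fun i _ => by
    refine h _ _ (Fint.val_le _ _) (Fint.val_le _ _) ?_
    have e' := congrArg (fun t => Fint.val (Hom.toFint t) i) e
    simpa only [comp_toFint, Fint.val_comp] using e')

/-- The injection omitting `i`. -/
def skip (i m : ℕ) : ℕ := if m < i then m else m + 1

lemma skip_mono (i : ℕ) {m m' : ℕ} (h : m ≤ m') : skip i m ≤ skip i m' := by
  unfold skip; split_ifs <;> omega

lemma skip_injective (i : ℕ) {m m' : ℕ} (h : skip i m = skip i m') : m = m' := by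
  unfold skip at h; split_ifs at h <;> omega

lemma skip_ne (i m : ℕ) : skip i m ≠ i := by
  unfold skip; split_ifs <;> omega

lemma exists_skip {i m : ℕ} (h : m ≠ i) : ∃ m', skip i m' = m := by
  rcases lt_or_gt_of_ne h with h | h
  · exact ⟨m, if_pos h⟩
  · exact ⟨m - 1, by unfold skip; rw [if_neg] <;> omega⟩

lemma skip_inner {n i m : ℕ} (hi : 0 < i) (hn : i < n + 1) :
    (0 < skip i m ∧ skip i m < n + 1) ↔ (0 < m ∧ m < n) := by
  unfold skip; split_ifs <;> omega

section Face

variable {n i : ℕ} (hi : 0 < i) (hn : i < n + 1)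

/-- The inner face of `Δ^{n+1}` omitting `i`. -/
def face : simp n ⟶ simp (n + 1) :=
  homSimp (Fint.mkHom ⟨n⟩ ⟨n + 1⟩ (skip i) (if_pos hi) (if_neg (by dsimp only; omega))
    fun _ _ h _ => skip_mono i h)

lemma val_face {m : ℕ} (hm : m ≤ n) : Fint.val (face hi hn).toFint m = skip i m :=
  Fint.val_mkHom ⟨n⟩ ⟨n + 1⟩ (skip i) (if_pos hi) (if_neg (by dsimp only; omega))
    (fun _ _ h _ => skip_mono i h) hm

lemma fn_comp_face {T : Nec} (f : T ⟶ simp n) (t : Fin (T.len + 1)) :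
    (Fint.fn (Hom.toFint (f ≫ face hi hn)) t : ℕ) = skip i (Fint.fn (Hom.toFint f) t) := by
  rw [Fint.fn_eq_val, comp_toFint, Fint.val_comp]
  exact (val_face hi hn (Fint.val_le f.toFint t)).trans
    (congrArg (skip i) (Fint.fn_eq_val f.toFint t).symm)

instance : Mono (face hi hn) := mono_of_injective _ fun i j h h' e => by
  exact skip_injective _ ((val_face hi hn h).symm.trans (e.trans (val_face hi hn h')))

lemma misses_iff_face {T : Nec} (f : T ⟶ simp (n + 1)) :
    Misses f i ↔ ∃ h : T ⟶ simp n, h ≫ face hi hn = f := by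
  constructor
  · intro h
    have h' : ∀ m, Fint.val f.toFint m ≠ i := fun m => h _
    have hlen : (⟨(simp (n + 1)).len⟩ : Fint).len = n + 1 := rfl
    -- The factorisation closes the gap left by `i`, lowering the values above `i` by one.
    let φ : ℕ → ℕ := fun m => if Fint.val f.toFint m < i then Fint.val f.toFint m else
      Fint.val f.toFint m - 1
    have hφ0 : φ 0 = 0 := by simp only [φ, Fint.val_zero, if_pos hi]
    have hφl : φ T.len = n := by
      have e : Fint.val f.toFint T.len = n + 1 := Fint.val_of_ge f.toFint le_rfl
      simp only [φ]
      rw [e, if_neg (by omega), Nat.add_sub_cancel]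
    have hφm : ∀ m m', m ≤ m' → m' ≤ T.len → φ m ≤ φ m' := fun m m' hm _ => by
      have := Fint.val_mono f.toFint hm
      simp only [φ]
      split_ifs <;> omega
    refine ⟨homSimp (Fint.mkHom ⟨T.len⟩ ⟨n⟩ φ hφ0 hφl hφm), Hom.ext (Fint.hom_ext_val fun m hm => ?_)⟩
    rw [comp_toFint, Fint.val_comp]
    refine (congrArg _ (Fint.val_mkHom ⟨T.len⟩ ⟨n⟩ φ hφ0 hφl hφm hm)).trans ?_
    have h1 : Fint.val f.toFint m ≤ n + 1 := Fint.val_le f.toFint m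
    have h2 := h' m
    have h3 : φ m ≤ n := by
      simp only [φ]
      split_ifs <;> omega
    refine (val_face hi hn h3).trans ?_
    simp only [φ, skip]
    split_ifs <;> omega
  · rintro ⟨h, rfl⟩ t
    rw [fn_comp_face]
    exact skip_ne _ _

lemma hits_comp_face {T : Nec} (f : T ⟶ simp n) (m : ℕ) :
    Hits (f ≫ face hi hn) (skip i m) ↔ Hits f m := by
  simp only [Hits, fn_comp_face]
  exact exists_congr fun t => and_congr_right fun _ =>
    ⟨fun h => skip_injective _ h, fun h => by rw [h]⟩

lemma misses_comp_face {T : Nec} (f : T ⟶ simp n) (m : ℕ) :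
    Misses (f ≫ face hi hn) (skip i m) ↔ Misses f m := by
  simp only [Misses, fn_comp_face]
  exact forall_congr' fun t => not_congr ⟨fun h => skip_injective _ h, fun h => by rw [h]⟩

lemma boxSieve_insert_face (B A : Set ℕ) {T : Nec} (f : T ⟶ simp (n + 1)) :
    boxSieve (n + 1) B (insert i A) f ↔
      boxSieve (n + 1) B A f ∨ ∃ h : T ⟶ simp n, h ≫ face hi hn = f := by
  rw [← misses_iff_face, boxSieve_iff, boxSieve_iff]
  constructor
  · rintro (h | ⟨m, rfl | hm, h⟩)
    · exact Or.inl (Or.inl h)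
    · exact Or.inr h.2.2
    · exact Or.inl (Or.inr ⟨m, hm, h⟩)
  · rintro ((h | ⟨m, hm, h⟩) | h)
    · exact Or.inl h
    · exact Or.inr ⟨m, Or.inr hm, h⟩
    · exact Or.inr ⟨i, Or.inl rfl, hi, hn, h⟩

/-- `skip i` is a bijection from the inner vertices of the face to the inner vertices other than
`i`, and it matches vertices hit or omitted. A map into the face never hits `i` but always omits it,
so `i ∈ A` would make the pullback the maximal sieve. -/
lemma boxSieve_pullback_face {A : Set ℕ} (hA : i ∉ A) {T : Nec} (f : T ⟶ simp n) :
    boxSieve n Set.univ {m | skip i m ∈ A} f ↔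
      (boxSieve (n + 1) Set.univ A).pullback (face hi hn) f := by
  change _ ↔ boxSieve (n + 1) Set.univ A (f ≫ face hi hn)
  rw [boxSieve_iff, boxSieve_iff]
  refine or_congr ⟨?_, ?_⟩ ⟨?_, ?_⟩
  · rintro ⟨m, -, h1, h2, h⟩
    have h3 := (skip_inner hi hn).2 ⟨h1, h2⟩
    exact ⟨skip i m, trivial, h3.1, h3.2, (hits_comp_face hi hn f m).2 h⟩
  · rintro ⟨m, -, h1, h2, h⟩
    obtain ⟨m', rfl⟩ := exists_skip (i := i) (m := m) (by
      rintro rfl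
      obtain ⟨t, -, ht⟩ := h
      rw [fn_comp_face] at ht
      exact skip_ne _ _ ht)
    have h3 := (skip_inner hi hn).1 ⟨h1, h2⟩
    exact ⟨m', trivial, h3.1, h3.2, (hits_comp_face hi hn f m').1 h⟩
  · rintro ⟨m, hm, h1, h2, h⟩
    have h3 := (skip_inner hi hn).2 ⟨h1, h2⟩
    exact ⟨skip i m, hm, h3.1, h3.2, (misses_comp_face hi hn f m).2 h⟩
  · rintro ⟨m, hm, h1, h2, h⟩
    obtain ⟨m', rfl⟩ := exists_skip (i := i) (m := m) (by rintro rfl; exact hA hm)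
    have h3 := (skip_inner hi hn).1 ⟨h1, h2⟩
    exact ⟨m', hm, h3.1, h3.2, (misses_comp_face hi hn f m').1 h⟩

end Face

/-! ### Wedges -/

/-- The inclusion of the vertices of the first factor of a wedge. -/
def left (m : ℕ) {p : ℕ} (i : Fin (p + 1)) : Fin (p + m + 1) := Fin.castLE (by omega) i

@[simp] lemma left_val (m : ℕ) {p : ℕ} (i : Fin (p + 1)) : (left m i : ℕ) = i := rfl

/-- The wedge `T ∨ Δ^m`. -/
def wedge (T : Nec) (m : ℕ) : Nec where
  len := T.len + m
  joints := insert (Fin.last _) (T.joints.image (left m))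
  zero_mem := Finset.mem_insert_of_mem (Finset.mem_image.2 ⟨0, T.zero_mem, rfl⟩)
  last_mem := Finset.mem_insert_self _ _

lemma fn_add_left (m : ℕ) {p q : ℕ} (f : (⟨p⟩ : Fint) ⟶ ⟨q⟩) (i : Fin (p + 1)) :
    Fint.fn (Fint.add f (𝟙 (⟨m⟩ : Fint)) : (⟨p + m⟩ : Fint) ⟶ ⟨q + m⟩) (left m i) =
      left m (Fint.fn f i) := Fin.ext (by
  have hi : (i : ℕ) ≤ p := Nat.le_of_lt_succ i.2
  rw [Fint.fn_eq_val, left_val, left_val, Fint.fn_eq_val]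
  refine (Fint.val_add f (𝟙 (⟨m⟩ : Fint)) (i := i) (by dsimp only; omega)).trans ?_
  dsimp only
  rw [Nat.sub_eq_zero_of_le hi, Fint.val_zero, add_zero])

/-- The morphism `f ∨ id`. -/
def wedgeMap {T U : Nec} (f : T ⟶ U) (m : ℕ) : wedge T m ⟶ wedge U m where
  toFint := Fint.add f.toFint (𝟙 (⟨m⟩ : Fint))
  subset i hi := by
    rcases Finset.mem_insert.1 hi with rfl | hi
    · exact Finset.mem_image.2 ⟨Fin.last _, last_mem _, Fint.fn_last _⟩
    · obtain ⟨t, ht, rfl⟩ := Finset.mem_image.1 hi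
      obtain ⟨t', ht', rfl⟩ := Finset.mem_image.1 (f.subset ht)
      exact Finset.mem_image.2 ⟨left m t', Finset.mem_insert_of_mem
        (Finset.mem_image_of_mem _ ht'), fn_add_left m f.toFint t'⟩

lemma wedgeMap_comp {T U V : Nec} (f : T ⟶ U) (g : U ⟶ V) (m : ℕ) :
    wedgeMap (f ≫ g) m = wedgeMap f m ≫ wedgeMap g m := Hom.ext (by
  have := MonoidalCategory.tensorHom_comp_tensorHom f.toFint (𝟙 (⟨m⟩ : Fint)) g.toFint (𝟙 (⟨m⟩ : Fint))
  rw [Category.comp_id] at this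
  exact this.symm)

/-- The inclusion `Δ^n ∨ Δ^m → Δ^{n+m}`. -/
def wedgeSimp (n m : ℕ) : wedge (simp n) m ⟶ simp (n + m) := homSimp (𝟙 _)

instance (n m : ℕ) : Mono (wedgeSimp n m) := mono_of_injective _ fun i j h h' e => by
  have e' : Fint.val (𝟙 (⟨n + m⟩ : Fint)) i = Fint.val (𝟙 (⟨n + m⟩ : Fint)) j := e
  exact (Fint.val_id (⟨n + m⟩ : Fint) h).symm.trans (e'.trans (Fint.val_id (⟨n + m⟩ : Fint) h'))

/-- The inclusion of the wedge is the identity on ordinals. A factorisation only asks that the extra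
joint `n` be the image of a joint of `T`; the two ends always are. -/
lemma hits_iff_wedgeSimp {T : Nec} {n m : ℕ} (f : T ⟶ simp (n + m)) :
    Hits f n ↔ ∃ h : T ⟶ wedge (simp n) m, h ≫ wedgeSimp n m = f := by
  constructor
  · rintro ⟨t, ht, h⟩
    refine ⟨⟨f.toFint, fun i hi => ?_⟩, Hom.ext (Category.comp_id _)⟩
    rcases Finset.mem_insert.1 hi with rfl | hi
    · exact Finset.mem_image.2 ⟨Fin.last _, T.last_mem, Fint.fn_last f.toFint⟩
    · obtain ⟨s, hs, rfl⟩ := Finset.mem_image.1 hi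
      rcases Finset.mem_insert.1 hs with rfl | hs
      · exact Finset.mem_image.2 ⟨0, T.zero_mem, Fint.fn_zero f.toFint⟩
      · obtain rfl := Finset.mem_singleton.1 hs
        exact Finset.mem_image.2 ⟨t, ht, Fin.ext h⟩
  · rintro ⟨h, rfl⟩
    obtain ⟨t, ht, e⟩ := Finset.mem_image.1 (h.subset (Finset.mem_insert_of_mem
      (Finset.mem_image_of_mem _ (simp n).last_mem)))
    exact ⟨t, ht, congrArg Fin.val e⟩

lemma boxSieve_insert_wedge {n m : ℕ} (hn : 0 < n) (hm : 0 < m) (B A : Set ℕ) {T : Nec}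
    (f : T ⟶ simp (n + m)) :
    boxSieve (n + m) (insert n B) A f ↔
      boxSieve (n + m) B A f ∨ ∃ h : T ⟶ wedge (simp n) m, h ≫ wedgeSimp n m = f := by
  rw [← hits_iff_wedgeSimp, boxSieve_iff, boxSieve_iff]
  constructor
  · rintro (⟨m, rfl | hm, h⟩ | h)
    · exact Or.inr h.2.2
    · exact Or.inl (Or.inl ⟨m, hm, h⟩)
    · exact Or.inl (Or.inr h)
  · rintro ((⟨m, hm, h⟩ | h) | h)
    · exact Or.inl ⟨m, Or.inr hm, h⟩
    · exact Or.inr h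
    · exact Or.inl ⟨n, Or.inl rfl, hn, by omega, h⟩

end Nec

/-- The index sets matter only through their inner vertices, which lets the chains of sieves run
over initial segments of `ℕ`. -/
lemma boxSieve_congr {n : ℕ} {B B' A A' : Set ℕ} (hB : ∀ i, 0 < i → i < n → (i ∈ B ↔ i ∈ B'))
    (hA : ∀ i, 0 < i → i < n → (i ∈ A ↔ i ∈ A')) {T : Nec} (f : T ⟶ Nec.simp n) :
    boxSieve n B A f ↔ boxSieve n B' A' f := by
  rw [boxSieve_iff, boxSieve_iff]
  exact or_congr
    (exists_congr fun i => ⟨fun h => ⟨(hB i h.2.1 h.2.2.1).1 h.1, h.2⟩,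
      fun h => ⟨(hB i h.2.1 h.2.2.1).2 h.1, h.2⟩⟩)
    (exists_congr fun i => ⟨fun h => ⟨(hA i h.2.1 h.2.2.1).1 h.1, h.2⟩,
      fun h => ⟨(hA i h.2.1 h.2.2.1).2 h.1, h.2⟩⟩)

/-! ### Building horns and boxes one generator at a time -/

section Chains

variable {k : Type u} [CommRing k] {Y K F N : NecklicialModule k} {n j : ℕ}

/-- Filling of the sieves on `Δ^n` generated by all wedges and some inner faces that do not
include the `j`-th one, for `0 < j < n`. -/
def FillsBoxes (Y : NecklicialModule k) (n : ℕ) : Prop :=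
  ∀ (j : ℕ) (A : Set ℕ), 0 < j → j < n → j ∉ A → Fills Y (boxSieve n Set.univ A)

/-- Filling of the families on the wedges `Δ^i ∨ Δ^{n-i}` coming from smaller `i`. -/
def FillsWedges (Y : NecklicialModule k) (n : ℕ) : Prop :=
  ∀ i m : ℕ, 0 < i → 0 < m → i + m = n →
    Fills Y ((boxSieve (i + m) {x | x < i} ∅).pullback (Nec.wedgeSimp i m))

/-- Since `j ≠ i`, the vertex `j` survives as an inner vertex of the face whose own face is absent
from the pullback. The pullback is therefore again a box. -/
lemma FillsBoxes.pullback_face (h : FillsBoxes Y n) {i : ℕ} (hi : 0 < i) (hn : i < n + 1)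
    {A : Set ℕ} (hA : i ∉ A) (hj0 : 0 < j) (hj : j < n + 1) (hjA : j ∉ A) (hij : j ≠ i) :
    Fills Y ((boxSieve (n + 1) Set.univ A).pullback (Nec.face hi hn)) := by
  obtain ⟨j', rfl⟩ := Nec.exists_skip hij
  have h1 := (Nec.skip_inner hi hn).1 ⟨hj0, hj⟩
  exact (h j' _ h1.1 h1.2 hjA).congr (Nec.boxSieve_pullback_face hi hn hA)

/-- To fill all boxes it is enough to fill horns. -/
lemma FillsBoxes.of_horns (h : FillsBoxes Y n)
    (hY : ∀ j, 0 < j → j < n + 1 → Fills Y (boxSieve (n + 1) Set.univ {j}ᶜ)) :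
    FillsBoxes Y (n + 1) := fun j A hj0 hj hjA => by
  -- The missing faces other than the `j`-th are adjoined in increasing order until the box becomes
  -- a horn. Each overlap is a box of dimension `n`, so filling descends back along the chain.
  have key : ∀ i, Fills Y (boxSieve (n + 1) Set.univ (A ∪ {x | x < i ∧ x ≠ j})) →
      Fills Y (boxSieve (n + 1) Set.univ A) := by
    intro i
    induction i with
    | zero => exact fun h => h.congr (boxSieve_congr (fun _ _ _ => Iff.rfl) fun x _ _ => by simp)
    | succ i ih =>
      refine fun hi => ih ?_
      by_cases hc : 0 < i ∧ i < n + 1 ∧ i ≠ j ∧ i ∉ A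
      · obtain ⟨hi0, hin, hij, hiA⟩ := hc
        refine Fills.of_adjoin (Nec.face hi0 hin)
          (fun f => Nec.boxSieve_insert_face hi0 hin Set.univ _ f)
          (h.pullback_face hi0 hin (j := j) (by simp [hiA]) hj0 hj (by simp [hjA]) hij.symm)
          (hi.congr (boxSieve_congr (fun _ _ _ => Iff.rfl) fun x _ _ => ?_))
        by_cases hx : x = i
        · subst hx; simp [hij]
        · have : x ≤ i ↔ x < i := by omega
          simp [hx, this]
      · refine hi.congr (boxSieve_congr (fun _ _ _ => Iff.rfl) fun x hx0 hxn => ?_)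
        by_cases hx : x = i
        · subst hx
          by_cases hxj : x = j
          · simp [hxj]
          · have : x ∈ A := by_contra fun hxA => hc ⟨hx0, hxn, hxj, hxA⟩
            simp [this]
        · have : x ≤ i ↔ x < i := by omega
          simp [this]
  refine key (n + 1) ((hY j hj0 hj).congr (boxSieve_congr (fun _ _ _ => Iff.rfl) fun x _ hx => ?_))
  simp only [Set.mem_compl_iff, Set.mem_singleton_iff, Set.mem_union, Set.mem_ofPred_eq, hx,
    true_and]
  exact ⟨Or.inr, fun h => h.elim (fun h e => hjA (e ▸ h)) id⟩

/-- Families on horns lift along an epimorphism whose kernel has fillings. -/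
lemma lifts_horn {i : K ⟶ F} {p : F ⟶ N} (hi : ∀ T, Function.Injective (i.app (op T)))
    (hip : ∀ T, Function.Exact (i.app (op T)) (p.app (op T)))
    (hp : ∀ T, Function.Surjective (p.app (op T))) (hK : FillsBoxes K n)
    (hK' : FillsWedges K (n + 1)) (hj0 : 0 < j) (hj : j < n + 1) :
    Lifts p (boxSieve (n + 1) Set.univ {j}ᶜ) := by
  -- Lift first over the wedges `Δ^l ∨ Δ^{n+1-l}` by increasing `l`, starting from the empty sieve.
  -- In this order the overlap with the wedges already treated only subdivides the first factor.
  have h1 : ∀ l, Lifts p (boxSieve (n + 1) {x | x < l} ∅) := by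
    intro l
    induction l with
    | zero =>
      refine Lifts.of_eq_bot ?_
      rintro T f (⟨x, hx, -⟩ | ⟨x, hx, -⟩)
      · exact absurd hx (Nat.not_lt_zero x)
      · exact hx
    | succ l ih =>
      by_cases hl : 0 < l ∧ l < n + 1
      · obtain ⟨m, hm⟩ := Nat.exists_eq_add_of_lt hl.2
        have hm' : n + 1 = l + (m + 1) := hm
        rw [hm'] at ih hK' ⊢
        refine (ih.adjoin hi hip hp (Nec.wedgeSimp l (m + 1))
          (fun f => Nec.boxSieve_insert_wedge hl.1 (Nat.succ_pos m) _ _ f)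
          (hK' l (m + 1) hl.1 (Nat.succ_pos m) rfl)).congr
          (boxSieve_congr (fun x _ _ => ?_) fun _ _ _ => Iff.rfl)
        simp only [Set.mem_insert_iff, Set.mem_ofPred_eq]
        omega
      · refine ih.congr (boxSieve_congr (fun x _ _ => ?_) fun _ _ _ => Iff.rfl)
        simp only [Set.mem_ofPred_eq]
        omega
  -- With all wedges present, adjoin the inner faces other than the `j`-th; omitting `j` keeps every
  -- overlap a box in which `j` is missing.
  have h2 : ∀ l, Lifts p (boxSieve (n + 1) Set.univ {x | x < l ∧ x ≠ j}) := by
    intro l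
    induction l with
    | zero => exact (h1 (n + 1)).congr (boxSieve_congr (fun x _ hx => by simpa using hx)
        fun x _ _ => by simp)
    | succ l ih =>
      by_cases hl : 0 < l ∧ l < n + 1 ∧ l ≠ j
      · obtain ⟨hl0, hln, hlj⟩ := hl
        refine (ih.adjoin hi hip hp (Nec.face hl0 hln)
          (fun f => Nec.boxSieve_insert_face hl0 hln Set.univ _ f)
          (hK.pullback_face hl0 hln (j := j) (by simp) hj0 hj (by simp) hlj.symm)).congr
          (boxSieve_congr (fun _ _ _ => Iff.rfl) fun x _ _ => ?_)
        simp only [Set.mem_insert_iff, Set.mem_ofPred_eq]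
        omega
      · refine ih.congr (boxSieve_congr (fun _ _ _ => Iff.rfl) fun x _ _ => ?_)
        simp only [Set.mem_ofPred_eq]
        omega
  refine (h2 (n + 1)).congr (boxSieve_congr (fun _ _ _ => Iff.rfl) fun x _ hx => ?_)
  simpa using fun _ => Nat.le_of_lt_succ hx

end Chains

/-! ## Coefficients in a quiver -/

open scoped TensorProduct DirectSum

namespace KQuiv

noncomputable section

variable {k : Type u} [CommRing k] {S : Type u} {M M' N N' P : KQuiv k S} {a b c : S}

variable (M N a b c) in
/-- The projection `(M ⊗_S N)(a, b) → M(a, c) ⊗ N(c, b)`. -/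
def proj : (tensor M N).obj a b →ₗ[k] M.obj a c ⊗[k] N.obj c b :=
  DirectSum.component k S (fun c => M.obj a c ⊗[k] N.obj c b) c

lemma proj_incl (x : M.obj a c ⊗[k] N.obj c b) : proj M N a b c (incl M N a b c x) = x := by
  classical
  exact DirectSum.component.lof_self (M := fun c => M.obj a c ⊗[k] N.obj c b) k c x

lemma proj_tmk (m : M.obj a c) (n : N.obj c b) : proj M N a b c (tmk M N c m n) = m ⊗ₜ n :=
  proj_incl _

lemma proj_tmk_ne {d : S} (h : d ≠ c) (m : M.obj a d) (n : N.obj d b) :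
    proj M N a b c (tmk M N d m n) = 0 := by
  classical
  exact (DirectSum.component.of (M := fun c => M.obj a c ⊗[k] N.obj c b) k c d (m ⊗ₜ n)).trans (dif_neg h)

lemma proj_map (f : M ⟶ M') (x : (tensor M N).obj a b) :
    proj M' N a b c (app (map f (𝟙 N)) a b x) = (app f a c).rTensor _ (proj M N a b c x) := by
  refine tensor_ind (p := fun x => proj M' N a b c (app (map f (𝟙 N)) a b x) =
    (app f a c).rTensor _ (proj M N a b c x)) ?_ (fun x y hx hy => ?_) (fun d m n => ?_) x
  · simp only [map_zero]
  · simp only [map_add, hx, hy]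
  · rw [map_tmk]
    by_cases h : d = c
    · subst h
      rw [proj_tmk, proj_tmk]
      rfl
    · rw [proj_tmk_ne h, proj_tmk_ne h, map_zero]

lemma map_incl (f : M ⟶ M') (x : M.obj a c ⊗[k] N.obj c b) :
    app (map f (𝟙 N)) a b (incl M N a b c x) = incl M' N a b c ((app f a c).rTensor _ x) := by
  induction x with
  | zero => simp only [map_zero]
  | tmul m n => exact map_tmk _ _ _ _
  | add x y hx hy => simp only [map_add, hx, hy]

/-- This reduces injectivity, surjectivity and exactness of `M ⊗_S g` to ordinary tensor products,
one intermediate vertex at a time. -/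
lemma app_map_eq_lmap (g : N ⟶ N') :
    (app (map (𝟙 M) g) a b : (tensor M N).obj a b → (tensor M N').obj a b) =
      DirectSum.lmap fun c => (app g c b).lTensor (M.obj a c) := by
  classical
  funext x
  refine tensor_ind (p := fun x => app (map (𝟙 M) g) a b x =
    DirectSum.lmap (fun c => (app g c b).lTensor (M.obj a c)) x) ?_ (fun x y hx hy => ?_)
    (fun d m n => ?_) x
  · exact (map_zero _).trans (map_zero _).symm
  · exact (map_add _ _ _).trans ((congrArg₂ _ hx hy).trans (map_add _ _ _).symm)
  · rw [map_tmk]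
    exact (DirectSum.lmap_lof (f := fun c => (app g c b).lTensor (M.obj a c)) d (m ⊗ₜ n)).symm

lemma lmap_exact {ι : Type*} {A B C : ι → Type*} [∀ i, AddCommGroup (A i)]
    [∀ i, AddCommGroup (B i)] [∀ i, AddCommGroup (C i)] [∀ i, Module k (A i)]
    [∀ i, Module k (B i)] [∀ i, Module k (C i)] (f : ∀ i, A i →ₗ[k] B i)
    (g : ∀ i, B i →ₗ[k] C i) (h : ∀ i, Function.Exact (f i) (g i)) :
    Function.Exact (DirectSum.lmap f) (DirectSum.lmap g) := by
  classical
  rw [LinearMap.exact_iff, DirectSum.ker_lmap, DirectSum.range_lmap]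
  simp only [LinearMap.exact_iff.1 (h _)]

variable (M) in
/-- Levelwise flatness of a quiver. -/
def Flat : Prop := ∀ a b, Module.Flat k (M.obj a b)

lemma Flat.tensor (hM : Flat M) (hN : Flat N) : Flat (tensor M N) := fun a b => by
  have := hM
  have := hN
  have (c : S) : Module.Flat k (M.obj a c) := hM a c
  have (c : S) : Module.Flat k (N.obj c b) := hN c b
  exact inferInstanceAs (Module.Flat k (⨁ c : S, M.obj a c ⊗[k] N.obj c b))

variable (P) in
/-- The quiver of free modules on the elements of `P`. -/
def free : KQuiv k S := ⟨fun c d => ModuleCat.of k (P.obj c d →₀ k)⟩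

variable (P) in
/-- The canonical epimorphism onto `P`. -/
def freeHom : free P ⟶ P := ofApp fun _ _ => Finsupp.linearCombination k id

/-- The elements of the basis of the free quiver. -/
def basis (n : P.obj c b) : (free P).obj c b := Finsupp.single n (1 : k)

/-- The coordinates with respect to the basis of the free quiver. -/
def coeff (n : P.obj c b) : (free P).obj c b →ₗ[k] k := Finsupp.lapply n

lemma coeff_basis (n : P.obj c b) : coeff n (basis n) = 1 := Finsupp.single_eq_same

lemma coeff_basis_ne {n n' : P.obj c b} (h : n' ≠ n) : coeff n' (basis n) = 0 :=
  Finsupp.single_eq_of_ne h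

lemma free_ind {p : (free P).obj c b → Prop} (h0 : p 0) (hadd : ∀ x y, p x → p y → p (x + y))
    (h : ∀ (n : P.obj c b) (r : k), p (r • basis n)) (x : (free P).obj c b) : p x :=
  Finsupp.induction_linear (motive := p) x h0 hadd fun n r => by
    have e : Finsupp.single n r = r • Finsupp.single n (1 : k) := by
      rw [Finsupp.smul_single, smul_eq_mul, mul_one]
    rw [e]
    exact h n r

/-- The kernel of a morphism of quivers. -/
def ker (f : M ⟶ N) : KQuiv k S := ⟨fun c d => ModuleCat.of k (LinearMap.ker (app f c d))⟩

/-- The inclusion of the kernel. -/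
def kerHom (f : M ⟶ N) : ker f ⟶ M := ofApp fun c d => (LinearMap.ker (app f c d)).subtype

lemma kerHom_injective (f : M ⟶ N) (c d : S) : Function.Injective (app (kerHom f) c d) :=
  Subtype.val_injective

lemma kerHom_exact (f : M ⟶ N) (c d : S) : Function.Exact (app (kerHom f) c d) (app f c d) :=
  LinearMap.exact_subtype_ker_map _

lemma freeHom_surjective (c d : S) : Function.Surjective (app (freeHom P) c d) := fun x =>
  ⟨Finsupp.single x 1, (Finsupp.linearCombination_single k 1 x).trans (one_smul k x)⟩

/-- The sole use of flatness in the theorem: `X_T ⊗_S K → X_T ⊗_S F` stays injective. The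
coefficient quivers themselves are arbitrary. -/
lemma Flat.map_injective (hM : Flat M) {g : N ⟶ N'} (hg : ∀ c d, Function.Injective (app g c d)) :
    Function.Injective (app (map (𝟙 M) g) a b) := by
  rw [app_map_eq_lmap]
  exact (DirectSum.lmap_injective _).2 fun c =>
    have := hM a c
    Module.Flat.lTensor_preserves_injective_linearMap _ (hg c b)

lemma map_surjective {g : N ⟶ N'} (hg : ∀ c d, Function.Surjective (app g c d)) :
    Function.Surjective (app (map (𝟙 M) g) a b) := by
  rw [app_map_eq_lmap]
  exact (DirectSum.lmap_surjective _).2 fun c => LinearMap.lTensor_surjective _ (hg c b)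

lemma map_exact {f : P ⟶ N} {g : N ⟶ N'}
    (h : ∀ c d, Function.Exact (app f c d) (app g c d))
    (hg : ∀ c d, Function.Surjective (app g c d)) :
    Function.Exact (app (map (𝟙 M) f) a b) (app (map (𝟙 M) g) a b) := by
  rw [app_map_eq_lmap, app_map_eq_lmap]
  exact lmap_exact _ _ fun c => lTensor_exact _ (h c b) (hg c b)

end

end KQuiv

/-! ### The necklicial modules with quiver coefficients -/

namespace TemplicialModule

noncomputable section

variable {k : Type u} [CommRing k] {S : Type u} (A : TemplicialModule k S) {P Q : KQuiv k S}
  {a b c : S}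

/-- The necklicial module `T ↦ (X_T ⊗_S P)(a, b)`. -/
def tensorNec (P : KQuiv k S) (a b : S) : NecklicialModule k :=
  necklicial A.X ⋙ tensorRight P ⋙ KQuiv.eval a b

/-- Functoriality of `X_• ⊗_S P` in `P`. -/
def tensorNecMap (g : P ⟶ Q) (a b : S) : A.tensorNec P a b ⟶ A.tensorNec Q a b :=
  Functor.whiskerLeft _ (Functor.whiskerRight ((tensoringRight _).map g) (KQuiv.eval a b))

/-- The inclusion `X_•(a, c) ⊗ P(c, b) → (X_• ⊗_S P)(a, b)`. -/
def inclNec (P : KQuiv k S) (a b c : S) :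
    (A.nec a c).tensor (P.obj c b) ⟶ A.tensorNec P a b where
  app T := ModuleCat.ofHom (KQuiv.incl ((necklicial A.X).obj T) P a b c)
  naturality _ _ f := ModuleCat.hom_ext (LinearMap.ext fun x =>
    (KQuiv.map_incl ((necklicial A.X).map f) x).symm)

/-- The projection `(X_• ⊗_S P)(a, b) → X_•(a, c) ⊗ P(c, b)`. -/
def projNec (P : KQuiv k S) (a b c : S) :
    A.tensorNec P a b ⟶ (A.nec a c).tensor (P.obj c b) where
  app T := ModuleCat.ofHom (KQuiv.proj ((necklicial A.X).obj T) P a b c)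
  naturality _ _ f := ModuleCat.hom_ext (LinearMap.ext fun x =>
    KQuiv.proj_map ((necklicial A.X).map f) x)

lemma projNec_inclNec (T : Necᵒᵖ) (x : ((A.nec a c).tensor (P.obj c b)).obj T) :
    (A.projNec P a b c).app T ((A.inclNec P a b c).app T x) = x := KQuiv.proj_incl _

/-- The morphism `x ↦ x ⊗ n` for an element `n` of `P(c, b)`. -/
def tmkNec (n : P.obj c b) (a : S) : A.nec a c ⟶ A.tensorNec P a b where
  app T := ModuleCat.ofHom ((KQuiv.tmkₗ ((necklicial A.X).obj T) P a b c).flip n)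
  naturality _ _ f := ModuleCat.hom_ext (LinearMap.ext fun x =>
    (KQuiv.map_tmk ((necklicial A.X).map f) (𝟙 P) x n).symm)

end

end TemplicialModule

/-- Contraction with a linear form. -/
noncomputable def NecklicialModule.contract {k : Type u} [CommRing k] (Y : NecklicialModule k)
    {N : ModuleCat.{u} k} (φ : N →ₗ[k] k) : Y.tensor N ⟶ Y where
  app T := ModuleCat.ofHom (TensorProduct.rid k (Y.obj T) ∘ₗ φ.lTensor (Y.obj T))
  naturality T U f := ModuleCat.hom_ext (by
    refine TensorProduct.ext' fun y n => ?_
    change φ n • Y.map f y = Y.map f (φ n • y)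
    rw [map_smul])

/-! ### Decomposition for free coefficients -/

namespace TemplicialModule

noncomputable section

variable {k : Type u} [CommRing k] {S : Type u} (A : TemplicialModule k S) {P : KQuiv k S}
  {a b c : S}

/-- The coordinate of `(X_• ⊗_S F)(a, b)` along an element of the basis, for the free quiver
`F` on `P`. -/
def coord (n : P.obj c b) (a : S) : A.tensorNec (KQuiv.free P) a b ⟶ A.nec a c :=
  A.projNec (KQuiv.free P) a b c ≫ (A.nec a c).contract (KQuiv.coeff n)

lemma coord_tmk (n : P.obj c b) {T : Necᵒᵖ} (x : (A.nec a c).obj T)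
    (y : (KQuiv.free P).obj c b) :
    (A.coord n a).app T (KQuiv.tmk ((necklicial A.X).obj T) (KQuiv.free P) c x y) =
      KQuiv.coeff n y • x :=
  congrArg (((A.nec a c).contract (KQuiv.coeff n)).app T) (KQuiv.proj_tmk x y)

lemma coord_tmk_ne {d : S} (h : d ≠ c) (n : P.obj c b) {T : Necᵒᵖ} (x : (A.nec a d).obj T)
    (y : (KQuiv.free P).obj d b) :
    (A.coord n a).app T (KQuiv.tmk ((necklicial A.X).obj T) (KQuiv.free P) d x y) = 0 :=
  (congrArg (((A.nec a c).contract (KQuiv.coeff n)).app T) (KQuiv.proj_tmk_ne h x y)).trans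
    (map_zero _)

/-- The component of `(X_• ⊗_S F)(a, b)` along an element of the basis, for the free quiver `F`
on `P`. -/
def part (T : Necᵒᵖ) (i : Σ c, P.obj c b) : ((necklicial A.X).obj T ⊗ KQuiv.free P).obj a b →ₗ[k]
    ((necklicial A.X).obj T ⊗ KQuiv.free P).obj a b :=
  ((A.coord i.2 a ≫ A.tmkNec (KQuiv.basis i.2) a).app T).hom

lemma part_tmk (T : Necᵒᵖ) (n : P.obj c b) (x : ((necklicial A.X).obj T).obj a c)
    (y : (KQuiv.free P).obj c b) :
    A.part T ⟨c, n⟩ (KQuiv.tmk _ (KQuiv.free P) c x y) =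
      KQuiv.coeff n y • KQuiv.tmk _ (KQuiv.free P) c x (KQuiv.basis n) :=
  (congrArg ((A.tmkNec (KQuiv.basis n) a).app T) (A.coord_tmk n x y)).trans (map_smul _ _ _)

lemma part_tmk_ne {d : S} (h : d ≠ c) (T : Necᵒᵖ) (n : P.obj c b)
    (x : ((necklicial A.X).obj T).obj a d) (y : (KQuiv.free P).obj d b) :
    A.part T ⟨c, n⟩ (KQuiv.tmk _ (KQuiv.free P) d x y) = 0 :=
  (congrArg ((A.tmkNec (KQuiv.basis n) a).app T) (A.coord_tmk_ne h n x y)).trans (map_zero _)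

/-- Asking for the identity on every larger finite set makes the property additive: the union of the
two supports works for the sum. -/
lemma exists_sum_add {ι M : Type*} [AddCommGroup M] [Module k M] {e : ι → M →ₗ[k] M} {x y : M}
    (hx : ∃ s : Finset ι, ∀ s', s ⊆ s' → ∑ i ∈ s', e i x = x)
    (hy : ∃ s : Finset ι, ∀ s', s ⊆ s' → ∑ i ∈ s', e i y = y) :
    ∃ s : Finset ι, ∀ s', s ⊆ s' → ∑ i ∈ s', e i (x + y) = x + y := by
  classical
  obtain ⟨s, hs⟩ := hx
  obtain ⟨t, ht⟩ := hy
  refine ⟨s ∪ t, fun s' h => ?_⟩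
  simp only [map_add, Finset.sum_add_distrib]
  rw [hs s' (Finset.union_subset_left h), ht s' (Finset.union_subset_right h)]

lemma exists_sum_zero {ι M : Type*} [AddCommGroup M] [Module k M] (e : ι → M →ₗ[k] M) :
    ∃ s : Finset ι, ∀ s', s ⊆ s' → ∑ i ∈ s', e i 0 = 0 :=
  ⟨∅, fun _ _ => Finset.sum_eq_zero fun _ _ => map_zero _⟩

/-- On `m ⊗ r n`, with `n` a basis element over the vertex `c`, the component at `(c, n)` is the
identity and all others vanish. Such tensors span. -/
lemma sum_part (T : Necᵒᵖ) (x : ((necklicial A.X).obj T ⊗ KQuiv.free P).obj a b) :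
    ∃ s : Finset (Σ c, P.obj c b), ∀ s', s ⊆ s' → ∑ i ∈ s', A.part T i x = x := by
  refine KQuiv.tensor_ind (p := fun x => ∃ s : Finset (Σ c, P.obj c b), ∀ s', s ⊆ s' →
    ∑ i ∈ s', A.part T i x = x) (exists_sum_zero _) (fun x y => exists_sum_add) (fun c m y => ?_) x
  refine KQuiv.free_ind (p := fun y => ∃ s : Finset (Σ c, P.obj c b), ∀ s', s ⊆ s' →
    ∑ i ∈ s', A.part T i (KQuiv.tmk _ (KQuiv.free P) c m y) = KQuiv.tmk _ (KQuiv.free P) c m y)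
    ?_ (fun x y => ?_) (fun n r => ?_) y
  · simp only [KQuiv.tmk_zero_right]
    exact exists_sum_zero _
  · simp only [KQuiv.tmk_add_right]
    exact exists_sum_add
  · refine ⟨{⟨c, n⟩}, fun s' h => (Finset.sum_eq_single_of_mem _
      (h (Finset.mem_singleton_self _)) fun i _ hi => ?_).trans ?_⟩
    · obtain ⟨d, n'⟩ := i
      by_cases hd : c = d
      · subst hd
        have hn : n' ≠ n := fun e => hi (by rw [e])
        rw [part_tmk, map_smul, KQuiv.coeff_basis_ne hn, smul_zero, zero_smul]
      · exact A.part_tmk_ne hd T n' m _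
    · rw [part_tmk, map_smul, KQuiv.coeff_basis, KQuiv.tmk_smul_right, smul_eq_mul, mul_one]

variable {A}

lemma LevelwiseFlat.beads (hA : A.LevelwiseFlat) {p : ℕ} (z a : Fin (p + 1))
    (l : List (Fin (p + 1))) : KQuiv.Flat (beads A.X z a l) := by
  induction l generalizing a with
  | nil => exact hA _
  | cons b l ih => exact KQuiv.Flat.tensor (fun c d => hA _ c d) (ih b)

lemma LevelwiseFlat.necklicial (hA : A.LevelwiseFlat) (T : Necᵒᵖ) :
    KQuiv.Flat ((necklicial A.X).obj T) := hA.beads _ _ _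

/-- Filling of a finitely generated sieve passes from the necklicial modules `X_•(a, c)` to
`(X_• ⊗_S F)(a, b)` for a free quiver `F`. -/
lemma fills_free {U : Nec} {R : Sieve U} {J : Type*} [Finite J] {V : J → Nec} (g : ∀ j, V j ⟶ U)
    (hg : ∀ j, R (g j)) (hR : ∀ {T : Nec} (f : T ⟶ U), R f → ∃ j, ∃ h : T ⟶ V j, h ≫ g j = f)
    (h : ∀ c, Fills (A.nec a c) R) : Fills (A.tensorNec (KQuiv.free P) a b) R :=
  Fills.of_decomposition (fun i : Σ c, P.obj c b => A.tmkNec (KQuiv.basis i.2) a)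
    (fun i => A.coord i.2 a) (fun T x => A.sum_part T x) g hg hR fun i => h i.1

end

end TemplicialModule

/-! ## Appending a bead -/

section AppendAux

variable {V : Type*} [Category V] [MonoidalCategory V] {A B B' C L L' M R R' : V}

/-- The identities of this section are the coherence steps behind the naturality of `append`. They
are stated for arbitrary objects, so that the inductions on joints can use them up to definitional
unfolding of `beads`. -/
lemma append_nil_aux (t : B' ⟶ B) {c : M ⟶ C} {c' : M ⟶ R} {r : R ⟶ C} (h : c' ≫ r = c) :
    t ▷ M ≫ B ◁ c = B' ◁ c' ≫ (t ⊗ₘ r) := by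
  rw [← h, MonoidalCategory.tensorHom_def, whisker_exchange_assoc, MonoidalCategory.whiskerLeft_comp]

lemma append_active_aux (t : B' ⟶ B) {s : L' ⟶ L} {c : L ⊗ M ⟶ R} {c' : L' ⊗ M ⟶ R'}
    {s' : R' ⟶ R} (h : s ▷ M ≫ c = c' ≫ s') :
    (t ⊗ₘ s) ▷ M ≫ (α_ B L M).hom ≫ B ◁ c = ((α_ B' L' M).hom ≫ B' ◁ c') ≫ (t ⊗ₘ s') := by
  rw [← MonoidalCategory.tensorHom_id, associator_naturality_assoc,
    MonoidalCategory.tensorHom_id, ← MonoidalCategory.id_tensorHom,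
    ← MonoidalCategory.id_tensorHom, Category.assoc, tensorHom_comp_tensorHom,
    tensorHom_comp_tensorHom, h, Category.comp_id, Category.id_comp]

lemma append_cut_aux (d : A ⟶ B ⊗ C) (c : L ⊗ M ⟶ R) :
    (d ▷ L ≫ (α_ B C L).hom) ▷ M ≫ (α_ B (C ⊗ L) M).hom ≫ B ◁ ((α_ C L M).hom ≫ C ◁ c) =
      ((α_ A L M).hom ≫ A ◁ c) ≫ d ▷ R ≫ (α_ B C R).hom := by
  simp only [comp_whiskerRight, Category.assoc, MonoidalCategory.whiskerLeft_comp]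
  rw [whisker_exchange_assoc, ← associator_naturality_left_assoc,
    associator_naturality_right, pentagon_assoc]

lemma append_self_aux {s : L ⟶ L'} {c : L ⊗ M ⟶ R} {c' : L' ⊗ M ⟶ R'} {s' : R ⟶ R'}
    (h : s ▷ M ≫ c' = c ≫ s') :
    (B ◁ s) ▷ M ≫ (α_ B L' M).hom ≫ B ◁ c' = ((α_ B L M).hom ≫ B ◁ c) ≫ B ◁ s' := by
  rw [associator_naturality_middle_assoc, ← MonoidalCategory.whiskerLeft_comp, h,
    MonoidalCategory.whiskerLeft_comp, Category.assoc]

lemma append_ne_aux {s : L ⟶ L'} {c : L ⊗ M ⟶ R} {c' : L' ⊗ M ⟶ R'} {s' : R ⟶ R'}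
    (h : s ▷ M ≫ c' = c ≫ s') {d : A ⟶ B ⊗ L} {e : A ⊗ M ⟶ C} {d' : C ⟶ B ⊗ R}
    (h' : d ▷ M ≫ (α_ B L M).hom ≫ B ◁ c = e ≫ d') :
    (d ≫ B ◁ s) ▷ M ≫ (α_ B L' M).hom ≫ B ◁ c' = e ≫ d' ≫ B ◁ s' := by
  rw [← reassoc_of% h', ← MonoidalCategory.whiskerLeft_comp, ← h, comp_whiskerRight,
    Category.assoc, associator_naturality_middle_assoc, ← MonoidalCategory.whiskerLeft_comp]

end AppendAux

section Append

open Nec (left)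

variable {V : Type*} [Category V] (X : Fintᵒᵖ ⥤ V) {p q : ℕ} (m : ℕ)

/-- The morphism `f + id_[m]`. -/
abbrev extend (f : (⟨p⟩ : Fint) ⟶ ⟨q⟩) : (⟨p + m⟩ : Fint) ⟶ ⟨q + m⟩ :=
  Fint.add f (𝟙 (⟨m⟩ : Fint))

/-- The identification of `X_m` with the last bead of a wedge. -/
def lastBead (p m : ℕ) :
    X.obj (op ⟨m⟩) ≅ bead X (left m (Fin.last p)) (Fin.last (p + m)) :=
  X.mapIso (Fint.castIso (m := seg (left m (Fin.last p)) (Fin.last (p + m))) (n := ⟨m⟩)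
    (Nat.add_sub_cancel_left p m)).op

/-- A bead depends only on the difference of its joints, so the two sides have the same source and
target by definition; and `f + id` agrees with `f` up to `p`. -/
lemma beadMap_left (f : (⟨p⟩ : Fint) ⟶ ⟨q⟩) {a b : Fin (p + 1)} {a' b' : Fin (q + 1)}
    (ha : Fint.fn f a = a') (hb : Fint.fn f b = b') (hab : a ≤ b)
    (ha' : Fint.fn (extend m f) (left m a) = left m a')
    (hb' : Fint.fn (extend m f) (left m b) =
      left m b') :
    beadMap X (extend m f) ha' hb' =
      beadMap X f ha hb := by
  have key : restr (extend m f) ha' hb' =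
      (restr f ha hb : seg a b ⟶ seg a' b') := Fint.hom_ext_val fun i hi => by
    have hi' : i ≤ (b : ℕ) - a := hi
    have hab' : (a : ℕ) ≤ b := hab
    have hb2 : (b : ℕ) ≤ p := Nat.le_of_lt_succ b.2
    have e (j : ℕ) (hj : j ≤ p) :
        Fint.val (extend m f) j = Fint.val f j := by
      refine (Fint.val_add f (𝟙 (⟨m⟩ : Fint)) (i := j) (by dsimp only; omega)).trans ?_
      dsimp only
      rw [Nat.sub_eq_zero_of_le hj, Fint.val_zero, add_zero]
    refine (val_restr ha' hb' hi).trans (Eq.trans ?_ (val_restr ha hb hi').symm)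
    exact congrArg₂ _ (e _ (show (a : ℕ) + i ≤ p by omega))
      (e _ (show (a : ℕ) ≤ p by omega))
  exact congrArg (fun t => X.map (Quiver.Hom.op t)) key

/-- On the last `m` steps `f + id` is a translation, so its restriction to the last bead is the
identity of `[m]` up to the identifications of the two ordinals. -/
lemma lastBead_beadMap (f : (⟨p⟩ : Fint) ⟶ ⟨q⟩)
    (ha : Fint.fn (extend m f)
      (left m (Fin.last p)) = left m (Fin.last q))
    (hb : Fint.fn (extend m f)
      (Fin.last _) = Fin.last _) :
    (lastBead X q m).hom ≫
        beadMap X (extend m f) ha hb =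
      (lastBead X p m).hom := by
  refine (X.map_comp _ _).symm.trans (congrArg X.map ?_)
  refine Quiver.Hom.unop_inj (Fint.hom_ext_val fun i hi => ?_)
  have hi' : i ≤ p + m - p := hi
  refine (Fint.val_comp _ _ i).trans ?_
  have h1 : Fint.val (restr (extend m f) ha hb) i =
      i := by
    refine (val_restr ha hb hi).trans ?_
    have e (j : ℕ) (hj : j ≤ p + m) (hj' : p ≤ j) :
        Fint.val (extend m f) j = q + (j - p) := by
      refine (Fint.val_add f (𝟙 (⟨m⟩ : Fint)) (i := j) hj).trans ?_
      refine congrArg₂ _ (Fint.val_of_ge f hj') (Fint.val_id _ ?_)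
      dsimp only; omega
    refine (congrArg₂ _ (e (p + i) (by omega) (by omega)) (e p (by omega) le_rfl)).trans ?_
    omega
  refine (congrArg (Fint.val _) h1).trans ?_
  refine (Fint.val_castIso_hom (m := seg (left m (Fin.last q)) (Fin.last (q + m)))
    (n := ⟨m⟩) (Nat.add_sub_cancel_left q m) ?_).trans
    (Fint.val_castIso_hom (m := seg (left m (Fin.last p)) (Fin.last (p + m)))
    (n := ⟨m⟩) (Nat.add_sub_cancel_left p m) ?_).symm
  · change i ≤ q + m - q; omega
  · exact hi'

variable [MonoidalCategory V]

/-- Appending a bead of length `m`. -/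
def append : ∀ (a : Fin (p + 1)) (l : List (Fin (p + 1))),
    beads X (Fin.last p) a l ⊗ X.obj (op ⟨m⟩) ≅
      beads X (Fin.last (p + m)) (left m a) (l.map (left m) ++ [left m (Fin.last p)])
  | a, [] => whiskerLeftIso (bead X a (Fin.last p)) (lastBead X p m)
  | a, b :: l => (α_ _ _ _) ≪≫ whiskerLeftIso (bead X a b) (append b l)

lemma append_active (f : (⟨p⟩ : Fint) ⟶ ⟨q⟩) {a : Fin (p + 1)} {a' : Fin (q + 1)}
    (ha : Fint.fn f a = a') {l : List (Fin (p + 1))} {l' : List (Fin (q + 1))}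
    (hl : l.map (Fint.fn f) = l') (hs : Sorted (Fin.last p) a l)
    (hl' : (l.map (left m) ++ [left m (Fin.last p)]).map
      (Fint.fn (extend m f)) =
        l'.map (left m) ++ [left m (Fin.last q)])
    (ha' : Fint.fn (extend m f) (left m a) =
      left m a') :
    active X f (Fint.fn_last f) ha hl ▷ X.obj (op ⟨m⟩) ≫ (append X m a l).hom =
      (append X m a' l').hom ≫ active X
        (extend m f) (Fint.fn_last _) ha' hl' := by
  induction l generalizing a a' l' with
  | nil =>
    subst hl
    have e1 := beadMap_left X m f ha (Fint.fn_last f) hs ha' (List.cons.inj hl').1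
    have e2 := lastBead_beadMap X m f (List.cons.inj hl').1 (Fint.fn_last _)
    refine (append_nil_aux (beadMap X f ha (Fint.fn_last f)) e2).trans ?_
    exact congrArg (fun t => bead X a' (Fin.last q) ◁ (lastBead X q m).hom ≫
      (t ⊗ₘ beadMap X (extend m f) (List.cons.inj hl').1 (Fint.fn_last _))) e1.symm
  | cons b l ih =>
    subst hl
    have e1 := beadMap_left X m f ha rfl hs.1 ha' (List.cons.inj hl').1
    have i := ih (a' := Fint.fn f b) rfl (l' := l.map (Fint.fn f)) rfl hs.2
      (List.cons.inj hl').2 (List.cons.inj hl').1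
    refine (append_active_aux (beadMap X f ha rfl) i).trans ?_
    exact congrArg (fun t => (append X m a' (Fint.fn f b :: l.map (Fint.fn f))).hom ≫ (t ⊗ₘ
      active X (extend m f) (Fint.fn_last _) (List.cons.inj hl').1 (List.cons.inj hl').2)) e1.symm

variable [X.OplaxMonoidal]

/-- Cutting acts on the first bead and appending at the far end; the two commute by interchange and
the pentagon. -/
lemma append_cut (a b : Fin (p + 1)) (l : List (Fin (p + 1))) :
    cut X (Fin.last p) a b l ▷ X.obj (op ⟨m⟩) ≫ (α_ _ _ _).hom ≫
        bead X a b ◁ (append X m b l).hom =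
      (append X m a l).hom ≫ cut X (Fin.last (p + m)) (left m a) (left m b)
        (l.map (left m) ++ [left m (Fin.last p)]) := by
  cases l with
  | nil =>
    change comul X a b (Fin.last p) ▷ X.obj (op ⟨m⟩) ≫ (α_ _ _ _).hom ≫
        bead X a b ◁ bead X b (Fin.last p) ◁ (lastBead X p m).hom =
      bead X a (Fin.last p) ◁ (lastBead X p m).hom ≫ comul X a b (Fin.last p) ▷ _ ≫ (α_ _ _ _).hom
    rw [← associator_naturality_right, whisker_exchange_assoc]
  | cons c l => exact append_cut_aux (comul X a b c) (append X m c l).hom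

variable [IsIso (η X)]

/-- `subdiv` branches on whether the heads agree. If `b` is repeated both branches apply, and the
counit makes them equal. Such repetitions do arise after appending: for `l₁ = []` and `b` the last
vertex, the added joint coincides with `b`. -/
lemma subdiv_cons_of_sublist {z a b : Fin (p + 1)} {l₁ l₂ : List (Fin (p + 1))}
    (h : l₁.Sublist (b :: l₂)) (h' : l₁.Sublist l₂) (hab : a ≤ b) (hs : Sorted z b l₂) :
    subdiv X (z := z) (a := a) h = cut X z a b l₁ ≫ bead X a b ◁ subdiv X h' := by
  by_cases hd : ∃ t, l₁ = b :: t
  · obtain ⟨t, rfl⟩ := hd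
    have ht : t.Sublist l₂ := (List.sublist_cons_self _ _).trans h'
    rw [cut_self X hab (hs.sublist ht), ← MonoidalCategory.whiskerLeft_comp]
    exact (subdiv_cons_self X h).trans (congrArg _ (subdiv_unit_cons X h' ht hs).symm)
  · exact subdiv_cons_ne X h h' fun t e => hd ⟨t, e⟩

lemma Sorted.append {a : Fin (p + 1)} {l : List (Fin (p + 1))} (h : Sorted (Fin.last p) a l) :
    Sorted (Fin.last (p + m)) (left m a) (l.map (left m) ++ [left m (Fin.last p)]) := by
  induction l generalizing a with
  | nil => exact ⟨h, Fin.le_last _⟩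
  | cons b l ih => exact ⟨h.1, ih h.2⟩

/-- Induction on the finer list. A common first joint is carried along; a new one is inserted by
`cut`, which commutes with appending by `append_cut`. -/
lemma append_subdiv {a : Fin (p + 1)} {l₁ l₂ : List (Fin (p + 1))} (h : l₁.Sublist l₂)
    (h' : (l₁.map (left m) ++ [left m (Fin.last p)]).Sublist
      (l₂.map (left m) ++ [left m (Fin.last p)]))
    (hs : Sorted (Fin.last p) a l₂) :
    subdiv X h ▷ X.obj (op ⟨m⟩) ≫ (append X m a l₂).hom =
      (append X m a l₁).hom ≫ subdiv X h' := by
  induction l₂ generalizing a l₁ with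
  | nil =>
    cases List.sublist_nil.1 h
    rw [subdiv_refl, subdiv_refl, id_whiskerRight, Category.id_comp, Category.comp_id]
  | cons b l₂ ih =>
    by_cases hc : ∃ t, l₁ = b :: t
    · obtain ⟨t, rfl⟩ := hc
      have i := ih (List.cons_sublist_cons.1 h) (List.cons_sublist_cons.1 h') hs.2
      rw [subdiv_cons_self]
      exact (append_self_aux i).trans (congrArg ((append X m a (b :: t)).hom ≫ ·)
        (subdiv_cons_self X (a := left m a) (b := left m b) h').symm)
    · have hc' : ∀ t, l₁ ≠ b :: t := fun t e => hc ⟨t, e⟩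
      have hh := sublist_of_not_head h hc'
      have hh' := (hh.map (left m)).append (List.Sublist.refl [left m (Fin.last p)])
      have i := ih hh hh' hs.2
      have e := subdiv_cons_of_sublist X (a := left m a) (b := left m b)
        (z := Fin.last (p + m)) h' hh' hs.1 (hs.2.append m)
      rw [subdiv_cons_ne X h hh hc']
      exact (append_ne_aux i (append_cut X m a b l₁)).trans
        (congrArg ((append X m a l₁).hom ≫ ·) e.symm)

end Append

/-! ## Values on wedges -/

open Nec (left wedge wedgeMap wedgeSimp)

namespace Nec

lemma len_pos {T U : Nec} (f : T ⟶ U) (hU : 0 < U.len) : 0 < T.len := by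
  refine Nat.pos_of_ne_zero fun h => ?_
  have h1 := Fint.val_of_ge f.toFint (le_refl T.len)
  have h2 : Fint.val f.toFint T.len = 0 := (congrArg _ h).trans (Fint.val_zero _)
  exact hU.ne (h2.symm.trans h1)

/-- Positivity of both lengths makes the gluing vertex an inner joint. Both lists are then
increasing, without repetition and with the same elements. -/
lemma wedge_inner {T : Nec} {m : ℕ} (hT : 0 < T.len) (hm : 0 < m) :
    T.inner.map (left m) ++ [left m (Fin.last T.len)] = (wedge T m).inner := by
  have hlt : ∀ t ∈ T.inner.map (left m), t < left m (Fin.last T.len) := by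
    intro t ht
    obtain ⟨s, hs, rfl⟩ := List.mem_map.1 ht
    have h1 := (mem_inner.1 hs).2.2
    have h2 : s < Fin.last _ := lt_of_le_of_ne (Fin.le_last s) h1
    exact h2
  have hinj : Function.Injective (left m : Fin (T.len + 1) → Fin (T.len + m + 1)) :=
    fun i j h => Fin.ext (show (left m i : ℕ) = left m j from congrArg Fin.val h)
  refine List.Perm.eq_of_pairwise' (r := (· ≤ ·)) ?_ (Finset.pairwise_sort _ (· ≤ ·)) ?_
  · refine List.pairwise_append.2 ⟨(Finset.pairwise_sort _ (· ≤ ·)).map (left m)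
      (S := (· ≤ ·)) fun _ _ h => h,
      List.pairwise_singleton _ _, fun x hx y hy => ?_⟩
    rw [List.mem_singleton.1 hy]
    exact (hlt x hx).le
  · refine (List.perm_ext_iff_of_nodup ?_ (Finset.sort_nodup _ (· ≤ ·))).2 fun x => ?_
    · refine List.nodup_append.2 ⟨(Finset.sort_nodup _ (· ≤ ·)).map hinj, List.nodup_singleton _,
        fun x hx y hy => ?_⟩
      rw [List.mem_singleton.1 hy]
      exact (hlt x hx).ne
    · refine Iff.trans ?_ (mem_inner (T := wedge T m)).symm
      have hlast : (left m (Fin.last T.len) : Fin (T.len + m + 1)) ≠ Fin.last (T.len + m) :=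
        fun e => by
          have := congrArg Fin.val e
          simp only [left_val, Fin.val_last] at this
          omega
      rw [List.mem_append, List.mem_singleton, List.mem_map]
      constructor
      · rintro (⟨t, ht, rfl⟩ | rfl)
        · obtain ⟨h1, h2, h3⟩ := mem_inner.1 ht
          refine ⟨Finset.mem_insert_of_mem (Finset.mem_image_of_mem _ h1),
            fun e => h2 (hinj e), fun e => ?_⟩
          exact (hlt _ (List.mem_map_of_mem ht)).not_ge (e ▸ Fin.le_last _)
        · refine ⟨Finset.mem_insert_of_mem (Finset.mem_image_of_mem _ T.last_mem),
            fun e => ?_, hlast⟩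
          have h : T.len = 0 := congrArg Fin.val e
          omega
      · rintro ⟨h1, h2, h3⟩
        obtain ⟨t, ht, rfl⟩ := Finset.mem_image.1 ((Finset.mem_insert.1 h1).resolve_left h3)
        by_cases h : t = Fin.last _
        · exact Or.inr (by rw [h])
        · exact Or.inl ⟨t, mem_inner.2 ⟨ht, fun e => h2 (by rw [e]; rfl), h⟩, rfl⟩

end Nec

/-! ### The identification of `X_T ⊗ X_m` with `X_{T ∨ Δ^m}` -/

section WedgeIso

variable {V : Type*} [Category V] [MonoidalCategory V] (X : Fintᵒᵖ ⥤ V) [X.OplaxMonoidal]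
  [IsIso (η X)] {p q : ℕ} (m : ℕ)

/-- The inner joints of a wedge equal the appended list only propositionally. Keeping all lists
variable lets substitution remove the `eqToIso` terms before naturality is checked. -/
lemma append_map (f : (⟨p⟩ : Fint) ⟶ ⟨q⟩) {a : Fin (p + 1)} {a' : Fin (q + 1)}
    (ha : Fint.fn f a = a') {l : List (Fin (p + 1))} {l' l₂ : List (Fin (q + 1))}
    {L : List (Fin (p + m + 1))} {L' L₂ : List (Fin (q + m + 1))}
    (hl : l.map (Fint.fn f) = l₂) (h : l'.Sublist l₂)
    (e : l.map (left m) ++ [left m (Fin.last p)] = L)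
    (e' : l'.map (left m) ++ [left m (Fin.last q)] = L')
    (hL : L.map (Fint.fn (extend m f)) = L₂) (h' : L'.Sublist L₂)
    (ha' : Fint.fn (extend m f) (left m a) = left m a') (hs : Sorted (Fin.last p) a l) :
    (subdiv X h ≫ active X f (Fint.fn_last f) ha hl) ▷ X.obj (op ⟨m⟩) ≫
        (append X m a l ≪≫ eqToIso (congrArg (beads X (Fin.last (p + m)) (left m a)) e)).hom =
      (append X m a' l' ≪≫ eqToIso (congrArg (beads X (Fin.last (q + m)) (left m a')) e')).hom ≫
        subdiv X h' ≫ active X (extend m f) (Fint.fn_last _) ha' hL := by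
  have e₂ : l₂.map (left m) ++ [left m (Fin.last q)] = L₂ := by
    subst e hL hl
    rw [List.map_append, List.map_map, List.map_map]
    refine congrArg₂ _ (List.map_congr_left fun i _ => (Nec.fn_add_left m f i).symm) ?_
    exact congrArg (fun t => [t]) ((congrArg (left m) (Fint.fn_last f)).symm.trans
      (Nec.fn_add_left m f _).symm)
  subst e e' e₂
  simp only [eqToIso_refl, Iso.trans_refl]
  rw [comp_whiskerRight, Category.assoc, append_active X m f ha hl hs hL ha',
    reassoc_of% append_subdiv X m h h' (hl ▸ hs.map f (Fint.fn_last f) ha)]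

/-- The identification `X_T ⊗ X_m = X_{T ∨ Δ^m}`. -/
def wedgeIso {T : Nec} {m : ℕ} (hT : 0 < T.len) (hm : 0 < m) :
    (necklicial X).obj (op T) ⊗ X.obj (op ⟨m⟩) ≅ (necklicial X).obj (op (wedge T m)) :=
  append X m 0 T.inner ≪≫
    eqToIso (congrArg (beads X (Fin.last (T.len + m)) (left m 0)) (Nec.wedge_inner hT hm))

lemma wedgeIso_natural {T U : Nec} {m : ℕ} (f : T ⟶ U) (hT : 0 < T.len) (hU : 0 < U.len)
    (hm : 0 < m) :
    (necklicial X).map f.op ▷ X.obj (op ⟨m⟩) ≫ (wedgeIso X hT hm).hom =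
      (wedgeIso X hU hm).hom ≫ (necklicial X).map (wedgeMap f m).op :=
  append_map X m f.toFint (Fint.fn_zero _) rfl (Nec.Hom.inner_sublist f) (Nec.wedge_inner hT hm)
    (Nec.wedge_inner hU hm) rfl (Nec.Hom.inner_sublist (wedgeMap f m))
    (Fint.fn_zero (wedgeMap f m).toFint) T.inner_sorted

end WedgeIso

namespace TemplicialModule

noncomputable section

variable {k : Type u} [CommRing k] {S : Type u} (A : TemplicialModule k S) (P : KQuiv k S)
  (a b : S) {T U : Nec} {m : ℕ}

/-- The identification `X_T ⊗ (X_m ⊗ P) = X_{T ∨ Δ^m} ⊗ P`. -/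
def tensorNecWedge (hT : 0 < T.len) (hm : 0 < m) :
    (A.tensorNec (A.X.obj (op ⟨m⟩) ⊗ P) a b).obj (op T) ≅
      (A.tensorNec P a b).obj (op (wedge T m)) :=
  (KQuiv.eval a b).mapIso ((α_ _ _ _).symm ≪≫ whiskerRightIso (wedgeIso A.X hT hm) P)

lemma tensorNecWedge_natural (f : T ⟶ U) (hT : 0 < T.len) (hU : 0 < U.len) (hm : 0 < m) :
    (A.tensorNec (A.X.obj (op ⟨m⟩) ⊗ P) a b).map f.op ≫ (A.tensorNecWedge P a b hT hm).hom =
      (A.tensorNecWedge P a b hU hm).hom ≫ (A.tensorNec P a b).map (wedgeMap f m).op := by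
  have e : (necklicial A.X).map f.op ▷ (A.X.obj (op ⟨m⟩) ⊗ P) ≫
        ((α_ _ _ _).inv ≫ (wedgeIso A.X hT hm).hom ▷ P) =
      ((α_ _ _ _).inv ≫ (wedgeIso A.X hU hm).hom ▷ P) ≫
        (necklicial A.X).map (wedgeMap f m).op ▷ P := by
    rw [associator_inv_naturality_left_assoc, ← comp_whiskerRight, wedgeIso_natural,
      comp_whiskerRight, Category.assoc]
  exact congrArg (KQuiv.eval a b).map e

end

end TemplicialModule

/-! ## Filling boxes with coefficients -/

namespace Nec

/-- The inclusion `Δ^i ∨ Δ^m → Δ^n` for `n = i + m`. -/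
def wedgeSimpOfEq {i m n : ℕ} (h : i + m = n) : wedge (simp i) m ⟶ simp n :=
  wedgeSimp i m ≫ eqToHom (congrArg simp h)

lemma hits_iff_wedgeSimpOfEq {i m n : ℕ} (h : i + m = n) {T : Nec} (f : T ⟶ simp n) :
    Hits f i ↔ ∃ h' : T ⟶ wedge (simp i) m, h' ≫ wedgeSimpOfEq h = f := by
  subst h
  rw [hits_iff_wedgeSimp, wedgeSimpOfEq, eqToHom_refl, Category.comp_id]

lemma wedgeMap_wedgeSimp_toFint (x l m : ℕ) :
    (wedgeMap (wedgeSimp x l) m).toFint = 𝟙 (⟨x + l + m⟩ : Fint) :=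
  MonoidalCategory.id_tensorHom_id (⟨x + l⟩ : Fint) (⟨m⟩ : Fint)

/-- The map to factor through is the identity on ordinals, so only joints matter. Those of the
coarser wedge are images by assumption on `f`, and `hf` supplies the extra joint `x`. -/
lemma exists_comp_wedgeMap {T : Nec} {x l m : ℕ} (f : T ⟶ wedge (simp (x + l)) m)
    (hf : Hits f x) : ∃ h : T ⟶ wedge (wedge (simp x) l) m,
      h ≫ wedgeMap (wedgeSimp x l) m = f := by
  obtain ⟨t, ht, htx⟩ := hf
  refine ⟨⟨f.toFint, fun i hi => ?_⟩, Hom.ext ?_⟩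
  · rcases Finset.mem_insert.1 hi with rfl | hi
    · exact Finset.mem_image.2 ⟨Fin.last _, T.last_mem, Fint.fn_last f.toFint⟩
    · obtain ⟨s, hs, rfl⟩ := Finset.mem_image.1 hi
      rcases Finset.mem_insert.1 hs with rfl | hs
      · exact f.subset (Finset.mem_insert_of_mem (Finset.mem_image_of_mem _ (last_mem _)))
      · obtain ⟨r, hr, rfl⟩ := Finset.mem_image.1 hs
        rcases Finset.mem_insert.1 hr with rfl | hr
        · exact Finset.mem_image.2 ⟨0, T.zero_mem, Fint.fn_zero f.toFint⟩
        · obtain rfl := Finset.mem_singleton.1 hr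
          exact Finset.mem_image.2 ⟨t, ht, Fin.ext htx⟩
  · rw [comp_toFint, wedgeMap_wedgeSimp_toFint]
    exact Category.comp_id _

lemma hits_wedgeMap {T : Nec} {i m x : ℕ} {h : T ⟶ simp i} (hh : Hits h x) :
    Hits (wedgeMap h m ≫ wedgeSimp i m) x := by
  obtain ⟨t, ht, rfl⟩ := hh
  exact ⟨left m t, Finset.mem_insert_of_mem (Finset.mem_image_of_mem _ ht),
    congrArg Fin.val (fn_add_left m h.toFint t)⟩

end Nec

open Nec (wedge wedgeMap wedgeSimp)

namespace TemplicialModule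

noncomputable section

variable {k : Type u} [CommRing k] {S : Type u} {A : TemplicialModule k S} {P : KQuiv k S}
  {a b : S}

lemma tensorNecWedge_inv_natural {T U : Nec} {m : ℕ} (f : T ⟶ U) (hT : 0 < T.len)
    (hU : 0 < U.len) (hm : 0 < m) (x : (A.tensorNec P a b).obj (op (wedge U m))) :
    (A.tensorNecWedge P a b hT hm).inv ((A.tensorNec P a b).map (wedgeMap f m).op x) =
      (A.tensorNec (A.X.obj (op ⟨m⟩) ⊗ P) a b).map f.op
        ((A.tensorNecWedge P a b hU hm).inv x) := by
  have e : (A.tensorNecWedge P a b hU hm).inv ≫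
      (A.tensorNec (A.X.obj (op ⟨m⟩) ⊗ P) a b).map f.op =
        (A.tensorNec P a b).map (wedgeMap f m).op ≫ (A.tensorNecWedge P a b hT hm).inv := by
    rw [Iso.inv_comp_eq, ← Category.assoc, Iso.eq_comp_inv]
    exact A.tensorNecWedge_natural P a b f hT hU hm
  exact (ConcreteCategory.congr_hom e x).symm

/-- The transport of a compatible family on `Δ^i ∨ Δ^m` to `Δ^i`, with coefficients in
`X_m ⊗ P`. -/
def unwedge {i m : ℕ} (hi : 0 < i) (hm : 0 < m)
    (y : SieveFamily (A.tensorNec P a b)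
      ((boxSieve (i + m) {x | x < i} ∅).pullback (wedgeSimp i m))) :
    SieveFamily (A.tensorNec (A.X.obj (op ⟨m⟩) ⊗ P) a b) (boxSieve i Set.univ ∅) where
  val {T} h hh := (A.tensorNecWedge P a b (Nec.len_pos h hi) hm).inv (y.val (wedgeMap h m) (by
    obtain ⟨x, -, h0, hx, hhx⟩ | ⟨x, hx, -⟩ := hh
    · exact Or.inl ⟨x, hx, h0, by omega, Nec.hits_wedgeMap hhx⟩
    · exact absurd hx (Set.notMem_empty x)))
  compat {T T'} v h hh := by
    have hT := Nec.len_pos h hi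
    have hT' := Nec.len_pos (v ≫ h) hi
    refine Eq.trans (congrArg (A.tensorNecWedge P a b hT' hm).inv ?_)
      (tensorNecWedge_inv_natural v hT' hT hm _)
    refine (y.val_congr (Nec.wedgeMap_comp v h m) _).trans ?_
    exact y.compat (wedgeMap v m) (wedgeMap h m) _

/-- Filling of the families on wedges, from filling of smaller boxes. -/
lemma fillsWedges {n : ℕ} (h : ∀ i < n, ∀ Q : KQuiv k S, FillsBoxes (A.tensorNec Q a b) i) :
    FillsWedges (A.tensorNec P a b) n := fun i m hi hm hn y => by
  have hfill : Fills (A.tensorNec (A.X.obj (op ⟨m⟩) ⊗ P) a b) (boxSieve i Set.univ ∅) := by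
    -- For `i > 1` the vertex `1` can play the role of the missing face, as no face is present at
    -- all. For `i = 1` there is no inner vertex and the sieve is empty.
    by_cases hi1 : 1 < i
    · exact h i (by omega) _ 1 ∅ Nat.one_pos hi1 (Set.notMem_empty 1)
    · refine Fills.of_eq_bot ?_
      rintro T f (⟨x, -, h0, hx, -⟩ | ⟨x, hx, -⟩)
      · omega
      · exact hx
  obtain ⟨t, ht⟩ := hfill (unwedge hi hm y)
  refine ⟨(A.tensorNecWedge P a b (T := Nec.simp i) hi hm).hom t, fun T f hf => ?_⟩
  obtain ⟨x, hx, h0, -, hhx⟩ | ⟨x, hx, -⟩ := id hf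
  swap
  · exact absurd hx (Set.notMem_empty x)
  -- The map `f` hits some `x < i`, so it factors through `(Δ^x ∨ Δ^l) ∨ Δ^m` with `x + l = i`. By
  -- compatibility it suffices to check the filler there, where it is the defining property of `t`
  -- transported along `tensorNecWedge`.
  obtain ⟨l, rfl⟩ := Nat.exists_eq_add_of_le (show x ≤ i from le_of_lt hx)
  obtain ⟨g, rfl⟩ := Nec.exists_comp_wedgeMap f hhx
  have hl : 0 < l := by have : x < x + l := hx; omega
  have hν : boxSieve (x + l) Set.univ ∅ (wedgeSimp x l) :=
    Or.inl ⟨x, trivial, h0, hx, (Nec.hits_iff_wedgeSimp _).2 ⟨𝟙 _, Category.id_comp _⟩⟩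
  have e := ConcreteCategory.congr_hom
    (A.tensorNecWedge_natural P a b (wedgeSimp x l) hi hi hm) t
  have e' := ht _ (wedgeSimp x l) hν
  rw [map_op_comp]
  refine (congrArg ((A.tensorNec P a b).map g.op) (e.symm.trans
    (congrArg (A.tensorNecWedge P a b hi hm).hom e'))).trans ?_
  refine (congrArg ((A.tensorNec P a b).map g.op)
    (Iso.inv_hom_id_apply (A.tensorNecWedge P a b hi hm) _)).trans ?_
  exact (y.compat g (wedgeMap (wedgeSimp x l) m) _).symm

/-- Filling of horns with coefficients in a free quiver. -/
lemma fills_horn_free (hA : A.IsQuasiCategory) {n j : ℕ} (hj0 : 0 < j) (hj : j < n + 2) :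
    Fills (A.tensorNec (KQuiv.free P) a b) (boxSieve (n + 2) Set.univ {j}ᶜ) := by
  -- The finitely many generators are the wedges and the faces at the inner vertices `i + 1`, for `i
  -- : Fin (n + 1)`, with the face at `j` left out.
  refine fills_free (J := Fin (n + 1) ⊕ {i : Fin (n + 1) // (i : ℕ) + 1 ≠ j})
    (V := Sum.elim (fun i => wedge (Nec.simp (i + 1)) (n + 1 - i)) fun _ => Nec.simp (n + 1))
    (fun x => match x with
      | .inl i => Nec.wedgeSimpOfEq (show (i : ℕ) + 1 + (n + 1 - i) = n + 2 by omega)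
      | .inr i => Nec.face (Nat.succ_pos (i : Fin (n + 1))) (Nat.succ_lt_succ i.1.2)) ?_ ?_
    fun c => ?_
  · rintro (i | ⟨i, hi⟩)
    · exact Or.inl ⟨i + 1, trivial, Nat.succ_pos _, Nat.succ_lt_succ i.2,
        (Nec.hits_iff_wedgeSimpOfEq _ _).2 ⟨𝟙 _, Category.id_comp _⟩⟩
    · exact Or.inr ⟨i + 1, hi, Nat.succ_pos _, Nat.succ_lt_succ i.2,
        (Nec.misses_iff_face _ _ _).2 ⟨𝟙 _, Category.id_comp _⟩⟩
  · rintro T f (⟨i, -, h0, hi, h⟩ | ⟨i, hij, h0, hi, h⟩)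
    · obtain ⟨i, rfl⟩ := Nat.exists_eq_add_of_le' h0
      exact ⟨.inl ⟨i, Nat.lt_of_succ_lt_succ hi⟩, (Nec.hits_iff_wedgeSimpOfEq _ f).1 h⟩
    · obtain ⟨i, rfl⟩ := Nat.exists_eq_add_of_le' h0
      exact ⟨.inr ⟨⟨i, Nat.lt_of_succ_lt_succ hi⟩, hij⟩, (Nec.misses_iff_face _ _ f).1 h⟩
  · exact NecklicialModule.WeakKan.fills (j := ⟨j, by omega⟩) hj0 hj (hA a c)

/-- For a levelwise flat quasi-category, boxes in `(X_• ⊗_S P)(a, b)` have fillings. -/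
lemma fillsBoxes (hflat : A.LevelwiseFlat) (hA : A.IsQuasiCategory) (n : ℕ) (P : KQuiv k S) :
    FillsBoxes (A.tensorNec P a b) n := by
  induction n using Nat.strong_induction_on generalizing P with
  | _ n ih =>
    match n with
    | 0 => exact fun j _ _ hj => absurd hj (Nat.not_lt_zero j)
    | 1 => exact fun j _ hj0 hj => absurd hj (by omega)
    | n + 2 =>
      refine FillsBoxes.of_horns (ih (n + 1) (Nat.lt_succ_self _) P) fun j hj0 hj => ?_
      -- The cover is `X_• ⊗ F → X_• ⊗ P` with `F` free on the elements of `P`. The induction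
      -- hypothesis is used for the kernel quiver on faces, and for its products with `X_m` on
      -- wedges.
      exact Fills.of_lifts (lifts_horn
        (i := A.tensorNecMap (KQuiv.kerHom (KQuiv.freeHom P)) a b)
        (p := A.tensorNecMap (KQuiv.freeHom P) a b)
        (fun T => (hflat.necklicial (op T)).map_injective (KQuiv.kerHom_injective _))
        (fun T => KQuiv.map_exact (KQuiv.kerHom_exact _) KQuiv.freeHom_surjective)
        (fun T => KQuiv.map_surjective KQuiv.freeHom_surjective)
        (ih (n + 1) (Nat.lt_succ_self _) _) (fillsWedges fun i hi Q => ih i hi Q) hj0 hj)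
        (fills_horn_free hA hj0 hj)

end

end TemplicialModule

end Templicial

theorem mainTheorem2 {k : Type u} [CommRing k] {S : Type u}
    (A : Templicial.TemplicialModule k S) (hflat : A.LevelwiseFlat) (hA : A.IsQuasiCategory)
    (N : ModuleCat.{u} k) (a b : S) :
    Templicial.NecklicialModule.WeakKan
      (Templicial.NecklicialModule.tensor (A.nec a b) N) :=
  Templicial.weakKan_of_fills fun n j hj0 hj =>
    -- With constant coefficients `N`, the module `X_•(a, b) ⊗ N` is the summand of `(X_• ⊗_S P)(a,
    -- b)` with intermediate vertex `b`, and the horn is the box with all faces but the `j`-th.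
    let P : Templicial.KQuiv k S := ⟨fun _ _ => N⟩
    Templicial.Fills.of_retract (A.inclNec P a b b) (A.projNec P a b b)
      (fun T x => A.projNec_inclNec (P := P) (a := a) (b := b) (c := b) T x)
      (Templicial.TemplicialModule.fillsBoxes hflat hA (n + 2) P j {j}ᶜ hj0 hj
        (Set.notMem_compl_iff.2 rfl))
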